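/- Let $d\ge 1$, let $p$ be a probability distribution on $\mathbb{Z}^d$ whose support generates the group $\mathbb{Z}^d$, and let $0<\lambda\le\infty$. Consider the Activated Random Walk (ARW) model $(\eta_t)_{t\ge 0}$ on $\mathbb{Z}^d$: each site contains finitely many particles, each of which is active or passive (sleeping). Each active particle jumps at rate $1$, from $x$ to $x+z$ with probability $p(z)$, and tries to fall asleep at rate $\lambda$; the attempt succeeds if and only if the particle is alone at its site (for $\lambda=\infty$, a lone active particle falls asleep instantly). A sleeping particle does not move and becomes active at the instant when another particle arrives at its site. At time $0$ all particles are active (for $\lambda=\infty$, lone particles fall asleep at once) and the numbers of particles at the sites are i.i.d. Poisson random variables with mean $\mu\ge 0$; the infinite system is the limit, as $M\to\infty$, of the finite systems that start from only those particles that lie initially in $\{-M,\dots,M\}^d$. The system \emph{fixates} if for every $x\in\mathbb{Z}^d$ the state $\eta_t(x)$ of the site $x$ is eventually constant in $t$. Let $$\mu_c=\mu_c(\lambda)=\sup\{\mu\ge 0:\ \text{the system with initial density }\mu\text{ fixates almost surely}\}\in[0,\infty].$$ Then for every $\mu>1$ the system almost surely does not fixate; in particular $\mu_c\le 1$. -/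

import Mathlib

open MeasureTheory ProbabilityTheory Filter
open scoped ENNReal NNReal

noncomputable section

namespace ARW

/-- The vertices of the lattice `ℤ^d`. -/
abbrev Site (d : ℕ) : Type := Fin d → ℤ

/-- The state of one site: `active n` means `n` active particles (`n = 0`: the site is empty),
`passive` means exactly one particle, which is sleeping. -/
inductive SiteState : Type
  | active (n : ℕ)
  | passive

instance : Inhabited SiteState := ⟨.active 0⟩

namespace SiteState

/-- The number of active particles. -/
def numActive : SiteState → ℕ
  | active n => n
  | passive => 0

/-- A particle arrives; a sleeping particle is woken up (`A + S → 2A`). -/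
def add : SiteState → SiteState
  | active n => active (n + 1)
  | passive => active 2

/-- A particle leaves. Only used at sites with at least one active particle. -/
def remove : SiteState → SiteState
  | active n => active (n - 1)
  | passive => active 0

/-- An attempt to sleep: it succeeds if and only if the particle is alone. -/
def sleep : SiteState → SiteState
  | active n => if n = 1 then passive else active n
  | passive => passive

end SiteState

/-- A configuration `η`. -/
abbrev Config (d : ℕ) : Type := Site d → SiteState

/-- An instruction: try to sleep, or jump by the displacement `z`. -/
inductive Instruction (d : ℕ) : Type
  | sleep
  | jump (z : Site d)

instance (d : ℕ) : MeasurableSpace (Instruction d) := ⊤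

/-- The effect on `η` of executing an instruction at the site `x`. -/
def execute {d : ℕ} (η : Config d) (x : Site d) : Instruction d → Config d
  | .sleep => Function.update η x (η x).sleep
  | .jump z =>
      let η' : Config d := Function.update η x (η x).remove
      Function.update η' (x + z) (η' (x + z)).add

/-- Instantaneous reactions. If the sleeping rate is infinite, every lone particle falls asleep at
once; if it is finite there is no instantaneous reaction besides `A + S → 2A`. -/
def settle {d : ℕ} (lam : ℝ≥0∞) (η : Config d) : Config d :=
  fun x => if lam = ⊤ then (η x).sleep else η x

/-- The rate of the clock of one active particle: `1 + λ` (jumps at rate `1` and attempts to sleep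
at rate `λ`) for finite `λ`. For `λ = ∞` sleeping is instantaneous and the clock only governs the
jumps, at rate `1`. -/
def clockRate (lam : ℝ≥0∞) : ℝ := if lam = ⊤ then 1 else 1 + lam.toReal

/-- The probability that an instruction is a sleep instruction: `λ / (1 + λ)` for finite `λ`. For
`λ = ∞` all instructions are jumps, sleeping being taken care of by `settle`. -/
def sleepProb (lam : ℝ≥0∞) : ℝ≥0∞ := if lam = ⊤ then 0 else lam / (1 + lam)

/-- The law of one instruction: sleep with probability `sleepProb λ`, otherwise jump by a
displacement with distribution `p`. -/
def instructionLaw {d : ℕ} (p : PMF (Site d)) (lam : ℝ≥0∞) : Measure (Instruction d) :=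
  sleepProb lam • Measure.dirac Instruction.sleep
    + (1 - sleepProb lam) • (p.map Instruction.jump).toMeasure

/-- The randomness: initial particle numbers `η₀ x`, instructions `τ (x, j)`, and the
waiting times `ξ (x, i, k)` between successive rings of the `i`-th clock of the site `x`. -/
abbrev Noise (d : ℕ) : Type :=
  (Site d → ℕ) × (Site d × ℕ → Instruction d) × (Site d × ℕ × ℕ → ℝ)

/-- The law of the randomness: everything is independent, the initial particle numbers are Poisson
with parameter `mu`, the instructions have law `instructionLaw p lam`, and the waiting times are
exponential, so that the clocks are Poisson processes of rate `clockRate lam`. -/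
def noiseLaw {d : ℕ} (p : PMF (Site d)) (lam : ℝ≥0∞) (mu : ℝ≥0) : Measure (Noise d) :=
  (Measure.infinitePi fun _ : Site d => poissonMeasure mu).prod
    ((Measure.infinitePi fun _ : Site d × ℕ => instructionLaw p lam).prod
      (Measure.infinitePi fun _ : Site d × ℕ × ℕ => expMeasure (clockRate lam)))

lemma clockRate_pos (lam : ℝ≥0∞) : 0 < clockRate lam := by
  unfold clockRate
  split_ifs
  · exact one_pos
  · positivity

lemma sleepProb_le_one (lam : ℝ≥0∞) : sleepProb lam ≤ 1 := by
  unfold sleepProb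
  split_ifs
  · exact zero_le_one
  · exact ENNReal.div_le_of_le_mul (by rw [one_mul]; exact le_add_self)

instance {d : ℕ} (p : PMF (Site d)) (lam : ℝ≥0∞) :
    IsProbabilityMeasure (instructionLaw p lam) := by
  constructor
  simp only [instructionLaw, Measure.add_apply, Measure.smul_apply, measure_univ, smul_eq_mul,
    mul_one]
  exact add_tsub_cancel_of_le (sleepProb_le_one lam)

instance (lam : ℝ≥0∞) : IsProbabilityMeasure (expMeasure (clockRate lam)) :=
  isProbabilityMeasure_expMeasure (clockRate_pos lam)

instance {d : ℕ} (p : PMF (Site d)) (lam : ℝ≥0∞) (mu : ℝ≥0) :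
    IsProbabilityMeasure (noiseLaw p lam mu) := by
  unfold noiseLaw
  infer_instance

/-- The time of the `k`-th ring (`k = 0, 1, …`) of the `i`-th clock of the site `x`. -/
def ringTime {d : ℕ} (ω : Noise d) (x : Site d) (i k : ℕ) : ℝ :=
  ∑ l ∈ Finset.range (k + 1), ω.2.2 (x, i, l)

/-- A snapshot of the evolution: the current time, the current configuration, and the number of
instructions used so far at each site. -/
structure Snapshot (d : ℕ) where
  time : ℝ
  config : Config d
  used : Site d → ℕ

/-- After the snapshot `s`, the next effective ring takes place at time `q.1` at the site `q.2`.
When there are `n` active particles at a site, its first `n` clocks are effective, so that the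
site rings at total rate `n * clockRate lam`. Almost surely no two rings coincide. -/
def IsNextRing {d : ℕ} (ω : Noise d) (s : Snapshot d) (q : ℝ × Site d) : Prop :=
  s.time < q.1 ∧
  (∃ i < (s.config q.2).numActive, ∃ k, ringTime ω q.2 i k = q.1) ∧
  ∀ y, ∀ i < (s.config y).numActive, ∀ k,
    s.time < ringTime ω y i k → q.1 ≤ ringTime ω y i k

open Classical in
/-- The next effective ring, if any. -/
def nextRing {d : ℕ} (ω : Noise d) (s : Snapshot d) : Option (ℝ × Site d) :=
  if h : ∃ q, IsNextRing ω s q then some h.choose else none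

/-- One step of the evolution up to the time horizon `t`: wait for the next effective ring; if it
comes no later than `t`, execute the first unused instruction of the site that rings. -/
def step {d : ℕ} (lam : ℝ≥0∞) (ω : Noise d) (t : ℝ) (s : Snapshot d) : Snapshot d :=
  match nextRing ω s with
  | none => s
  | some (r, x) =>
      if r ≤ t then
        { time := r
          config := settle lam (execute s.config x (ω.2.1 (x, s.used x)))
          used := Function.update s.used x (s.used x + 1) }
      else s

open Classical in
/-- The value that a sequence eventually takes, with a default if it is not eventually constant. -/
def eventualValue {α : Type*} [Inhabited α] (f : ℕ → α) : α :=
  if h : ∃ a, ∀ᶠ k in atTop, f k = a then h.choose else default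

/-- The box `{-M, …, M}^d`. -/
def box (d M : ℕ) : Set (Site d) := {x | ∀ i, |x i| ≤ (M : ℤ)}

open Classical in
/-- At time `0`, only the particles in the box of radius `M` are kept. -/
def initialSnapshot {d : ℕ} (lam : ℝ≥0∞) (ω : Noise d) (M : ℕ) : Snapshot d where
  time := 0
  config := settle lam fun x => if x ∈ box d M then .active (ω.1 x) else .active 0
  used := fun _ => 0

/-- The state at time `t` of the site `x` in the finite system that starts from the particles in
the box of radius `M` only (the particles then move in the whole of `ℤ^d`). Almost surely, there
are finitely many effective rings before `t`. -/
def finiteState {d : ℕ} (lam : ℝ≥0∞) (ω : Noise d) (M : ℕ) (t : ℝ) : Config d := fun x =>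
  eventualValue fun k => ((step lam ω t)^[k] (initialSnapshot lam ω M)).config x

/-- The activated random walk `η_t` on `ℤ^d`, as the limit of the finite systems. -/
def state {d : ℕ} (lam : ℝ≥0∞) (ω : Noise d) (t : ℝ) : Config d := fun x =>
  eventualValue fun M => finiteState lam ω M t x

/-- The system locally fixates: `η_t x` is eventually constant for every site `x`. -/
def Fixates {d : ℕ} (lam : ℝ≥0∞) (ω : Noise d) : Prop :=
  ∀ x : Site d, ∃ a : SiteState, ∃ T : ℝ, ∀ t ≥ T, state lam ω t x = a

/-- The critical density `μ_c`: the supremum of all densities at which the system started from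
i.i.d. Poisson particle numbers fixates almost surely. -/
def criticalDensity {d : ℕ} (p : PMF (Site d)) (lam : ℝ≥0∞) : ℝ≥0∞ :=
  ⨆ (mu : ℝ≥0) (_ : ∀ᵐ ω ∂(noiseLaw p lam mu), Fixates lam ω), (mu : ℝ≥0∞)

end ARW

end

noncomputable section

namespace ARW

section

variable {d : ℕ}

/-! ### Counting -/

/-! A site with at least two particles is active, whatever the sleeping rate. So one may topple in
rounds in which every site keeps one particle and lets all the others follow their next
instructions: these topplings are legal, and a finite system eventually uses every instruction used
in this way (`Good.rounds_subset`). The task is to show that for μ > 1 the rounds use arbitrarily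
many instructions at the origin.

Let G_m(x) be the expected number of visits to 0 at times 0, …, m - 1 of the walk from x whose steps
are the displacements of the instructions, an attempt to sleep being a null step. Run K rounds and
after round j give each particle the weight G_{K-j} of its position. Since G_{k+1}(x) = 1_{x=0} + E
G_k(x+v), the weight of a particle that uses an instruction drops in mean only at the origin, and
there by 1. A particle that stays at x loses G_{k+1}(x) - G_k(x), the probability that the walk from
x is at 0 at time k. These probabilities sum to 1 over x and at most one particle stays per site, so
the staying particles cost at most 1 per round: this is where the density 1 comes from. The final
weight is 0 and the initial weight has mean μ Σ G_K(x), close to μK in a large box. Hence the origin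
uses at least (μ - 1)K instructions, up to fluctuations (`sum_greenR_mul_le`).

The fluctuations are o(K). The variance of the initial weight is at most μK max G_K. The rest is a
sum of orthogonal terms: a site has in mean at most μ new instructions per round
(`tsum_mem_fresh_le`), and an energy identity bounds the summed one-step variances of G_m
(`sum_greenVar_le`), which gives variance at most 2μK G_K(0). Finally max G_K = o(K) for every
nondegenerate walk (`exists_greenR_le`), so Chebyshev's inequality suffices, with no moment or
symmetry assumption on p.

To conclude, unbounded use of the stack at a site contradicts fixation (`Good.not_fixates`):
infinitely many of its instructions are real jumps, and each of them changes the number of particles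
at the moment it is used. This needs the infinite system to be the monotone limit of the finite ones
(`GoodClocks.snapAt_used_le`) and local activity to be bounded uniformly in the box (`ae_good`). The
latter follows from a dominating process on short time windows, whose iterates have bounded
expectations. -/

/-- The number of elements of a set, as an extended nonnegative real. -/
def cnt {α : Type*} (s : Set α) : ℝ≥0∞ := (s.encard : ℝ≥0∞)

lemma cnt_mono {α : Type*} {s t : Set α} (h : s ⊆ t) : cnt s ≤ cnt t :=
  ENat.toENNReal_le.2 (Set.encard_le_encard h)

lemma cnt_insert {α : Type*} {s : Set α} {a : α} (h : a ∉ s) : cnt (insert a s) = cnt s + 1 := by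
  simp [cnt, Set.encard_insert_of_notMem h]

lemma cnt_finset {α : Type*} (s : Finset α) : cnt (s : Set α) = s.card := by
  simp [cnt, Set.encard_coe_eq_coe_finsetCard]

lemma cnt_empty {α : Type*} : cnt (∅ : Set α) = 0 := by simp [cnt]

lemma cnt_eq_tsum {α : Type*} (s : Set α) : cnt s = ∑' a, s.indicator 1 a := by
  rw [cnt, ← ENNReal.tsum_set_one, ← tsum_subtype]
  rfl

/-- The displacement caused by an instruction; an attempt to sleep causes none. -/
def disp : Instruction d → Site d
  | .sleep => 0
  | .jump z => z

/-- The site to which the instruction `a.2` of the stack at `a.1` leads. -/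
def dest (τ : Site d × ℕ → Instruction d) (a : Site d × ℕ) : Site d := a.1 + disp (τ a)

/-- The number of instructions in `E` that lead to `x`. -/
def arrivals (τ : Site d × ℕ → Instruction d) (E : Set (Site d × ℕ)) (x : Site d) : ℝ≥0∞ :=
  cnt {a | a ∈ E ∧ dest τ a = x}

/-- The set of instructions used when `u x` instructions have been used at each site `x`. -/
def usedSet (u : Site d → ℕ) : Set (Site d × ℕ) := {a | a.2 < u a.1}

lemma arrivals_mono (τ : Site d × ℕ → Instruction d) {E F : Set (Site d × ℕ)} (h : E ⊆ F)
    (x : Site d) : arrivals τ E x ≤ arrivals τ F x :=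
  cnt_mono fun _ ha => ⟨h ha.1, ha.2⟩

lemma usedSet_mono {u v : Site d → ℕ} (h : u ≤ v) : usedSet u ⊆ usedSet v :=
  fun a ha => lt_of_lt_of_le ha (h a.1)

lemma usedSet_update (u : Site d → ℕ) (x : Site d) :
    usedSet (Function.update u x (u x + 1)) = insert (x, u x) (usedSet u) := by
  ext ⟨y, j⟩
  simp only [usedSet, Set.mem_ofPred_eq, Set.mem_insert_iff, Prod.mk.injEq]
  by_cases h : y = x
  · subst h; simp; omega
  · simp [h]

lemma arrivals_update (τ : Site d × ℕ → Instruction d) (u : Site d → ℕ) (x y : Site d) :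
    arrivals τ (usedSet (Function.update u x (u x + 1))) y
      = arrivals τ (usedSet u) y + (if dest τ (x, u x) = y then 1 else 0 : ℕ) := by
  rw [usedSet_update]
  split_ifs with h
  · rw [arrivals, arrivals, Nat.cast_one, ← cnt_insert]
    · congr 1
      ext a
      simp only [Set.mem_insert_iff, Set.mem_ofPred_eq]
      constructor
      · rintro ⟨rfl | h1, h2⟩
        · exact Or.inl rfl
        · exact Or.inr ⟨h1, h2⟩
      · rintro (rfl | ⟨h1, h2⟩)
        · exact ⟨Or.inl rfl, h⟩
        · exact ⟨Or.inr h1, h2⟩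
    · simp [usedSet]
  · rw [arrivals, arrivals, Nat.cast_zero, add_zero]
    congr 1
    ext a
    simp only [Set.mem_insert_iff, Set.mem_ofPred_eq]
    constructor
    · rintro ⟨rfl | h1, h2⟩
      · exact absurd h2 h
      · exact ⟨h1, h2⟩
    · rintro ⟨h1, h2⟩
      exact ⟨Or.inr h1, h2⟩

/-! ### One step of the evolution -/

/-- The number of particles at a site. -/
def SiteState.count : SiteState → ℕ
  | .active n => n
  | .passive => 1

lemma SiteState.numActive_le_count (s : SiteState) : s.numActive ≤ s.count := by
  cases s <;> simp [SiteState.numActive, SiteState.count]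

lemma SiteState.count_sleep (s : SiteState) : s.sleep.count = s.count := by
  cases s with
  | active n => by_cases h : n = 1 <;> simp [SiteState.sleep, SiteState.count, h]
  | passive => rfl

lemma SiteState.count_add (s : SiteState) : s.add.count = s.count + 1 := by
  cases s <;> rfl

lemma SiteState.count_remove {s : SiteState} (h : s.numActive ≠ 0) :
    s.remove.count + 1 = s.count := by
  cases s with
  | active n => simp [SiteState.numActive] at h; simp [SiteState.remove, SiteState.count]; omega
  | passive => simp [SiteState.numActive] at h

lemma count_settle (lam : ℝ≥0∞) (η : Config d) (x : Site d) :
    (settle lam η x).count = (η x).count := by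
  unfold settle
  split_ifs
  · exact SiteState.count_sleep _
  · rfl

lemma count_execute {η : Config d} {x : Site d} (h : (η x).numActive ≠ 0) (i : Instruction d)
    (y : Site d) :
    (execute η x i y).count + (if y = x then 1 else 0)
      = (η y).count + (if x + disp i = y then 1 else 0) := by
  have h1 := SiteState.count_remove h
  cases i with
  | sleep =>
    by_cases hy : y = x
    · subst hy; simp [execute, disp, SiteState.count_sleep]
    · simp [execute, disp, hy, Ne.symm hy]
  | jump z =>
    simp only [execute, disp]
    by_cases hy : x + z = y
    · subst hy
      simp only [Function.update_self, SiteState.count_add, if_true]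
      by_cases hz : x + z = x
      · rw [hz]; simp; omega
      · simp [hz]
    · have hy' : y ≠ x + z := Ne.symm hy
      rw [Function.update_of_ne hy']
      by_cases hx : y = x
      · subst hx; simp [hy]; omega
      · simp [hx, hy]

/-- The instruction used last, out of the first `c` ones of the stack at `x`, is an attempt to
sleep. -/
def LastSleep (τ : Site d × ℕ → Instruction d) (x : Site d) (c : ℕ) : Prop :=
  ∃ j, c = j + 1 ∧ τ (x, j) = .sleep

lemma lastSleep_succ {τ : Site d × ℕ → Instruction d} {x : Site d} {c : ℕ} :
    LastSleep τ x (c + 1) ↔ τ (x, c) = .sleep := by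
  constructor
  · rintro ⟨j, hj, h⟩
    obtain rfl : c = j := by omega
    exact h
  · exact fun h => ⟨c, rfl, h⟩

open Classical in
/-- The state of a site that holds `n` particles and has used `c` instructions. -/
def canon (lam : ℝ≥0∞) (τ : Site d × ℕ → Instruction d) (x : Site d) (c n : ℕ) : SiteState :=
  if n = 1 ∧ (lam = ⊤ ∨ LastSleep τ x c) then .passive else .active n

/-- Only a lone particle can sleep, and it then contributes no active particle, so adding particles
at a fixed stack position never reduces activity. -/
lemma canon_numActive_mono (lam : ℝ≥0∞) (τ : Site d × ℕ → Instruction d) (x : Site d) (c : ℕ)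
    {n m : ℕ} (h : n ≤ m) : (canon lam τ x c n).numActive ≤ (canon lam τ x c m).numActive := by
  unfold canon
  split_ifs with h1 h2 h2
  · exact le_rfl
  · exact Nat.zero_le _
  · obtain rfl := h2.1
    have : n ≠ 1 := fun h => h1 ⟨h, h2.2⟩
    simp only [SiteState.numActive]
    omega
  · exact h

lemma count_canon (lam : ℝ≥0∞) (τ : Site d × ℕ → Instruction d) (x : Site d) (c n : ℕ) :
    (canon lam τ x c n).count = n := by
  unfold canon
  split_ifs with h
  · exact h.1.symm
  · rfl

/-- The snapshot is obtained by a legal sequence of instructions from the initial particle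
numbers `σ`. -/
structure Consistent (lam : ℝ≥0∞) (τ : Site d × ℕ → Instruction d) (σ : Site d → ℕ)
    (s : Snapshot d) : Prop where
  -- Mass balance: every used instruction removes one particle from its site and delivers one to its
  -- destination, an attempt to sleep being an arrival at the same site.
  count : ∀ x, ((s.config x).count : ℝ≥0∞) + s.used x = σ x + arrivals τ (usedSet s.used) x
  canon : ∀ x, s.config x = canon lam τ x (s.used x) (s.config x).count
  -- Excludes an empty site whose last instruction was an attempt to sleep; otherwise `canon` would
  -- wrongly put the next arriving particle to sleep.
  slept : ∀ x, LastSleep τ x (s.used x) → 1 ≤ (s.config x).count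
  finite : {x | (s.config x).count ≠ 0}.Finite

/-- The snapshot after a ring at time `r` at the site `x`. -/
def ringAt (lam : ℝ≥0∞) (τ : Site d × ℕ → Instruction d) (s : Snapshot d) (r : ℝ) (x : Site d) :
    Snapshot d where
  time := r
  config := settle lam (execute s.config x (τ (x, s.used x)))
  used := Function.update s.used x (s.used x + 1)

lemma settle_canon (lam : ℝ≥0∞) (τ : Site d × ℕ → Instruction d) (x : Site d) (c n : ℕ) :
    (if lam = ⊤ then (canon lam τ x c n).sleep else canon lam τ x c n) = canon lam τ x c n := by
  unfold canon
  by_cases h : lam = ⊤ <;> by_cases hn : n = 1 <;> by_cases hs : LastSleep τ x c <;>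
    simp [h, hn, hs, SiteState.sleep]

lemma settle_add_canon (lam : ℝ≥0∞) (τ : Site d × ℕ → Instruction d) (x : Site d) (c n : ℕ)
    (h : LastSleep τ x c → 1 ≤ n) :
    (if lam = ⊤ then (canon lam τ x c n).add.sleep else (canon lam τ x c n).add)
      = canon lam τ x c (n + 1) := by
  unfold canon
  by_cases hl : lam = ⊤ <;> by_cases hn : n = 1 <;> by_cases hs : LastSleep τ x c <;>
    by_cases hn0 : n = 0 <;>
    simp_all [SiteState.sleep, SiteState.add]

lemma settle_sleep_canon (lam : ℝ≥0∞) (τ : Site d × ℕ → Instruction d) (x : Site d) (c n : ℕ)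
    (hτ : τ (x, c) = .sleep) (h : (canon lam τ x c n).numActive ≠ 0) :
    (if lam = ⊤ then (canon lam τ x c n).sleep.sleep else (canon lam τ x c n).sleep)
      = canon lam τ x (c + 1) n := by
  unfold canon at *
  by_cases hl : lam = ⊤ <;> by_cases hn : n = 1 <;> by_cases hs : LastSleep τ x c <;>
    simp_all [SiteState.sleep, SiteState.numActive, lastSleep_succ]

lemma settle_remove_canon (lam : ℝ≥0∞) (τ : Site d × ℕ → Instruction d) (x : Site d) (c n : ℕ)
    (hτ : τ (x, c) ≠ .sleep) (h : (canon lam τ x c n).numActive ≠ 0) :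
    (if lam = ⊤ then (canon lam τ x c n).remove.sleep else (canon lam τ x c n).remove)
      = canon lam τ x (c + 1) (n - 1) := by
  unfold canon at *
  by_cases hl : lam = ⊤ <;> by_cases hn : n = 1 <;> by_cases hs : LastSleep τ x c <;>
    by_cases hn2 : n - 1 = 1 <;>
    simp_all [SiteState.sleep, SiteState.numActive, SiteState.remove, lastSleep_succ]

lemma settle_stay_canon (lam : ℝ≥0∞) (τ : Site d × ℕ → Instruction d) (x : Site d) (c n : ℕ)
    (hτ : τ (x, c) ≠ .sleep) (h : (canon lam τ x c n).numActive ≠ 0) :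
    (if lam = ⊤ then (canon lam τ x c n).remove.add.sleep else (canon lam τ x c n).remove.add)
      = canon lam τ x (c + 1) n := by
  unfold canon at *
  by_cases hl : lam = ⊤ <;> by_cases hn : n = 1 <;> by_cases hs : LastSleep τ x c <;>
    by_cases hn2 : n = 0 <;>
    simp_all [SiteState.sleep, SiteState.numActive, SiteState.remove, SiteState.add,
      lastSleep_succ] <;>
    first
    | omega
    | (rw [if_neg (by omega)]; congr 1; omega)

lemma Consistent.count_ringAt {lam : ℝ≥0∞} {τ : Site d × ℕ → Instruction d} {s : Snapshot d}
    {x : Site d} (hx : (s.config x).numActive ≠ 0) (r : ℝ)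
    (y : Site d) :
    ((ringAt lam τ s r x).config y).count + (if y = x then 1 else 0)
      = (s.config y).count + (if dest τ (x, s.used x) = y then 1 else 0) := by
  simp only [ringAt, count_settle]
  exact count_execute hx _ _

/-- With mass balance and `canon`, the whole configuration is a function of the numbers of
instructions used. This replaces the abelian property: two systems with the same stacks can be
compared through their `used` functions alone. -/
lemma Consistent.ringAt {lam : ℝ≥0∞} {τ : Site d × ℕ → Instruction d} {σ : Site d → ℕ}
    {s : Snapshot d} (h : Consistent lam τ σ s) {x : Site d}
    (hx : (s.config x).numActive ≠ 0) (r : ℝ) : Consistent lam τ σ (ringAt lam τ s r x) := by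
  have hc := Consistent.count_ringAt (lam := lam) (τ := τ) hx r
  refine ⟨fun y => ?_, fun y => ?_, fun y => ?_, ?_⟩
  · have h1 := h.count y
    have h2 := hc y
    have h3 : (ARW.ringAt lam τ s r x).used = Function.update s.used x (s.used x + 1) := rfl
    rw [h3, arrivals_update, ← add_assoc, ← h1]
    have h4 : Function.update s.used x (s.used x + 1) y = s.used y + (if y = x then 1 else 0) := by
      by_cases hy : y = x
      · subst hy; simp
      · simp [hy]
    rw [h4]
    norm_cast
    omega
  · have hy := h.canon y
    have hcy := hc y
    set n := (s.config y).count with hn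
    have hset : (ARW.ringAt lam τ s r x).config y
      = if lam = ⊤ then (execute s.config x (τ (x, s.used x)) y).sleep
        else execute s.config x (τ (x, s.used x)) y := rfl
    by_cases hyx : y = x
    · subst hyx
      have hu : (ARW.ringAt lam τ s r y).used y = s.used y + 1 := by simp [ARW.ringAt]
      rw [hy] at hx
      rw [hu]
      cases hτ : τ (y, s.used y) with
      | sleep =>
        have hcn : ((ARW.ringAt lam τ s r y).config y).count = n := by
          simpa [dest, hτ, disp] using hcy
        rw [hcn, hset, ← settle_sleep_canon lam τ y _ n hτ hx, hτ, ← hy]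
        simp [execute]
      | jump z =>
        by_cases hz : z = 0
        · have hcn : ((ARW.ringAt lam τ s r y).config y).count = n := by
            simpa [dest, hτ, disp, hz] using hcy
          rw [hcn, hset, ← settle_stay_canon lam τ y _ n (by simp [hτ]) hx, hτ, ← hy]
          simp [execute, hz]
        · have hcn : ((ARW.ringAt lam τ s r y).config y).count = n - 1 := by
            simp [dest, hτ, disp, hz] at hcy
            omega
          rw [hcn, hset, ← settle_remove_canon lam τ y _ n (by simp [hτ]) hx, hτ, ← hy]
          simp [execute, hz]
    · have hu : (ARW.ringAt lam τ s r x).used y = s.used y := by simp [ARW.ringAt, hyx]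
      rw [hu]
      by_cases hd : dest τ (x, s.used x) = y
      · have hcn : ((ARW.ringAt lam τ s r x).config y).count = n + 1 := by
          simpa [hd, hyx] using hcy
        rw [hcn, hset, ← settle_add_canon lam τ y _ n (h.slept y), ← hy]
        cases hτ : τ (x, s.used x) with
        | sleep => exact absurd (by simpa [dest, hτ, disp] using hd.symm) hyx
        | jump z =>
          obtain rfl : x + z = y := by simpa [dest, hτ, disp] using hd
          simp [execute, Function.update_of_ne hyx]
      · have hcn : ((ARW.ringAt lam τ s r x).config y).count = n := by
          simpa [hd, hyx] using hcy
        rw [hcn, hset, ← settle_canon lam τ y _ n, ← hy]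
        cases hτ : τ (x, s.used x) with
        | sleep => simp [execute, hyx]
        | jump z =>
          have hd' : y ≠ x + z := fun h => hd (by simp [dest, hτ, disp, h])
          simp [execute, hyx, hd']
  · intro hs
    have hcy := hc y
    by_cases hyx : y = x
    · subst hyx
      have hu : (ARW.ringAt lam τ s r y).used y = s.used y + 1 := by simp [ARW.ringAt]
      rw [hu, lastSleep_succ] at hs
      have := SiteState.numActive_le_count (s.config y)
      simp [dest, hs, disp] at hcy
      omega
    · have hu : (ARW.ringAt lam τ s r x).used y = s.used y := by simp [ARW.ringAt, hyx]
      rw [hu] at hs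
      have := h.slept y hs
      simp [hyx] at hcy
      omega
  · refine (h.finite.union (Set.finite_singleton (dest τ (x, s.used x)))).subset fun y hy => ?_
    have hcy := hc y
    by_cases hd : dest τ (x, s.used x) = y
    · exact Or.inr hd.symm
    · left
      simp only [Set.mem_ofPred_eq] at hy ⊢
      rw [if_neg hd] at hcy
      omega

end

section

variable {d : ℕ}

/-! ### The trajectory of a finite system -/

/-- The clocks behave as they do almost surely. -/
structure GoodClocks (ω : Noise d) : Prop where
  pos : ∀ a, 0 < ω.2.2 a
  inj : ∀ x i k y j l, x ≠ y → ringTime ω x i k ≠ ringTime ω y j l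
  unbounded : ∀ x i (t : ℝ), ∃ k, t < ringTime ω x i k

lemma GoodClocks.ringTime_strictMono {ω : Noise d} (h : GoodClocks ω) (x : Site d) (i : ℕ) :
    StrictMono (ringTime ω x i) := by
  refine strictMono_nat_of_lt_succ fun k => ?_
  rw [ringTime, ringTime, Finset.sum_range_succ _ (k + 1)]
  exact lt_add_of_pos_right _ (h.pos _)

lemma GoodClocks.ringTime_pos {ω : Noise d} (h : GoodClocks ω) (x : Site d) (i k : ℕ) :
    0 < ringTime ω x i k :=
  Finset.sum_pos (fun _ _ => h.pos _) (by simp)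

lemma isNextRing_of_nextRing {ω : Noise d} {s : Snapshot d} {q : ℝ × Site d}
    (h : nextRing ω s = some q) : IsNextRing ω s q := by
  unfold nextRing at h
  split_ifs at h with h'
  obtain rfl := Option.some.inj h
  exact h'.choose_spec

/-- Only finitely many clocks are effective, because finitely many sites are occupied, and each has
a first ring after the current time; take the earliest of these. -/
lemma GoodClocks.exists_nextRing {ω : Noise d} (h : GoodClocks ω) {s : Snapshot d}
    (hfin : {x | (s.config x).count ≠ 0}.Finite) {x : Site d}
    (hx : (s.config x).numActive ≠ 0) : ∃ q, nextRing ω s = some q := by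
  classical
  have hex : ∃ q, IsNextRing ω s q := by
    let A : Set (Site d × ℕ) := {a | a.2 < (s.config a.1).numActive}
    have hA : A.Finite := by
      refine ((hfin.toFinset.finite_toSet.biUnion fun y _ =>
        ((Set.finite_singleton y).prod (Set.finite_Iio (s.config y).numActive)))).subset ?_
      rintro ⟨y, i⟩ hyi
      simp only [A, Set.mem_ofPred_eq] at hyi
      have := (s.config y).numActive_le_count
      simp only [Set.mem_iUnion]
      refine ⟨y, ?_, ?_⟩
      · simp only [Set.Finite.coe_toFinset, Set.mem_ofPred_eq]
        omega
      · exact ⟨rfl, hyi⟩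
    have hne : A.Nonempty := ⟨(x, 0), Nat.pos_of_ne_zero hx⟩
    let F : Site d × ℕ → ℕ := fun a => Nat.find (h.unbounded a.1 a.2 s.time)
    have hF : ∀ a, s.time < ringTime ω a.1 a.2 (F a) :=
      fun a => Nat.find_spec (h.unbounded a.1 a.2 s.time)
    obtain ⟨a, ha, hmin⟩ := Set.exists_min_image A (fun a => ringTime ω a.1 a.2 (F a)) hA hne
    refine ⟨(ringTime ω a.1 a.2 (F a), a.1), hF a, ⟨a.2, ha, F a, rfl⟩, fun y i hi k hk => ?_⟩
    refine (hmin (y, i) hi).trans ?_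
    exact (h.ringTime_strictMono y i).monotone
      (Nat.find_min' (h.unbounded y i s.time) hk)
  refine ⟨hex.choose, ?_⟩
  unfold nextRing
  rw [dif_pos hex]

lemma GoodClocks.nextRing_eq {ω : Noise d} (h : GoodClocks ω) {s : Snapshot d}
    (hfin : {x | (s.config x).count ≠ 0}.Finite) {x : Site d} {i k : ℕ}
    (hi : i < (s.config x).numActive) (ht : s.time < ringTime ω x i k)
    (hq : ∀ q, nextRing ω s = some q → ringTime ω x i k ≤ q.1) :
    nextRing ω s = some (ringTime ω x i k, x) := by
  obtain ⟨⟨r, y⟩, hqs⟩ := h.exists_nextRing hfin (x := x) (by omega)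
  obtain ⟨h1, ⟨j, hj, l, hl⟩, h3⟩ := isNextRing_of_nextRing hqs
  have hr : r = ringTime ω x i k := le_antisymm (h3 x i hi k ht) (hq _ hqs)
  have hy : x = y := by
    by_contra hne
    exact h.inj x i k y j l hne (hr.symm.trans hl.symm)
  rw [hqs, hr, hy]

/-- Wait for the next effective ring, without time horizon. -/
def adv (lam : ℝ≥0∞) (ω : Noise d) (s : Snapshot d) : Snapshot d :=
  match nextRing ω s with
  | none => s
  | some q => ringAt lam ω.2.1 s q.1 q.2

/-- The snapshot of the finite system after `k` effective rings. -/
def traj (lam : ℝ≥0∞) (ω : Noise d) (M k : ℕ) : Snapshot d :=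
  (adv lam ω)^[k] (initialSnapshot lam ω M)

/-- No effective ring takes place after the snapshot up to time `t`. -/
def Stopped (ω : Noise d) (s : Snapshot d) (t : ℝ) : Prop :=
  ∀ q, nextRing ω s = some q → t < q.1

lemma adv_of_none {lam : ℝ≥0∞} {ω : Noise d} {s : Snapshot d} (h : nextRing ω s = none) :
    adv lam ω s = s := by
  simp [adv, h]

lemma adv_of_some {lam : ℝ≥0∞} {ω : Noise d} {s : Snapshot d} {q : ℝ × Site d}
    (h : nextRing ω s = some q) : adv lam ω s = ringAt lam ω.2.1 s q.1 q.2 := by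
  simp [adv, h]

lemma step_of_stopped {lam : ℝ≥0∞} {ω : Noise d} {s : Snapshot d} {t : ℝ} (h : Stopped ω s t) :
    step lam ω t s = s := by
  unfold step
  cases hq : nextRing ω s with
  | none => rfl
  | some q => simp [not_le.2 (h q hq)]

lemma step_of_not_stopped {lam : ℝ≥0∞} {ω : Noise d} {s : Snapshot d} {t : ℝ}
    (h : ¬ Stopped ω s t) : step lam ω t s = adv lam ω s := by
  simp only [Stopped, not_forall, not_lt] at h
  obtain ⟨q, hq, hqt⟩ := h
  simp [step, adv, hq, hqt, ringAt]

lemma traj_succ (lam : ℝ≥0∞) (ω : Noise d) (M k : ℕ) :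
    traj lam ω M (k + 1) = adv lam ω (traj lam ω M k) :=
  Function.iterate_succ_apply' _ _ _

/-- The initial particle numbers, restricted to the set `S`. -/
def source (S : Set (Site d)) (ω : Noise d) (x : Site d) : ℕ :=
  open Classical in if x ∈ S then ω.1 x else 0

lemma source_mono {S S' : Set (Site d)} (h : S ⊆ S') (ω : Noise d) (x : Site d) :
    source S ω x ≤ source S' ω x := by
  unfold source
  split_ifs with h1 h2
  · exact le_rfl
  · exact absurd (h h1) h2
  · exact Nat.zero_le _
  · exact le_rfl

lemma box_mono {M M' : ℕ} (h : M ≤ M') : box d M ⊆ box d M' :=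
  fun _ hx i => (hx i).trans (by exact_mod_cast h)

lemma box_finite (d M : ℕ) : (box d M).Finite := by
  refine (Set.Finite.pi (t := fun _ : Fin d => Set.Icc (-(M : ℤ)) M)
    fun _ => Set.finite_Icc _ _).subset fun x hx i _ => ?_
  exact abs_le.1 (hx i)

lemma consistent_init (lam : ℝ≥0∞) (ω : Noise d) (M : ℕ) :
    Consistent lam ω.2.1 (source (box d M) ω) (initialSnapshot lam ω M) := by
  classical
  have hls : ∀ x, ¬ LastSleep ω.2.1 x 0 := fun x ⟨j, hj, _⟩ => by omega
  have hcfg : ∀ x, (initialSnapshot lam ω M).config x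
      = canon lam ω.2.1 x 0 (source (box d M) ω x) := by
    intro x
    have h1 : (initialSnapshot lam ω M).config x
      = if lam = ⊤ then (SiteState.active (source (box d M) ω x)).sleep
        else .active (source (box d M) ω x) := by
      simp only [initialSnapshot, settle, source]
      by_cases hx : x ∈ box d M <;> simp [hx]
    rw [h1, canon]
    by_cases hl : lam = ⊤ <;> by_cases hn : source (box d M) ω x = 1 <;>
      simp [hl, hn, hls, SiteState.sleep]
  have hcount : ∀ x, ((initialSnapshot lam ω M).config x).count = source (box d M) ω x :=
    fun x => by rw [hcfg, count_canon]
  have hused : ∀ x, (initialSnapshot lam ω M).used x = 0 := fun _ => rfl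
  refine ⟨fun x => ?_, fun x => ?_, fun x hx => absurd hx (hls x), ?_⟩
  · rw [hcount, hused]
    have : usedSet (initialSnapshot lam ω M).used = (∅ : Set (Site d × ℕ)) := by
      ext a; simp [usedSet, hused]
    simp [this, arrivals, cnt_empty]
  · rw [hcount, hused, hcfg]
  · refine (box_finite d M).subset fun x hx => ?_
    simp only [Set.mem_ofPred_eq, hcount, source] at hx
    by_contra h
    simp [h] at hx

lemma numActive_ne_zero_of_nextRing {ω : Noise d} {s : Snapshot d} {q : ℝ × Site d}
    (h : nextRing ω s = some q) : (s.config q.2).numActive ≠ 0 := by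
  obtain ⟨_, ⟨i, hi, _⟩, _⟩ := isNextRing_of_nextRing h
  omega

lemma consistent_traj (lam : ℝ≥0∞) (ω : Noise d) (M k : ℕ) :
    Consistent lam ω.2.1 (source (box d M) ω) (traj lam ω M k) := by
  induction k with
  | zero => exact consistent_init lam ω M
  | succ k ih =>
    rw [traj_succ]
    cases hq : nextRing ω (traj lam ω M k) with
    | none => rwa [adv_of_none hq]
    | some q =>
      rw [adv_of_some hq]
      exact ih.ringAt (numActive_ne_zero_of_nextRing hq) _

lemma traj_time_le_succ (lam : ℝ≥0∞) (ω : Noise d) (M k : ℕ) :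
    (traj lam ω M k).time ≤ (traj lam ω M (k + 1)).time := by
  rw [traj_succ]
  cases hq : nextRing ω (traj lam ω M k) with
  | none => rw [adv_of_none hq]
  | some q =>
    rw [adv_of_some hq]
    exact (isNextRing_of_nextRing hq).1.le

lemma traj_time_mono (lam : ℝ≥0∞) (ω : Noise d) (M : ℕ) :
    Monotone fun k => (traj lam ω M k).time :=
  monotone_nat_of_le_succ (traj_time_le_succ lam ω M)

lemma traj_time_nonneg (lam : ℝ≥0∞) (ω : Noise d) (M k : ℕ) : 0 ≤ (traj lam ω M k).time :=
  traj_time_mono lam ω M (Nat.zero_le k)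

lemma traj_used_mono (lam : ℝ≥0∞) (ω : Noise d) (M : ℕ) :
    Monotone fun k => (traj lam ω M k).used := by
  refine monotone_nat_of_le_succ fun k => ?_
  simp only [traj_succ]
  cases hq : nextRing ω (traj lam ω M k) with
  | none => rw [adv_of_none hq]
  | some q =>
    rw [adv_of_some hq]
    intro x
    by_cases hx : x = q.2
    · subst hx; simp [ringAt]
    · simp [ringAt, hx]

lemma Stopped.mono {ω : Noise d} {s : Snapshot d} {t t' : ℝ} (h : Stopped ω s t) (ht : t' ≤ t) :
    Stopped ω s t' :=
  fun q hq => ht.trans_lt (h q hq)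

lemma traj_eq_of_stopped {lam : ℝ≥0∞} {ω : Noise d} {M k l : ℕ} {t : ℝ} (hkl : k ≤ l)
    (h : Stopped ω (traj lam ω M k) t) (ht : (traj lam ω M l).time ≤ t) :
    traj lam ω M l = traj lam ω M k := by
  induction l, hkl using Nat.le_induction with
  | base => rfl
  | succ l _ ih =>
    have ih' := ih ((traj_time_le_succ lam ω M l).trans ht)
    rw [traj_succ, ih'] at ht ⊢
    cases hq : nextRing ω (traj lam ω M k) with
    | none => rw [adv_of_none hq]
    | some q =>
      rw [adv_of_some hq] at ht
      exact absurd (h q hq) (not_lt.2 ht)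

/-- The finite system has finitely many effective rings in bounded time intervals. -/
def NonExplosive (lam : ℝ≥0∞) (ω : Noise d) (M : ℕ) : Prop :=
  ∀ t, ∃ k, Stopped ω (traj lam ω M k) t

open Classical in
/-- The snapshot of the finite system at time `t`. -/
def snapAt (lam : ℝ≥0∞) (ω : Noise d) (M : ℕ) (t : ℝ) : Snapshot d :=
  if h : ∃ k, Stopped ω (traj lam ω M k) t then traj lam ω M (Nat.find h)
  else initialSnapshot lam ω M

section snapAt

variable {lam : ℝ≥0∞} {ω : Noise d} {M : ℕ}

lemma NonExplosive.exists_snapAt (h : NonExplosive lam ω M) {t : ℝ} (ht : 0 ≤ t) :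
    ∃ k, snapAt lam ω M t = traj lam ω M k ∧ (traj lam ω M k).time ≤ t ∧
      Stopped ω (traj lam ω M k) t := by
  classical
  have hex := h t
  refine ⟨Nat.find hex, by rw [snapAt, dif_pos hex], ?_, Nat.find_spec hex⟩
  cases hk : Nat.find hex with
  | zero => exact ht
  | succ k =>
    have := Nat.find_min hex (m := k) (by omega)
    simp only [Stopped, not_forall, not_lt] at this
    obtain ⟨q, hq, hqt⟩ := this
    rw [traj_succ, adv_of_some hq]
    exact hqt

lemma snapAt_eq {k : ℕ} {t : ℝ} (h : Stopped ω (traj lam ω M k) t)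
    (ht : (traj lam ω M k).time ≤ t) : snapAt lam ω M t = traj lam ω M k := by
  classical
  have hex : ∃ k, Stopped ω (traj lam ω M k) t := ⟨k, h⟩
  rw [snapAt, dif_pos hex]
  exact (traj_eq_of_stopped (Nat.find_min' hex h) (Nat.find_spec hex) ht).symm

lemma NonExplosive.used_le_used (h : NonExplosive lam ω M) {s t : ℝ} (hst : s ≤ t) :
    (snapAt lam ω M s).used ≤ (snapAt lam ω M t).used := by
  classical
  rw [snapAt, snapAt, dif_pos (h s), dif_pos (h t)]
  exact traj_used_mono lam ω M
    (Nat.find_min' (h s) ((Nat.find_spec (h t)).mono hst))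

/-- This produces the snapshot immediately before `t`, while `snapAt` already includes a ring at
time `t` itself. It is what allows a jump at a given ring to be examined. -/
lemma NonExplosive.exists_before (h : NonExplosive lam ω M) {t : ℝ} (ht : 0 < t) :
    ∃ k, (traj lam ω M k).time < t ∧ ∀ q, nextRing ω (traj lam ω M k) = some q → t ≤ q.1 := by
  classical
  have hex : ∃ k, ∀ q, nextRing ω (traj lam ω M k) = some q → t ≤ q.1 :=
    let ⟨k, hk⟩ := h t
    ⟨k, fun q hq => (hk q hq).le⟩
  refine ⟨Nat.find hex, ?_, Nat.find_spec hex⟩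
  cases hk : Nat.find hex with
  | zero => exact ht
  | succ k =>
    have := Nat.find_min hex (m := k) (by omega)
    simp only [not_forall, not_le] at this
    obtain ⟨q, hq, hqt⟩ := this
    rw [traj_succ, adv_of_some hq]
    exact hqt

lemma eventualValue_eq {α : Type*} [Inhabited α] {f : ℕ → α} {a : α}
    (h : ∀ᶠ k in atTop, f k = a) : eventualValue f = a := by
  have hex : ∃ a, ∀ᶠ k in atTop, f k = a := ⟨a, h⟩
  rw [eventualValue, dif_pos hex]
  obtain ⟨k, h1, h2⟩ := (hex.choose_spec.and h).exists
  exact h1.symm.trans h2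

lemma NonExplosive.finiteState_eq (h : NonExplosive lam ω M) (t : ℝ) :
    finiteState lam ω M t = (snapAt lam ω M t).config := by
  classical
  have hex := h t
  have h1 : ∀ k ≤ Nat.find hex, (step lam ω t)^[k] (initialSnapshot lam ω M)
      = traj lam ω M k := by
    intro k hk
    induction k with
    | zero => rfl
    | succ k ih =>
      rw [Function.iterate_succ_apply', ih (by omega), traj_succ,
        step_of_not_stopped (Nat.find_min hex (by omega))]
  have h2 : ∀ k ≥ Nat.find hex, (step lam ω t)^[k] (initialSnapshot lam ω M)
      = traj lam ω M (Nat.find hex) := by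
    intro k hk
    induction k, hk using Nat.le_induction with
    | base => exact h1 _ le_rfl
    | succ k _ ih => rw [Function.iterate_succ_apply', ih, step_of_stopped (Nat.find_spec hex)]
  funext x
  refine eventualValue_eq (eventually_atTop.2 ⟨Nat.find hex, fun k hk => ?_⟩)
  rw [h2 k hk, snapAt, dif_pos hex]

lemma NonExplosive.consistent_snapAt (h : NonExplosive lam ω M) (t : ℝ) :
    Consistent lam ω.2.1 (source (box d M) ω) (snapAt lam ω M t) := by
  classical
  rw [snapAt, dif_pos (h t)]
  exact consistent_traj _ _ _ _

/-- An effective clock makes its site use an instruction when it rings. -/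
lemma GoodClocks.snapAt_ringTime (hg : GoodClocks ω) {k : ℕ} {x : Site d} {i m : ℕ}
    (ht : (traj lam ω M k).time < ringTime ω x i m)
    (hq : ∀ q, nextRing ω (traj lam ω M k) = some q → ringTime ω x i m ≤ q.1)
    (hi : i < ((traj lam ω M k).config x).numActive) :
    snapAt lam ω M (ringTime ω x i m)
      = ringAt lam ω.2.1 (traj lam ω M k) (ringTime ω x i m) x := by
  have hn := hg.nextRing_eq (consistent_traj lam ω M k).finite hi ht hq
  have hs : traj lam ω M (k + 1)
      = ringAt lam ω.2.1 (traj lam ω M k) (ringTime ω x i m) x := by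
    rw [traj_succ, adv_of_some hn]
  rw [← hs]
  refine snapAt_eq (fun q hq' => ?_) (by rw [hs]; rfl)
  have := (isNextRing_of_nextRing hq').1
  rwa [hs] at this

end snapAt

/-! ### Monotonicity in the set of initial particles -/

/-- When both systems have used equally many instructions at `x`, mass balance leaves only the
source and the arrivals to compare, and both are larger in the system that has used more elsewhere.
-/
lemma Consistent.count_le_count {lam : ℝ≥0∞} {τ : Site d × ℕ → Instruction d}
    {σ σ' : Site d → ℕ} {s s' : Snapshot d} (h : Consistent lam τ σ s)
    (h' : Consistent lam τ σ' s') {x : Site d} (hσ : σ x ≤ σ' x) (hu : s.used ≤ s'.used)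
    (hx : s'.used x ≤ s.used x) : (s.config x).count ≤ (s'.config x).count := by
  have h1 := h.count x
  have h2 := h'.count x
  have h3 := arrivals_mono τ (usedSet_mono hu) x
  have h4 : ((s.config x).count : ℝ≥0∞) + s.used x ≤ (s'.config x).count + s.used x := by
    calc _ = (σ x : ℝ≥0∞) + arrivals τ (usedSet s.used) x := h1
      _ ≤ σ' x + arrivals τ (usedSet s'.used) x := add_le_add (by exact_mod_cast hσ) h3
      _ = (s'.config x).count + s'.used x := h2.symm
      _ ≤ _ := by gcongr
  norm_cast at h4
  omega

lemma Consistent.numActive_le_numActive {lam : ℝ≥0∞} {τ : Site d × ℕ → Instruction d}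
    {σ σ' : Site d → ℕ} {s s' : Snapshot d} (h : Consistent lam τ σ s)
    (h' : Consistent lam τ σ' s') {x : Site d} (hσ : σ x ≤ σ' x) (hu : s.used ≤ s'.used)
    (hx : s'.used x ≤ s.used x) : (s.config x).numActive ≤ (s'.config x).numActive := by
  rw [h.canon x, h'.canon x, le_antisymm (hu x) hx]
  exact canon_numActive_mono _ _ _ _ (h.count_le_count h' hσ hu hx)

/-- The larger system can never be overtaken. At a ring that makes the smaller system use an
instruction, the larger one is either ahead at that site already, or level with it; when level it
has at least as many active particles, so the same clock is effective there and it also moves on. -/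
lemma GoodClocks.traj_used_le {lam : ℝ≥0∞} {ω : Noise d} {M M' : ℕ} (hg : GoodClocks ω)
    (h' : NonExplosive lam ω M') (hM : M ≤ M') (k : ℕ) :
    (traj lam ω M k).used ≤ (snapAt lam ω M' (traj lam ω M k).time).used := by
  induction k with
  | zero => exact fun x => Nat.zero_le _
  | succ k ih =>
    rw [traj_succ]
    cases hq : nextRing ω (traj lam ω M k) with
    | none => rwa [adv_of_none hq]
    | some q =>
      rw [adv_of_some hq]
      obtain ⟨r, x⟩ := q
      obtain ⟨h1, ⟨i, hi, m, hr⟩, -⟩ := isNextRing_of_nextRing hq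
      simp only at h1 hi hr
      have hmono := h'.used_le_used h1.le
      intro y
      simp only [ringAt]
      by_cases hy : y = x
      · subst hy
        rw [Function.update_self]
        obtain ⟨l, hl1, hl2⟩ := h'.exists_before (hg.ringTime_pos y i m)
        rw [hr] at hl1 hl2
        have hle : (traj lam ω M k).used ≤ (traj lam ω M' l).used := by
          refine ih.trans ?_
          have hmax : (snapAt lam ω M' (max (traj lam ω M k).time (traj lam ω M' l).time))
              = traj lam ω M' l :=
            snapAt_eq (fun q hq => lt_of_lt_of_le (max_lt h1 hl1) (hl2 q hq)) (le_max_right _ _)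
          rw [← hmax]
          exact h'.used_le_used (le_max_left _ _)
        have hle' : (traj lam ω M' l).used ≤ (snapAt lam ω M' r).used := by
          have := h'.used_le_used hl1.le
          rwa [snapAt_eq (fun q hq => lt_of_lt_of_le hl1 (hl2 q hq)) le_rfl] at this
        -- If the bound fails, both systems are level at `y` just before time `r`, so the numbers of
        -- active particles can be compared.
        by_contra hlt
        replace hlt : ¬ (traj lam ω M k).used y + 1 ≤ (snapAt lam ω M' r).used y := hlt
        have h5 : (traj lam ω M k).used y ≤ (traj lam ω M' l).used y := hle y
        have h6 : (traj lam ω M' l).used y ≤ (snapAt lam ω M' r).used y := hle' y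
        have hact := (consistent_traj lam ω M k).numActive_le_numActive
          (consistent_traj lam ω M' l) (x := y) (source_mono (box_mono hM) ω y) hle (by omega)
        have := hg.snapAt_ringTime (x := y) (i := i) (m := m) (hr ▸ hl1) (hr ▸ hl2)
          (lt_of_lt_of_le hi hact)
        rw [hr] at this
        apply hlt
        rw [this]
        simp only [ringAt, Function.update_self]
        omega
      · rw [Function.update_of_ne hy]
        exact (ih y).trans (hmono y)

lemma GoodClocks.snapAt_used_le {lam : ℝ≥0∞} {ω : Noise d} {M M' : ℕ} (hg : GoodClocks ω)
    (h : NonExplosive lam ω M) (h' : NonExplosive lam ω M') (hM : M ≤ M') {t : ℝ} (ht : 0 ≤ t) :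
    (snapAt lam ω M t).used ≤ (snapAt lam ω M' t).used := by
  obtain ⟨k, hk, hkt, -⟩ := h.exists_snapAt ht
  rw [hk]
  exact (hg.traj_used_le h' hM k).trans (h'.used_le_used hkt)

end

section

variable {d : ℕ}

/-! ### Fixation forces bounded use of instructions -/

/-- Almost sure properties of the finite systems: they do not explode, and the activity at a site
up to a given time is bounded uniformly in the size of the system. -/
structure Good (lam : ℝ≥0∞) (ω : Noise d) : Prop where
  clocks : GoodClocks ω
  nonExplosive : ∀ M, NonExplosive lam ω M
  bounded : ∀ x t, ∃ C : ℕ, ∀ M k, (traj lam ω M k).time ≤ t →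
    ((traj lam ω M k).config x).count + (traj lam ω M k).used x ≤ C

lemma eventually_const_of_monotone_of_le {f : ℕ → ℕ} (hf : Monotone f) {C : ℕ}
    (hC : ∀ n, f n ≤ C) : ∃ a, ∀ᶠ n in atTop, f n = a := by
  have h := tendsto_atTop_ciSup hf ⟨C, by rintro _ ⟨n, rfl⟩; exact hC n⟩
  rw [nhds_discrete, tendsto_pure] at h
  exact ⟨_, h⟩

section

variable {lam : ℝ≥0∞} {ω : Noise d}

lemma Good.bounded_snapAt (h : Good lam ω) (x : Site d) (t : ℝ) : ∃ C : ℕ, ∀ M, ∀ s ≤ t, 0 ≤ s →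
    ((snapAt lam ω M s).config x).count + (snapAt lam ω M s).used x ≤ C := by
  obtain ⟨C, hC⟩ := h.bounded x t
  refine ⟨C, fun M s hs hs0 => ?_⟩
  obtain ⟨k, hk, hkt, -⟩ := (h.nonExplosive M).exists_snapAt hs0
  rw [hk]
  exact hC M k (hkt.trans hs)

/-- At a given time, the state of a site in the finite systems stabilises as the systems grow. -/
lemma Good.exists_limit (h : Good lam ω) (x : Site d) {t : ℝ} (ht : 0 ≤ t) :
    ∃ L : ℕ, ∀ᶠ M in atTop, (snapAt lam ω M t).used x = L ∧
      (snapAt lam ω M t).config x = state lam ω t x := by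
  obtain ⟨C, hC⟩ := h.bounded_snapAt x t
  have hmono : Monotone fun M => (snapAt lam ω M t).used x := fun M M' hM =>
    h.clocks.snapAt_used_le (h.nonExplosive M) (h.nonExplosive M') hM ht x
  obtain ⟨L, hL⟩ := eventually_const_of_monotone_of_le hmono (C := C)
    fun M => (Nat.le_add_left _ _).trans (hC M t le_rfl ht)
  obtain ⟨N, hN⟩ := eventually_atTop.1 hL
  -- From `N` on, the number of used instructions at `x` no longer depends on the box, so the
  -- particle count at `x` is monotone too.
  have hmono' : Monotone fun M => ((snapAt lam ω (M + N) t).config x).count := by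
    intro M M' hM
    refine ((h.nonExplosive _).consistent_snapAt t).count_le_count
      ((h.nonExplosive _).consistent_snapAt t) (source_mono (box_mono (by omega)) ω x)
      (h.clocks.snapAt_used_le (h.nonExplosive _) (h.nonExplosive _) (by omega) ht) ?_
    rw [hN _ (Nat.le_add_left _ _), hN _ (Nat.le_add_left _ _)]
  obtain ⟨n, hn⟩ := eventually_const_of_monotone_of_le hmono' (C := C)
    fun M => (Nat.le_add_right _ _).trans (hC (M + N) t le_rfl ht)
  obtain ⟨N', hN'⟩ := eventually_atTop.1 hn
  have hev : ∀ M ≥ N' + N, (snapAt lam ω M t).used x = L ∧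
      (snapAt lam ω M t).config x = canon lam ω.2.1 x L n := by
    intro M hM
    have h1 := hN M (by omega)
    have h2 := hN' (M - N) (by omega)
    rw [Nat.sub_add_cancel (by omega)] at h2
    refine ⟨h1, ?_⟩
    rw [((h.nonExplosive M).consistent_snapAt t).canon x, h1, h2]
  have hst : state lam ω t x = canon lam ω.2.1 x L n := by
    refine eventualValue_eq (eventually_atTop.2 ⟨N' + N, fun M hM => ?_⟩)
    rw [(h.nonExplosive M).finiteState_eq]
    exact (hev M hM).2
  exact ⟨L, eventually_atTop.2 ⟨N' + N, fun M hM => hst ▸ hev M hM⟩⟩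

lemma NonExplosive.traj_used_le_snapAt {M : ℕ} (h : NonExplosive lam ω M) {k : ℕ} {t : ℝ}
    (ht : (traj lam ω M k).time ≤ t) : (traj lam ω M k).used ≤ (snapAt lam ω M t).used := by
  obtain ⟨l, hl, -, hs⟩ := h.exists_snapAt ((traj_time_nonneg lam ω M k).trans ht)
  rw [hl]
  rcases le_total k l with hkl | hkl
  · exact traj_used_mono lam ω M hkl
  · rw [traj_eq_of_stopped hkl hs ht]

/-- A site uses instructions only when one of its effective clocks rings. -/
lemma NonExplosive.used_eq_of_no_ring {M : ℕ} (h : NonExplosive lam ω M) {x : Site d} {C : ℕ}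
    {s t : ℝ} (hs : 0 ≤ s) (hst : s ≤ t)
    (hC : ∀ k, (traj lam ω M k).time ≤ t → ((traj lam ω M k).config x).count ≤ C)
    (hno : ∀ i < C, ∀ m, s < ringTime ω x i m → t < ringTime ω x i m) :
    (snapAt lam ω M t).used x = (snapAt lam ω M s).used x := by
  refine le_antisymm ?_ (h.used_le_used hst x)
  obtain ⟨l, hl, hlt, -⟩ := h.exists_snapAt (hs.trans hst)
  rw [hl]
  clear hl
  induction l with
  | zero => exact Nat.zero_le _
  | succ l ih =>
    have hlt' := (traj_time_le_succ lam ω M l).trans hlt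
    by_cases hls : (traj lam ω M (l + 1)).time ≤ s
    · exact h.traj_used_le_snapAt hls x
    · refine le_trans (le_of_eq ?_) (ih hlt')
      rw [traj_succ] at hls hlt ⊢
      cases hq : nextRing ω (traj lam ω M l) with
      | none => rw [adv_of_none hq]
      | some q =>
        rw [adv_of_some hq] at hls hlt ⊢
        obtain ⟨-, ⟨i, hi, m, hm⟩, -⟩ := isNextRing_of_nextRing hq
        by_cases hx : x = q.2
        · subst hx
          have hle := SiteState.numActive_le_count ((traj lam ω M l).config q.2)
          have := hno i (hi.trans_le (hle.trans (hC l hlt'))) m (hm ▸ not_le.1 hls)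
          rw [hm] at this
          exact absurd hlt (not_le.2 this)
        · simp [ringAt, hx]

/-- If the number of instructions used at a site is unbounded then the state of the site is not
eventually constant. -/
theorem Good.not_fixates (h : Good lam ω) {x : Site d}
    (hinf : ∀ n, ∃ j ≥ n, disp (ω.2.1 (x, j)) ≠ 0)
    (hunb : ∀ n, ∃ M t, 0 ≤ t ∧ n ≤ (snapAt lam ω M t).used x) : ¬ Fixates lam ω := by
  classical
  intro hfix
  obtain ⟨a, T', hT'⟩ := hfix x
  obtain ⟨T, hT0, hT⟩ : ∃ T : ℝ, 0 ≤ T ∧ ∀ t ≥ T, state lam ω t x = a :=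
    ⟨max T' 0, le_max_right _ _, fun t ht => hT' t ((le_max_left _ _).trans ht)⟩
  have hlim : ∀ t : ℝ, ∃ L : ℕ, 0 ≤ t → ∀ᶠ M in atTop, (snapAt lam ω M t).used x = L ∧
      (snapAt lam ω M t).config x = state lam ω t x := fun t => by
    by_cases ht : 0 ≤ t
    · obtain ⟨L, hL⟩ := h.exists_limit x ht
      exact ⟨L, fun _ => hL⟩
    · exact ⟨0, fun h => absurd h ht⟩
  choose L hL using hlim
  -- The instruction `j` is a genuine jump not yet used at time `T`. The plan is to find the moment
  -- at which it is used and to see the count change there.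
  obtain ⟨j, hj, hdisp⟩ := hinf (L T)
  obtain ⟨t, ht0, hLt⟩ : ∃ t, 0 ≤ t ∧ j + 1 ≤ L t := by
    obtain ⟨M, t, ht, hM⟩ := hunb (j + 1)
    refine ⟨t, ht, ?_⟩
    obtain ⟨M', h1, h2⟩ := ((hL t ht).and (eventually_ge_atTop M)).exists
    rw [← h1.1]
    exact hM.trans (h.clocks.snapAt_used_le (h.nonExplosive M) (h.nonExplosive M') h2 ht x)
  have hTt : T < t := by
    by_contra hle
    obtain ⟨M, h1, h2⟩ := ((hL t ht0).and (hL T hT0)).exists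
    have : (snapAt lam ω M t).used x ≤ (snapAt lam ω M T).used x :=
      (h.nonExplosive M).used_le_used (not_lt.1 hle) x
    rw [h1.1, h2.1] at this
    omega
  obtain ⟨C, hC⟩ := h.bounded x t
  have hC' : ∀ M k, (traj lam ω M k).time ≤ t → ((traj lam ω M k).config x).count ≤ C :=
    fun M k hk => (Nat.le_add_right _ _).trans (hC M k hk)
  have hnoring : ∀ M, ∀ s s', 0 ≤ s → s ≤ s' → s' ≤ t →
      (∀ i < C, ∀ m, s < ringTime ω x i m → s' < ringTime ω x i m) →
      (snapAt lam ω M s').used x = (snapAt lam ω M s).used x :=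
    fun M s s' hs hss hs' hno => (h.nonExplosive M).used_eq_of_no_ring hs hss
      (fun k hk => hC' M k (hk.trans hs')) hno
  have hLconst : ∀ s s', 0 ≤ s → s ≤ s' → s' ≤ t →
      (∀ i < C, ∀ m, s < ringTime ω x i m → s' < ringTime ω x i m) → L s' = L s := by
    intro s s' hs hss hs' hno
    obtain ⟨M, h1, h2⟩ := ((hL s hs).and (hL s' (hs.trans hss))).exists
    rw [← h1.1, ← h2.1]
    exact hnoring M s s' hs hss hs' hno
  -- By time `t` the site never holds more than `C` particles in any box, so only its first `C`
  -- clocks matter, and they ring finitely often. Thus `L` can change only at the finitely many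
  -- times in `R`.
  let R : Set ℝ := {ρ | T < ρ ∧ ρ ≤ t ∧ ∃ i < C, ∃ m, ringTime ω x i m = ρ}
  have hR : R.Finite := by
    choose m hm using fun i => h.clocks.unbounded x i t
    refine (((Set.finite_Iio C).biUnion fun i _ =>
      (Set.finite_Iio (m i)).image (ringTime ω x i))).subset ?_
    rintro ρ ⟨-, hρ, i, hi, l, rfl⟩
    simp only [Set.mem_iUnion]
    refine ⟨i, hi, l, ?_, rfl⟩
    exact (h.clocks.ringTime_strictMono x i).lt_iff_lt.1 (hρ.trans_lt (hm i))
  -- The last candidate time at which instruction `j` is still unused; the next element `ρ` of `R`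
  -- is the time at which it is used.
  obtain ⟨s, ⟨hsR, hsL⟩, hsmax⟩ := Set.exists_max_image {s | s ∈ insert T R ∧ L s ≤ j} id
    ((hR.insert T).subset fun s hs => hs.1) ⟨T, Set.mem_insert _ _, hj⟩
  have hTs : T ≤ s := by
    rcases hsR with rfl | hsR
    · exact le_rfl
    · exact hsR.1.le
  have hst : s ≤ t := by
    rcases hsR with rfl | hsR
    · exact hTt.le
    · exact hsR.2.1
  have hs0 := hT0.trans hTs
  have hne : {ρ | ρ ∈ R ∧ s < ρ}.Nonempty := by
    by_contra hemp
    have : L t = L s := by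
      refine hLconst s t hs0 hst le_rfl fun i hi m hm => ?_
      by_contra hle
      exact hemp ⟨ringTime ω x i m, ⟨hTs.trans_lt hm, not_lt.1 hle, i, hi, m, rfl⟩, hm⟩
    omega
  obtain ⟨ρ, ⟨hρR, hsρ⟩, hρmin⟩ := Set.exists_min_image {ρ | ρ ∈ R ∧ s < ρ} id
    (hR.subset fun ρ hρ => hρ.1) hne
  have hLρ : j + 1 ≤ L ρ := by
    by_contra hlt
    have := hsmax ρ ⟨Or.inr hρR, by omega⟩
    simp only [id] at this
    linarith
  obtain ⟨-, hρt, i, hi, m, hρ⟩ := hρR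
  have hno : ∀ s', s ≤ s' → s' < ρ →
      ∀ i < C, ∀ m, s < ringTime ω x i m → s' < ringTime ω x i m := by
    intro s' hs' hs'ρ i hi m hm
    by_contra hle
    have := hρmin _ ⟨⟨hTs.trans_lt hm, by linarith, i, hi, m, rfl⟩, hm⟩
    simp only [id] at this
    linarith
  have hρ0 : 0 < ρ := hs0.trans_lt hsρ
  -- One box that already shows the limiting behaviour at both `s` and `ρ`. The time `s'` just
  -- before `ρ` depends on this box, so at `s'` only a comparison with a still larger box is
  -- available.
  obtain ⟨M, h1, h2⟩ := ((hL s hs0).and (hL ρ hρ0.le)).exists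
  obtain ⟨k, hk1, hk2⟩ := (h.nonExplosive M).exists_before hρ0
  set s' := max s (traj lam ω M k).time with hs'
  have hs'ρ : s' < ρ := max_lt hsρ hk1
  have hss' : s ≤ s' := le_max_left _ _
  have hsnap : snapAt lam ω M s' = traj lam ω M k :=
    snapAt_eq (fun q hq => hs'ρ.trans_le (hk2 q hq)) (le_max_right _ _)
  have huk : (traj lam ω M k).used x = L s := by
    rw [← hsnap, hnoring M s s' hs0 hss' (hs'ρ.le.trans hρt) (hno s' hss' hs'ρ), h1.1]
  have hnot : ¬ Stopped ω (traj lam ω M k) ρ := by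
    intro hnone
    have := h2.1
    rw [snapAt_eq hnone hk1.le, huk] at this
    omega
  simp only [Stopped, not_forall, not_lt] at hnot
  obtain ⟨⟨r, y⟩, hq, hqρ⟩ := hnot
  have hrρ : r = ρ := le_antisymm hqρ (hk2 _ hq)
  obtain ⟨-, ⟨i', hi', m', hm'⟩, -⟩ := isNextRing_of_nextRing hq
  simp only at hi' hm'
  have hxy : x = y := by
    by_contra hne
    exact h.clocks.inj x i m y i' m' hne (by rw [hρ, hm', hrρ])
  subst hxy
  have hsnapρ := h.clocks.snapAt_ringTime (lam := lam) (M := M) (k := k) (x := x) (i := i')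
    (m := m') (by rw [hm', hrρ]; exact hk1) (by rw [hm', hrρ]; exact hk2) hi'
  rw [hm', hrρ] at hsnapρ
  -- A single ring uses a single instruction, so the one used at `ρ` is exactly the jump `j`.
  have hLj : L s = j := by
    have := h2.1
    rw [hsnapρ] at this
    simp only [ringAt, Function.update_self] at this
    omega
  have hcount := Consistent.count_ringAt (lam := lam) (τ := ω.2.1) (s := traj lam ω M k) (x := x)
    (by omega) ρ x
  rw [← hsnapρ, h2.2, hT ρ (hTs.trans hsρ.le), huk, hLj, if_pos rfl,
    if_neg (by simpa [dest] using hdisp)] at hcount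
  have hs'0 : 0 ≤ s' := hs0.trans hss'
  obtain ⟨M', h3, h4⟩ := ((hL s' hs'0).and (eventually_ge_atTop M)).exists
  -- At `ρ` the box `M` loses a particle at `x` and reaches the count of `a`, so it had one more at
  -- `s'`. The larger box `M'` has at least as many at `s'`, yet already shows the state `a` there:
  -- a contradiction.
  have hle := ((h.nonExplosive M).consistent_snapAt s').count_le_count
    ((h.nonExplosive M').consistent_snapAt s') (source_mono (box_mono h4) ω x)
    (h.clocks.snapAt_used_le (h.nonExplosive M) (h.nonExplosive M') h4 hs'0) (by
      rw [h3.1, hsnap, huk, hLconst s s' hs0 hss' (hs'ρ.le.trans hρt) (hno s' hss' hs'ρ)])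
  rw [hsnap, h3.2, hT s' (hTs.trans hss')] at hle
  omega

end

/-! ### Toppling in rounds -/

/-- The number of instructions in the finite set `E` that lead to `x`. -/
def arr (τ : Site d × ℕ → Instruction d) (E : Finset (Site d × ℕ)) (x : Site d) : ℕ :=
  (E.filter fun a => dest τ a = x).card

lemma arrivals_coe (τ : Site d × ℕ → Instruction d) (E : Finset (Site d × ℕ)) (x : Site d) :
    arrivals τ (E : Set (Site d × ℕ)) x = arr τ E x := by
  rw [arr, ← cnt_finset, arrivals]
  congr 1
  ext a
  simp

/-- The instructions used in the first `j` rounds, if in every round each site with `n ≥ 2`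
particles uses `n - 1` instructions. The initial particle numbers `σ` vanish outside of `B`. -/
def rounds (B : Finset (Site d)) (σ : Site d → ℕ) (τ : Site d × ℕ → Instruction d) :
    ℕ → Finset (Site d × ℕ)
  | 0 => ∅
  | j + 1 => (B ∪ (rounds B σ τ j).image (dest τ)).biUnion fun x =>
      -- The range is the cumulative number of instructions, so all particles that were ever at `x`
      -- except one have been sent on. The truncated subtraction covers sites without particles.
      (Finset.range (σ x + arr τ (rounds B σ τ j) x - 1)).image fun m => (x, m)

lemma mem_rounds_succ {B : Finset (Site d)} {σ : Site d → ℕ} (hσ : ∀ x, x ∉ B → σ x = 0)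
    {τ : Site d × ℕ → Instruction d} {j : ℕ} {a : Site d × ℕ} :
    a ∈ rounds B σ τ (j + 1) ↔ a.2 + 1 < σ a.1 + arr τ (rounds B σ τ j) a.1 := by
  obtain ⟨x, m⟩ := a
  simp only [rounds, Finset.mem_biUnion, Finset.mem_image, Finset.mem_range, Prod.mk.injEq]
  constructor
  · rintro ⟨y, -, m', hm', rfl, rfl⟩
    omega
  · intro h
    refine ⟨x, ?_, m, by omega, rfl, rfl⟩
    by_contra hx
    simp only [Finset.mem_union, Finset.mem_image, not_or, not_exists, not_and] at hx
    have h0 : arr τ (rounds B σ τ j) x = 0 := by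
      rw [arr, Finset.card_eq_zero, Finset.filter_eq_empty_iff]
      exact fun a ha => hx.2 a ha
    rw [hσ x hx.1, h0] at h
    omega

/-- The instructions used in rounds are used by the finite system, too. -/
theorem Good.rounds_subset {lam : ℝ≥0∞} {ω : Noise d} (h : Good lam ω) (M j : ℕ) :
    ∃ t, 0 ≤ t ∧ ∀ a ∈ rounds (box_finite d M).toFinset (source (box d M) ω) ω.2.1 j,
      a.2 < (snapAt lam ω M t).used a.1 := by
  classical
  have hne := h.nonExplosive M
  induction j with
  | zero => exact ⟨0, le_rfl, by simp [rounds]⟩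
  | succ j ih =>
    obtain ⟨t, ht0, ht⟩ := ih
    have hσ : ∀ x, x ∉ (box_finite d M).toFinset → source (box d M) ω x = 0 := by
      intro x hx
      simp only [Set.Finite.mem_toFinset] at hx
      simp [source, hx]
    have key : ∀ a ∈ rounds (box_finite d M).toFinset (source (box d M) ω) ω.2.1 (j + 1),
        ∃ t, 0 ≤ t ∧ a.2 < (snapAt lam ω M t).used a.1 := by
      rintro ⟨x, m⟩ ha
      rw [mem_rounds_succ hσ] at ha
      by_contra! hle
      simp only at ha hle
      -- If instruction `m` is never used, the use at `x` has a maximum, attained at `t0`. After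
      -- `t0` and after the previous rounds are complete, mass balance leaves at least two particles
      -- at `x`, so clock `0` is effective and its next ring exceeds the maximum.
      let A : Set ℕ := {n | ∃ t, 0 ≤ t ∧ (snapAt lam ω M t).used x = n}
      have hA : BddAbove A := ⟨m, by rintro _ ⟨t, ht, rfl⟩; exact hle t ht⟩
      obtain ⟨t0, ht00, ht0A⟩ := Nat.sSup_mem (s := A) ⟨_, 0, le_rfl, rfl⟩ hA
      have hmax : ∀ t, 0 ≤ t → (snapAt lam ω M t).used x ≤ (snapAt lam ω M t0).used x := by
        intro t ht
        rw [ht0A]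
        exact le_csSup hA ⟨t, ht, rfl⟩
      set t1 := max t t0
      obtain ⟨l, hl⟩ := h.clocks.unbounded x 0 t1
      have ht10 : 0 ≤ t1 := ht00.trans (le_max_right _ _)
      obtain ⟨k, hk1, hk2⟩ := hne.exists_before (ht10.trans_lt hl)
      set s := max t1 (traj lam ω M k).time
      have hs1 : t1 ≤ s := le_max_left _ _
      have hsnap : snapAt lam ω M s = traj lam ω M k :=
        snapAt_eq (fun q hq => (max_lt hl hk1).trans_le (hk2 q hq)) (le_max_right _ _)
      have hu : (traj lam ω M k).used x = (snapAt lam ω M t0).used x := by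
        rw [← hsnap]
        exact le_antisymm (hmax s (ht10.trans hs1))
          (hne.used_le_used ((le_max_right _ _).trans hs1) x)
      have hc := (consistent_traj lam ω M k).count x
      have hsub : ((rounds (box_finite d M).toFinset (source (box d M) ω) ω.2.1 j :
          Finset (Site d × ℕ)) : Set (Site d × ℕ)) ⊆ usedSet (traj lam ω M k).used := by
        intro a ha
        rw [← hsnap]
        exact (ht a ha).trans_le (hne.used_le_used ((le_max_left _ _).trans hs1) a.1)
      have harr := arrivals_mono ω.2.1 hsub x
      rw [arrivals_coe] at harr
      have hcount : 2 ≤ ((traj lam ω M k).config x).count := by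
        have h1 : ((source (box d M) ω x : ℝ≥0∞)) + (arr ω.2.1
            (rounds (box_finite d M).toFinset (source (box d M) ω) ω.2.1 j) x : ℕ)
            ≤ ((traj lam ω M k).config x).count + (traj lam ω M k).used x := by
          rw [hc]
          gcongr
        norm_cast at h1
        have h2 := hle t0 ht00
        omega
      have hact : 0 < ((traj lam ω M k).config x).numActive := by
        rw [(consistent_traj lam ω M k).canon x, canon, if_neg (by omega)]
        simp only [SiteState.numActive]
        omega
      have hring := h.clocks.snapAt_ringTime hk1 hk2 hact
      have hfin := hmax _ (ht10.trans hl.le)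
      rw [hring] at hfin
      simp only [ringAt, Function.update_self] at hfin
      omega
    -- Each instruction has its own time; the set of instructions is finite and use is monotone, so
    -- one late time serves them all.
    choose! T hT0 hT using key
    obtain ⟨b, hb⟩ := ((rounds (box_finite d M).toFinset (source (box d M) ω) ω.2.1
      (j + 1)).image T).bddAbove
    refine ⟨max b 0, le_max_right _ _, fun a ha => (hT a ha).trans_le ?_⟩
    exact hne.used_le_used ((hb (by simpa using ⟨_, _, ha, rfl⟩)).trans (le_max_left _ _)) a.1

end

section

variable {d : ℕ}

/-! ### A dominating process -/

/-- The `w`-th time window of length `δ`. -/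
def win (δ : ℝ) (w : ℕ) : Set ℝ := Set.Ioc (w * δ) ((w + 1) * δ)

/-- The set of instructions of index below `L x` at each site `x`. -/
def below (L : Site d → ℝ≥0∞) : Set (Site d × ℕ) := {a | (a.2 : ℝ≥0∞) < L a.1}

/-- The number of particles that are initially at `x`, if only those in `S` are kept, or arrive
there when `L y` instructions are used at each site `y`. -/
def visitors (S : Set (Site d)) (ω : Noise d) (L : Site d → ℝ≥0∞) (x : Site d) : ℝ≥0∞ :=
  source S ω x + arrivals ω.2.1 (below L) x

/-- Iterative upper bounds for the number of instructions used at `x` up to the end of the window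
`w`: in each window the `i`-th clock of `x` is effective if there may have been more than `i`
visitors of `x` before the end of the window. -/
def domUsed (S : Set (Site d)) (ω : Noise d) (δ : ℝ) : ℕ → ℕ → Site d → ℝ≥0∞
  | 0 => fun _ _ => 0
  | g + 1 => fun w x => cnt {a : ℕ × ℕ | ∃ v ≤ w, ringTime ω x a.1 a.2 ∈ win δ v ∧
      (a.1 : ℝ≥0∞) < visitors S ω (domUsed S ω δ g v) x}

lemma below_mono {L L' : Site d → ℝ≥0∞} (h : L ≤ L') : below L ⊆ below L' :=
  fun a ha => lt_of_lt_of_le ha (h a.1)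

lemma visitors_mono {S S' : Set (Site d)} (hS : S ⊆ S') {ω : Noise d} {L L' : Site d → ℝ≥0∞}
    (h : L ≤ L') (x : Site d) : visitors S ω L x ≤ visitors S' ω L' x :=
  add_le_add (by exact_mod_cast source_mono hS ω x) (arrivals_mono _ (below_mono h) x)

lemma domUsed_mono_window (S : Set (Site d)) (ω : Noise d) (δ : ℝ) (g : ℕ) :
    Monotone (domUsed S ω δ g) := by
  intro w w' hw x
  cases g with
  | zero => exact le_rfl
  | succ g => exact cnt_mono fun a ⟨v, hv, h⟩ => ⟨v, hv.trans hw, h⟩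

lemma domUsed_mono_succ {S S' : Set (Site d)} (hS : S ⊆ S') (ω : Noise d) (δ : ℝ) (g w : ℕ) :
    domUsed S ω δ g w ≤ domUsed S' ω δ (g + 1) w := by
  intro x
  induction g generalizing w x with
  | zero => exact zero_le
  | succ g ih =>
    exact cnt_mono fun a ⟨v, hv, h1, h2⟩ =>
      ⟨v, hv, h1, h2.trans_le (visitors_mono hS (fun x => ih v x) _)⟩

lemma domUsed_mono (S : Set (Site d)) (ω : Noise d) (δ : ℝ) (w : ℕ) :
    Monotone fun g => domUsed S ω δ g w :=
  monotone_nat_of_le_succ fun g => domUsed_mono_succ subset_rfl ω δ g w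

lemma exists_mem_win {δ : ℝ} (hδ : 0 < δ) {r : ℝ} (hr : 0 < r) : ∃ w, r ∈ win δ w := by
  have h1 : 1 ≤ ⌈r / δ⌉₊ := Nat.one_le_iff_ne_zero.2 (Nat.ceil_pos.2 (by positivity)).ne'
  refine ⟨⌈r / δ⌉₊ - 1, ?_, ?_⟩
  · rw [← lt_div_iff₀ hδ]
    exact Nat.lt_ceil.1 (by omega)
  · rw [← div_le_iff₀ hδ, Nat.cast_sub h1]
    simpa using Nat.le_ceil (r / δ)

lemma le_of_mem_win {δ : ℝ} (hδ : 0 < δ) {r : ℝ} {v w : ℕ} (hv : r ∈ win δ v)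
    (hw : r ≤ (w + 1) * δ) : v ≤ w := by
  have h := lt_of_mul_lt_mul_right (hv.1.trans_le hw) hδ.le
  have h2 : (v : ℝ) < ((w + 1 : ℕ) : ℝ) := by push_cast; exact h
  exact Nat.lt_succ_iff.1 (by exact_mod_cast h2)

section

variable {lam : ℝ≥0∞} {ω : Noise d} {M : ℕ} {S : Set (Site d)} {δ : ℝ}

/-- The rings up to time `r` that the `g + 1`-st iteration of the bound takes into account. -/
def domRings (S : Set (Site d)) (ω : Noise d) (δ : ℝ) (g : ℕ) (r : ℝ) (x : Site d) :
    Set (ℕ × ℕ) :=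
  {a | ringTime ω x a.1 a.2 ≤ r ∧ ∃ v, ringTime ω x a.1 a.2 ∈ win δ v ∧
    (a.1 : ℝ≥0∞) < visitors S ω (domUsed S ω δ g v) x}

lemma cnt_domRings_le (hδ : 0 < δ) {g w : ℕ} {r : ℝ} (hr : r ≤ (w + 1) * δ) (x : Site d) :
    cnt (domRings S ω δ g r x) ≤ domUsed S ω δ (g + 1) w x :=
  cnt_mono fun _ ⟨h1, v, h2, h3⟩ => ⟨v, le_of_mem_win hδ h2 (h1.trans hr), h2, h3⟩

/-- Each used instruction is charged to a different ring, and induction on the number `k` of rings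
shows that `k` iterations of the bound suffice. A clock that rings effectively has index below the
current count, hence below the number of visitors by the end of its window. -/
lemma traj_used_le_domRings (hδ : 0 < δ) (hS : box d M ⊆ S)
    (k : ℕ) (x : Site d) :
    ((traj lam ω M k).used x : ℝ≥0∞) ≤ cnt (domRings S ω δ k (traj lam ω M k).time x) := by
  induction k generalizing x with
  | zero =>
    have : (traj lam ω M 0).used x = 0 := rfl
    simp [this]
  | succ k ih =>
    have hmono : ∀ {r r' : ℝ} (y : Site d), r ≤ r' →
        domRings S ω δ k r y ⊆ domRings S ω δ (k + 1) r' y :=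
      fun y hr a ⟨h1, v, h2, h3⟩ => ⟨h1.trans hr, v, h2,
        h3.trans_le (visitors_mono subset_rfl (domUsed_mono_succ subset_rfl ω δ k v) y)⟩
    have ht := traj_time_le_succ lam ω M k
    rw [traj_succ] at ht ⊢
    cases hq : nextRing ω (traj lam ω M k) with
    | none =>
      rw [adv_of_none hq]
      exact (ih x).trans (cnt_mono (hmono x le_rfl))
    | some q =>
      rw [adv_of_some hq] at ht ⊢
      obtain ⟨r, y⟩ := q
      obtain ⟨h1, ⟨i, hi, m, hm⟩, -⟩ := isNextRing_of_nextRing hq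
      simp only at h1 hi hm
      by_cases hx : x = y
      · subst hx
        have hu : (ringAt lam ω.2.1 (traj lam ω M k) r x).used x
            = (traj lam ω M k).used x + 1 := by simp [ringAt]
        rw [hu]
        -- The present ring is strictly later than all rings charged so far, so it raises the count
        -- by one.
        have hnot : (i, m) ∉ domRings S ω δ k (traj lam ω M k).time x :=
          fun h => absurd (hm ▸ h.1) (not_le.2 h1)
        push_cast
        refine (add_le_add_left (ih x) 1).trans ?_
        rw [← cnt_insert hnot]
        refine cnt_mono (Set.insert_subset ?_ (hmono x h1.le))
        have hr0 : 0 < r := (traj_time_nonneg lam ω M k).trans_lt h1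
        obtain ⟨w, hw⟩ := exists_mem_win hδ hr0
        refine ⟨hm.le, w, hm.symm ▸ hw, ?_⟩
        have hle := SiteState.numActive_le_count ((traj lam ω M k).config x)
        have hc := (consistent_traj lam ω M k).count x
        calc (i : ℝ≥0∞) < ((traj lam ω M k).config x).count := by exact_mod_cast hi.trans_le hle
          _ ≤ ((traj lam ω M k).config x).count + (traj lam ω M k).used x := le_self_add
          _ = _ := hc
          _ ≤ _ := by
            refine add_le_add (by exact_mod_cast source_mono hS ω x) (arrivals_mono _ ?_ x)
            intro a ha
            refine lt_of_lt_of_le (b := ((traj lam ω M k).used a.1 : ℝ≥0∞))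
              (by exact_mod_cast ha) ?_
            exact (ih a.1).trans (cnt_domRings_le hδ (h1.le.trans hw.2) a.1)
      · have hu : (ringAt lam ω.2.1 (traj lam ω M k) r y).used x
            = (traj lam ω M k).used x := by simp [ringAt, hx]
        rw [hu]
        exact (ih x).trans (cnt_mono (hmono x h1.le))

lemma traj_used_le_domUsed (hδ : 0 < δ) (hS : box d M ⊆ S)
    {k w : ℕ} (hk : (traj lam ω M k).time ≤ (w + 1) * δ) (x : Site d) :
    ((traj lam ω M k).used x : ℝ≥0∞) ≤ domUsed S ω δ (k + 1) w x :=
  (traj_used_le_domRings hδ hS k x).trans (cnt_domRings_le hδ hk x)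

lemma traj_count_le_visitors (hδ : 0 < δ) (hS : box d M ⊆ S)
    {k w : ℕ} (hk : (traj lam ω M k).time ≤ (w + 1) * δ) (x : Site d) :
    (((traj lam ω M k).config x).count : ℝ≥0∞) + (traj lam ω M k).used x
      ≤ visitors S ω (domUsed S ω δ (k + 1) w) x := by
  rw [(consistent_traj lam ω M k).count x]
  refine add_le_add (by exact_mod_cast source_mono hS ω x) (arrivals_mono _ ?_ x)
  intro a ha
  exact lt_of_lt_of_le (b := ((traj lam ω M k).used a.1 : ℝ≥0∞))
    (by exact_mod_cast ha) (traj_used_le_domUsed hδ hS hk a.1)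

lemma tsum_used_ringAt (τ : Site d × ℕ → Instruction d) (s : Snapshot d) (r : ℝ) (x : Site d) :
    ∑' y, ((ringAt lam τ s r x).used y : ℝ≥0∞) = ∑' y, (s.used y : ℝ≥0∞) + 1 := by
  classical
  have : ∀ y, ((ringAt lam τ s r x).used y : ℝ≥0∞)
      = s.used y + (if y = x then 1 else 0) := by
    intro y
    by_cases hy : y = x
    · subst hy; simp [ringAt]
    · simp [ringAt, hy]
  simp_rw [this]
  rw [ENNReal.tsum_add, tsum_ite_eq]

/-- Every effective ring raises the total number of used instructions by one, while by any fixed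
time this total is at most `C`, uniformly in the number of iterations. -/
lemma nonExplosive_of_domUsed (hδ : 0 < δ)
    (hfin : ∀ w, ∃ C : ℕ, ∀ g, ∑' x, domUsed (box d M) ω δ g w x ≤ C) :
    NonExplosive lam ω M := by
  by_contra hne
  simp only [NonExplosive, not_forall, not_exists, Stopped, not_lt] at hne
  obtain ⟨t, ht⟩ := hne
  have hsum : ∀ k : ℕ, (k : ℝ≥0∞) ≤ ∑' x, ((traj lam ω M k).used x : ℝ≥0∞) := by
    intro k
    induction k with
    | zero => simp
    | succ k ih =>
      obtain ⟨q, hq, -⟩ := ht k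
      rw [traj_succ, adv_of_some hq, tsum_used_ringAt]
      push_cast
      gcongr
  have htime : ∀ k, (traj lam ω M (k + 1)).time ≤ t := by
    intro k
    obtain ⟨q, hq, hqt⟩ := ht k
    rw [traj_succ, adv_of_some hq]
    exact hqt
  obtain ⟨w, hw⟩ := exists_nat_ge (t / δ)
  have hw' : t ≤ (w + 1) * δ := by
    rw [div_le_iff₀ hδ] at hw
    linarith
  obtain ⟨C, hC⟩ := hfin w
  have h1 := (hsum (C + 1)).trans ((ENNReal.tsum_le_tsum fun x =>
    traj_used_le_domUsed hδ subset_rfl ((htime C).trans hw') x).trans (hC _))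
  norm_cast at h1
  omega

/-- Sufficient conditions for the good properties in terms of the dominating process. -/
theorem GoodClocks.good (hg : GoodClocks ω) (hδ : 0 < δ)
    (hbox : ∀ M w, ∃ C : ℕ, ∀ g, ∑' x, domUsed (box d M) ω δ g w x ≤ C)
    (huniv : ∀ w x, ∃ C : ℕ, ∀ g, visitors Set.univ ω (domUsed Set.univ ω δ g w) x ≤ C) :
    Good lam ω where
  clocks := hg
  nonExplosive M := nonExplosive_of_domUsed hδ (hbox M)
  bounded x t := by
    obtain ⟨w, hw⟩ := exists_nat_ge (t / δ)
    have hw' : t ≤ (w + 1) * δ := by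
      rw [div_le_iff₀ hδ] at hw
      linarith
    obtain ⟨C, hC⟩ := huniv w x
    refine ⟨C, fun M k hk => ?_⟩
    have := (traj_count_le_visitors hδ (Set.subset_univ (box d M)) (hk.trans hw') x).trans
      (hC _)
    exact_mod_cast this

end

end

section

variable {d : ℕ}

/-! ### Resampling coordinates -/

section resampling

variable {ι κ X : Type*} [MeasurableSpace X]

lemma measurable_update_prod [DecidableEq ι] (a : ι) :
    Measurable fun q : (ι → X) × X => Function.update q.1 a q.2 := by
  refine measurable_pi_iff.2 fun i => ?_
  by_cases h : i = a
  · subst h; simpa using measurable_snd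
  · simp only [Function.update_of_ne h]
    exact (measurable_pi_apply i).comp measurable_fst

lemma measurable_extend_prod {e : κ → ι} (he : Function.Injective e) :
    Measurable fun q : (ι → X) × (κ → X) => Function.extend e q.2 q.1 := by
  refine measurable_pi_iff.2 fun i => ?_
  by_cases h : ∃ k, e k = i
  · obtain ⟨k, rfl⟩ := h
    simp only [he.extend_apply]
    exact (measurable_pi_apply k).comp measurable_snd
  · simp only [Function.extend_apply' _ _ _ h]
    exact (measurable_pi_apply i).comp measurable_fst

/-- Overwriting coordinates of an i.i.d. family by fresh independent copies preserves the law.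
Independence is used throughout in this form: a quantity that ignores some coordinates is unchanged
by resampling them. -/
lemma measurePreserving_extend {e : κ → ι} (he : Function.Injective e) (ν : Measure X)
    [IsProbabilityMeasure ν] :
    MeasurePreserving (fun q : (ι → X) × (κ → X) => Function.extend e q.2 q.1)
      ((Measure.infinitePi fun _ => ν).prod (Measure.infinitePi fun _ => ν))
      (Measure.infinitePi fun _ => ν) := by
  classical
  refine ⟨measurable_extend_prod he, Measure.eq_infinitePi _ fun s t ht => ?_⟩
  rw [Measure.map_apply (measurable_extend_prod he)
    (MeasurableSet.pi s.countable_toSet fun i _ => ht i)]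
  have hpre : (fun q : (ι → X) × (κ → X) => Function.extend e q.2 q.1) ⁻¹' (Set.pi s t)
      = (Set.pi (s.filter fun i => i ∉ Set.range e : Finset ι) t)
        ×ˢ (Set.pi (s.preimage e he.injOn : Finset κ) fun k => t (e k)) := by
    ext ⟨f, v⟩
    simp only [Set.mem_preimage, Set.mem_pi, Set.mem_prod, Finset.mem_coe, Finset.mem_filter,
      Finset.mem_preimage, Set.mem_range, not_exists]
    constructor
    · refine fun h => ⟨fun i hi => ?_, fun k hk => ?_⟩
      · have := h i hi.1
        rwa [Function.extend_apply' _ _ _ (by simpa using hi.2)] at this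
      · simpa [he.extend_apply] using h _ hk
    · rintro ⟨h1, h2⟩ i hi
      by_cases h : ∃ k, e k = i
      · obtain ⟨k, rfl⟩ := h
        simpa [he.extend_apply] using h2 k hi
      · rw [Function.extend_apply' _ _ _ h]
        exact h1 i ⟨hi, by simpa using h⟩
  rw [hpre, Measure.prod_prod, Measure.infinitePi_pi _ (fun i _ => ht i),
    Measure.infinitePi_pi _ (fun i _ => ht (e i)),
    Finset.prod_preimage' e s he.injOn (fun i => ν (t i)), mul_comm,
    Finset.prod_filter_mul_prod_filter_not]

lemma measurePreserving_update [DecidableEq ι] (a : ι) (ν : Measure X) [IsProbabilityMeasure ν] :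
    MeasurePreserving (fun q : (ι → X) × X => Function.update q.1 a q.2)
      ((Measure.infinitePi fun _ => ν).prod ν) (Measure.infinitePi fun _ => ν) := by
  refine ⟨measurable_update_prod a, Measure.eq_infinitePi _ fun s t ht => ?_⟩
  rw [Measure.map_apply (measurable_update_prod a)
    (MeasurableSet.pi s.countable_toSet fun i _ => ht i)]
  have hpre : (fun q : (ι → X) × X => Function.update q.1 a q.2) ⁻¹' (Set.pi s t)
      = (Set.pi (s.erase a : Finset ι) t) ×ˢ (if a ∈ s then t a else Set.univ) := by
    ext ⟨f, v⟩
    simp only [Set.mem_preimage, Set.mem_pi, Set.mem_prod, Finset.mem_coe, Finset.mem_erase]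
    constructor
    · refine fun h => ⟨fun i hi => ?_, ?_⟩
      · simpa [hi.1] using h i hi.2
      · split_ifs with ha
        · simpa using h a ha
        · trivial
    · rintro ⟨h1, h2⟩ i hi
      by_cases h : i = a
      · subst h; simpa [hi] using h2
      · simpa [h] using h1 i ⟨h, hi⟩
  rw [hpre, Measure.prod_prod, Measure.infinitePi_pi _ (fun i _ => ht i)]
  split_ifs with ha
  · rw [Finset.prod_erase_mul _ _ ha]
  · rw [Finset.erase_eq_of_notMem ha, measure_univ, mul_one]

variable {α β γ ε : Type*} [MeasurableSpace α] [MeasurableSpace β] [MeasurableSpace γ]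
  [MeasurableSpace ε] {μα : Measure α} {μβ : Measure β} {μγ : Measure γ} {με : Measure ε}
  [SFinite μα] [SFinite μβ] [SFinite μγ] [SFinite με]

lemma measurePreserving_middle {φ : β × ε → β} (h : MeasurePreserving φ (μβ.prod με) μβ) :
    MeasurePreserving (fun q : (α × β × γ) × ε => (q.1.1, φ (q.1.2.1, q.2), q.1.2.2))
      ((μα.prod (μβ.prod μγ)).prod με) (μα.prod (μβ.prod μγ)) := by
  have hφ := h.measurable
  have hm : Measurable (fun q : (α × β × γ) × ε => (q.1.1, φ (q.1.2.1, q.2), q.1.2.2)) := by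
    fun_prop
  refine ⟨hm, Measure.ext_of_lintegral _ fun f hf => ?_⟩
  rw [lintegral_map hf hm, lintegral_prod _ (by fun_prop), lintegral_prod _ (by fun_prop),
    lintegral_prod _ (by fun_prop)]
  refine lintegral_congr fun a => ?_
  rw [lintegral_prod _ (by fun_prop), lintegral_prod _ (by fun_prop)]
  have h1 : ∫⁻ b, ∫⁻ c, f (a, b, c) ∂μγ ∂μβ
      = ∫⁻ q, ∫⁻ c, f (a, φ q, c) ∂μγ ∂(μβ.prod με) := by
    rw [← h.lintegral_comp (f := fun b => ∫⁻ c, f (a, b, c) ∂μγ)]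
    exact Measurable.lintegral_prod_right' (f := fun q : β × γ => f (a, q)) (by fun_prop)
  rw [h1, lintegral_prod]
  · refine lintegral_congr fun b => ?_
    rw [lintegral_lintegral_swap]
    fun_prop
  · refine (Measurable.lintegral_prod_right'
      (f := fun q : (β × ε) × γ => f (a, φ q.1, q.2)) (by fun_prop)).aemeasurable

lemma measurePreserving_last {φ : γ × ε → γ} (h : MeasurePreserving φ (μγ.prod με) μγ) :
    MeasurePreserving (fun q : (α × β × γ) × ε => (q.1.1, q.1.2.1, φ (q.1.2.2, q.2)))
      ((μα.prod (μβ.prod μγ)).prod με) (μα.prod (μβ.prod μγ)) := by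
  have hφ := h.measurable
  have hm : Measurable (fun q : (α × β × γ) × ε => (q.1.1, q.1.2.1, φ (q.1.2.2, q.2))) := by
    fun_prop
  refine ⟨hm, Measure.ext_of_lintegral _ fun f hf => ?_⟩
  rw [lintegral_map hf hm, lintegral_prod _ (by fun_prop), lintegral_prod _ (by fun_prop),
    lintegral_prod _ (by fun_prop)]
  refine lintegral_congr fun a => ?_
  rw [lintegral_prod _ (by fun_prop), lintegral_prod _ (by fun_prop)]
  refine lintegral_congr fun b => ?_
  rw [← h.lintegral_comp (f := fun c => f (a, b, c)) (by fun_prop), lintegral_prod _ (by fun_prop)]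

end resampling

/-- Replace one instruction. -/
def setInstr (a : Site d × ℕ) (ω : Noise d) (v : Instruction d) : Noise d :=
  (ω.1, Function.update ω.2.1 a v, ω.2.2)

/-- Replace the waiting times of one clock. -/
def setClock (x : Site d) (i : ℕ) (ω : Noise d) (v : ℕ → ℝ) : Noise d :=
  (ω.1, ω.2.1, Function.extend (fun l : ℕ => (x, i, l)) v ω.2.2)

lemma clock_injective (x : Site d) (i : ℕ) : Function.Injective fun l : ℕ => (x, i, l) :=
  fun _ _ h => by simpa using h

section noise

variable (p : PMF (Site d)) (lam : ℝ≥0∞) (mu : ℝ≥0)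

lemma measurePreserving_setInstr (a : Site d × ℕ) :
    MeasurePreserving (fun q : Noise d × Instruction d => setInstr a q.1 q.2)
      ((noiseLaw p lam mu).prod (instructionLaw p lam)) (noiseLaw p lam mu) :=
  measurePreserving_middle (measurePreserving_update a (instructionLaw p lam))

/-- The law of the waiting times of one clock. -/
def clockLaw (lam : ℝ≥0∞) : Measure (ℕ → ℝ) :=
  Measure.infinitePi fun _ : ℕ => expMeasure (clockRate lam)

instance (lam : ℝ≥0∞) : IsProbabilityMeasure (clockLaw lam) := by
  unfold clockLaw
  infer_instance

lemma measurePreserving_setClock (x : Site d) (i : ℕ) :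
    MeasurePreserving (fun q : Noise d × (ℕ → ℝ) => setClock x i q.1 q.2)
      ((noiseLaw p lam mu).prod (clockLaw lam)) (noiseLaw p lam mu) :=
  measurePreserving_last (measurePreserving_extend (clock_injective x i)
    (expMeasure (clockRate lam)))

/-- The condition `hinv` says that `F` does not look at the instruction `a`; resampling that
instruction then makes the expectation factorise. -/
lemma lintegral_mul_instr {F : Noise d → ℝ≥0∞} (hF : Measurable F) {H : Instruction d → ℝ≥0∞}
    (a : Site d × ℕ) (hinv : ∀ ω v, F (setInstr a ω v) = F ω) :
    ∫⁻ ω, F ω * H (ω.2.1 a) ∂noiseLaw p lam mu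
      = (∫⁻ ω, F ω ∂noiseLaw p lam mu) * ∫⁻ v, H v ∂instructionLaw p lam := by
  have hH : Measurable H := measurable_from_top
  rw [← (measurePreserving_setInstr p lam mu a).lintegral_comp (by fun_prop),
    ← lintegral_prod_mul hF.aemeasurable hH.aemeasurable]
  refine lintegral_congr fun q => ?_
  rw [hinv]
  simp [setInstr]

lemma integral_mul_instr {F : Noise d → ℝ} (hF : Measurable F) {H : Instruction d → ℝ}
    (a : Site d × ℕ) (hinv : ∀ ω v, F (setInstr a ω v) = F ω) :
    ∫ ω, F ω * H (ω.2.1 a) ∂noiseLaw p lam mu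
      = (∫ ω, F ω ∂noiseLaw p lam mu) * ∫ v, H v ∂instructionLaw p lam := by
  have hH : Measurable H := measurable_from_top
  have hmp := measurePreserving_setInstr p lam mu a
  rw [← integral_prod_mul F H]
  conv_lhs => rw [← hmp.map_eq]
  rw [integral_map hmp.measurable.aemeasurable (by fun_prop)]
  refine integral_congr_ae (Eventually.of_forall fun q => ?_)
  simp only [hinv]
  simp [setInstr]

lemma lintegral_mul_clock {F : Noise d → ℝ≥0∞} (hF : Measurable F) {H : (ℕ → ℝ) → ℝ≥0∞}
    (hH : Measurable H) (x : Site d) (i : ℕ) (hinv : ∀ ω v, F (setClock x i ω v) = F ω) :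
    ∫⁻ ω, F ω * H (fun l => ω.2.2 (x, i, l)) ∂noiseLaw p lam mu
      = (∫⁻ ω, F ω ∂noiseLaw p lam mu) * ∫⁻ v, H v ∂clockLaw lam := by
  rw [← (measurePreserving_setClock p lam mu x i).lintegral_comp (by fun_prop),
    ← lintegral_prod_mul hF.aemeasurable hH.aemeasurable]
  refine lintegral_congr fun q => ?_
  rw [hinv]
  congr 2
  funext l
  exact (clock_injective x i).extend_apply _ _ _

end noise

end

section

variable {d : ℕ}

/-! ### The clocks -/

/-- The sum of the first `m` waiting times. -/
def partialSum (v : ℕ → ℝ) (m : ℕ) : ℝ := ∑ l ∈ Finset.range m, v l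

lemma measurable_partialSum (m : ℕ) : Measurable fun v => partialSum v m := by
  unfold partialSum
  fun_prop

lemma ringTime_eq_partialSum (ω : Noise d) (x : Site d) (i m : ℕ) :
    ringTime ω x i m = partialSum (fun l => ω.2.2 (x, i, l)) (m + 1) := rfl

variable (lam : ℝ≥0∞)

lemma expMeasure_Iic (x : ℝ) : expMeasure (clockRate lam) (Set.Iic x)
    = ENNReal.ofReal (if 0 ≤ x then 1 - Real.exp (-(clockRate lam * x)) else 0) := by
  rw [← cdf_expMeasure_eq (clockRate_pos lam), cdf_eq_real, ofReal_measureReal]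

lemma expMeasure_Iic_zero : expMeasure (clockRate lam) (Set.Iic 0) = 0 := by
  rw [expMeasure_Iic]; simp

lemma expMeasure_singleton (c : ℝ) : expMeasure (clockRate lam) {c} = 0 := by
  unfold expMeasure gammaMeasure
  exact withDensity_absolutelyContinuous _ _ (measure_singleton c)

/-- Here `s` is the previous ring time. If `s ≤ T`, lack of memory gives the hitting probability of
the window, given that `T` is passed; if `s` lies in the window, the next ring must come within `δ`;
later values of `s` contribute nothing. -/
lemma expMeasure_Ioc {δ : ℝ} (hδ : 0 ≤ δ) (T s : ℝ) :
    expMeasure (clockRate lam) {u | s + u ∈ Set.Ioc T (T + δ)}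
      ≤ ENNReal.ofReal (1 - Real.exp (-(clockRate lam * δ))) *
        (Set.indicator (Set.Iic T) (fun s => expMeasure (clockRate lam) {u | T < s + u}) s
          + Set.indicator (Set.Ioc T (T + δ)) 1 s) := by
  have hc := clockRate_pos lam
  set c := clockRate lam
  have h1 : {u : ℝ | s + u ∈ Set.Ioc T (T + δ)} = Set.Ioc (T - s) (T - s + δ) := by
    ext u
    simp only [Set.mem_Ioc, Set.mem_ofPred_eq]
    constructor <;> rintro ⟨h, h'⟩ <;> constructor <;> linarith
  have h2 : ∀ s : ℝ, {u : ℝ | T < s + u} = (Set.Iic (T - s))ᶜ := by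
    intro s
    ext u
    simp [sub_lt_iff_lt_add']
  rw [h1]
  have hIoc : ∀ a : ℝ, expMeasure c (Set.Ioc a (a + δ))
      = expMeasure c (Set.Iic (a + δ)) - expMeasure c (Set.Iic a) := by
    intro a
    rw [← measure_sdiff (Set.Iic_subset_Iic.2 (by linarith)) measurableSet_Iic.nullMeasurableSet
      (measure_ne_top _ _)]
    congr 1
    ext u
    simp [and_comm]
  by_cases hs : s ≤ T
  · rw [Set.indicator_of_mem (show s ∈ Set.Iic T from hs), Set.indicator_of_notMem (by simp [hs]),
      add_zero, h2,
      measure_compl measurableSet_Iic (measure_ne_top _ _), measure_univ, hIoc,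
      expMeasure_Iic, expMeasure_Iic, if_pos (by linarith), if_pos (by linarith),
      ← ENNReal.ofReal_sub, ← ENNReal.ofReal_one, ← ENNReal.ofReal_sub, ← ENNReal.ofReal_mul]
    · refine ENNReal.ofReal_le_ofReal (le_of_eq ?_)
      rw [show -(clockRate lam * (T - s + δ)) = -(c * (T - s)) + -(c * δ) by
        simp only [c]; ring, Real.exp_add]
      ring
    · simp only [sub_nonneg, Real.exp_le_one_iff, Left.neg_nonpos_iff]
      positivity
    · simp only [sub_nonneg, Real.exp_le_one_iff, Left.neg_nonpos_iff]
      exact mul_nonneg hc.le (by linarith)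
    · simp only [sub_nonneg, Real.exp_le_one_iff, Left.neg_nonpos_iff]
      exact mul_nonneg hc.le (by linarith)
  · rw [Set.indicator_of_notMem (by simpa using hs), zero_add]
    by_cases hs' : s ≤ T + δ
    · rw [Set.indicator_of_mem (show s ∈ Set.Ioc T (T + δ) from ⟨not_le.1 hs, hs'⟩)]
      simp only [Pi.one_apply, mul_one]
      refine (measure_mono Set.Ioc_subset_Iic_self).trans ?_
      rw [expMeasure_Iic, if_pos (by linarith)]
      refine ENNReal.ofReal_le_ofReal ?_
      gcongr
      linarith
    · have : expMeasure c (Set.Ioc (T - s) (T - s + δ)) ≤ expMeasure c (Set.Iic 0) :=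
        measure_mono (Set.Ioc_subset_Iic_self.trans (Set.Iic_subset_Iic.2 (by linarith)))
      rw [expMeasure_Iic_zero] at this
      exact this.trans zero_le

lemma lintegral_partialSum_succ {f : ℝ → ℝ → ℝ≥0∞} (hf : Measurable (Function.uncurry f)) (m : ℕ) :
    ∫⁻ v, f (partialSum v m) (partialSum v (m + 1)) ∂clockLaw lam
      = ∫⁻ v, ∫⁻ u, f (partialSum v m) (partialSum v m + u) ∂expMeasure (clockRate lam)
        ∂clockLaw lam := by
  have hmp := measurePreserving_update m (expMeasure (clockRate lam))
  have hps := measurable_partialSum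
  have hm : Measurable fun v => f (partialSum v m) (partialSum v (m + 1)) :=
    hf.comp ((hps m).prodMk (hps (m + 1)))
  have hu : ∀ (v : ℕ → ℝ) u, partialSum (Function.update v m u) m = partialSum v m := by
    intro v u
    refine Finset.sum_congr rfl fun l hl => ?_
    rw [Function.update_of_ne (Finset.mem_range.1 hl).ne]
  have hu' : ∀ (v : ℕ → ℝ) u, partialSum (Function.update v m u) (m + 1)
      = partialSum v m + u := by
    intro v u
    rw [← hu v u, partialSum, Finset.sum_range_succ, Function.update_self]
    rfl
  rw [clockLaw, ← hmp.lintegral_comp hm, lintegral_prod]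
  · simp only [hu, hu']
  · exact (hm.comp hmp.measurable).aemeasurable

lemma ae_clock_pos : ∀ᵐ v ∂clockLaw lam, ∀ l, 0 < v l := by
  refine ae_all_iff.2 fun l => ?_
  have h := measurePreserving_eval_infinitePi (fun _ : ℕ => expMeasure (clockRate lam)) l
  refine h.quasiMeasurePreserving.ae (p := fun u => 0 < u) ?_
  rw [ae_iff]
  simp only [not_lt]
  exact expMeasure_Iic_zero lam

/-- The partial sums increase almost surely, so the level `T` is crossed by at most one step. -/
lemma sum_crossing_le (T : ℝ) (n : ℕ) :
    ∑ m ∈ Finset.range n, clockLaw lam {v | partialSum v m ≤ T ∧ T < partialSum v (m + 1)}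
      ≤ 1 := by
  classical
  have hmeas : ∀ m, MeasurableSet {v : ℕ → ℝ | partialSum v m ≤ T ∧ T < partialSum v (m + 1)} :=
    fun m => (measurableSet_le (measurable_partialSum m) measurable_const).inter
      (measurableSet_lt measurable_const (measurable_partialSum (m + 1)))
  simp_rw [← lintegral_indicator_one (hmeas _)]
  rw [← lintegral_finsetSum _ fun m _ => measurable_one.indicator (hmeas m)]
  calc _ ≤ ∫⁻ _, 1 ∂clockLaw lam := by
        refine lintegral_mono_ae ?_
        filter_upwards [ae_clock_pos lam] with v hv
        have hmono : Monotone (partialSum v) := monotone_nat_of_le_succ fun m => by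
          rw [partialSum, partialSum, Finset.sum_range_succ]
          linarith [hv m]
        by_cases hex : ∃ m ∈ Finset.range n, partialSum v m ≤ T ∧ T < partialSum v (m + 1)
        · obtain ⟨m, hm, h1, h2⟩ := hex
          rw [Finset.sum_eq_single_of_mem m hm]
          · rw [Set.indicator_apply]
            split_ifs <;> simp
          · intro l _ hlm
            rw [Set.indicator_apply, if_neg]
            rintro ⟨h3, h4⟩
            rcases lt_or_gt_of_ne hlm with h | h
            · exact absurd (h4.trans_le (hmono (Nat.succ_le_of_lt h))) (not_lt.2 h1)
            · exact absurd (h2.trans_le (hmono (Nat.succ_le_of_lt h))) (not_lt.2 h3)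
        · rw [Finset.sum_eq_zero]
          · exact zero_le
          · intro m hm
            rw [Set.indicator_apply, if_neg]
            exact fun h => hex ⟨m, hm, h⟩
    _ = 1 := by simp

/-- The length of the time windows. -/
def winLength : ℝ := 1 / (3 * clockRate lam)

lemma winLength_pos : 0 < winLength lam := by
  have := clockRate_pos lam
  unfold winLength
  positivity

/-- A renewal inequality. A ring in the window either is the first beyond its left end, or follows
another ring in the window, with conditional probability at most ε = 1 - exp(-1/3) ≤ 1/3. The
expected number S thus satisfies S ≤ ε(1 + S), whence S ≤ 1/2. -/
lemma tsum_ring_mem_win_le (w : ℕ) :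
    ∑' m, clockLaw lam {v | partialSum v (m + 1) ∈ win (winLength lam) w} ≤ 2⁻¹ := by
  have hδ := winLength_pos lam
  set δ := winLength lam with hδdef
  set T : ℝ := w * δ
  have hT : 0 ≤ T := by positivity
  have hwin : win δ w = Set.Ioc T (T + δ) := by
    rw [win, add_mul, one_mul]
  rw [hwin]
  set ε : ℝ := 1 - Real.exp (-(clockRate lam * δ))
  have hε0 : 0 ≤ ε := by
    simp only [ε, sub_nonneg, Real.exp_le_one_iff, Left.neg_nonpos_iff]
    exact mul_nonneg (clockRate_pos lam).le hδ.le
  have hε : ε ≤ 1 / 3 := by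
    have h1 := Real.add_one_le_exp (-(clockRate lam * δ))
    have h2 : clockRate lam * δ = 1 / 3 := by
      have := (clockRate_pos lam).ne'
      rw [hδdef, winLength]
      field_simp
    simp only [ε]
    linarith
  have hmW : ∀ m, MeasurableSet {v : ℕ → ℝ | partialSum v m ∈ Set.Ioc T (T + δ)} :=
    fun m => measurable_partialSum m measurableSet_Ioc
  have hstep : ∀ m, clockLaw lam {v | partialSum v (m + 1) ∈ Set.Ioc T (T + δ)}
      ≤ ENNReal.ofReal ε *
        (clockLaw lam {v | partialSum v m ≤ T ∧ T < partialSum v (m + 1)}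
          + clockLaw lam {v | partialSum v m ∈ Set.Ioc T (T + δ)}) := by
    intro m
    have h1 : clockLaw lam {v | partialSum v (m + 1) ∈ Set.Ioc T (T + δ)}
        = ∫⁻ v, expMeasure (clockRate lam) {u | partialSum v m + u ∈ Set.Ioc T (T + δ)}
          ∂clockLaw lam := by
      rw [← lintegral_indicator_one (hmW (m + 1))]
      have := lintegral_partialSum_succ lam
        (f := fun _ r => (Set.Ioc T (T + δ)).indicator 1 r)
        ((measurable_one.indicator measurableSet_Ioc).comp measurable_snd) m
      refine (Eq.trans ?_ this).trans ?_
      · rfl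
      · refine lintegral_congr fun v => ?_
        rw [← lintegral_indicator_one]
        · rfl
        · exact (measurable_const_add _) measurableSet_Ioc
    have h2 : clockLaw lam {v | partialSum v m ≤ T ∧ T < partialSum v (m + 1)}
        = ∫⁻ v, (Set.Iic T).indicator (fun s => expMeasure (clockRate lam) {u | T < s + u})
          (partialSum v m) ∂clockLaw lam := by
      have hms : MeasurableSet {q : ℝ × ℝ | q.1 ≤ T ∧ T < q.2} :=
        (measurableSet_le measurable_fst measurable_const).inter
          (measurableSet_lt measurable_const measurable_snd)
      have hms' : MeasurableSet {v : ℕ → ℝ | partialSum v m ≤ T ∧ T < partialSum v (m + 1)} :=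
        ((measurable_partialSum m).prodMk (measurable_partialSum (m + 1))) hms
      rw [← lintegral_indicator_one hms']
      have := lintegral_partialSum_succ lam
        (f := fun s r => {q : ℝ × ℝ | q.1 ≤ T ∧ T < q.2}.indicator 1 (s, r))
        (measurable_one.indicator hms) m
      refine (Eq.trans ?_ this).trans ?_
      · rfl
      · refine lintegral_congr fun v => ?_
        by_cases hv : partialSum v m ≤ T
        · rw [Set.indicator_of_mem (show partialSum v m ∈ Set.Iic T from hv),
            ← lintegral_indicator_one]
          · refine lintegral_congr fun u => ?_
            simp only [Set.indicator_apply, Set.mem_ofPred_eq, hv, true_and, Pi.one_apply]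
          · exact measurableSet_lt measurable_const (measurable_const_add _)
        · rw [Set.indicator_of_notMem (show partialSum v m ∉ Set.Iic T from hv)]
          simp [hv]
    have h3 : clockLaw lam {v | partialSum v m ∈ Set.Ioc T (T + δ)}
        = ∫⁻ v, (Set.Ioc T (T + δ)).indicator 1 (partialSum v m) ∂clockLaw lam := by
      rw [← lintegral_indicator_one (hmW m)]
      rfl
    rw [h1, h2, h3, ← lintegral_add_right, ← lintegral_const_mul']
    · exact lintegral_mono fun v => expMeasure_Ioc lam hδ.le T _
    · exact ENNReal.ofReal_ne_top
    · exact (measurable_one.indicator measurableSet_Ioc).comp (measurable_partialSum m)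
  have h0 : clockLaw lam {v | partialSum v 0 ∈ Set.Ioc T (T + δ)} = 0 := by
    simp [partialSum, hT.not_gt]
  -- Partial sums are used because they are finite, so that S can be absorbed into the left side.
  refine ENNReal.tsum_le_of_sum_range_le fun n => ?_
  set S := ∑ m ∈ Finset.range n,
    clockLaw lam {v | partialSum v (m + 1) ∈ Set.Ioc T (T + δ)} with hS
  have hStop : S ≠ ⊤ := ENNReal.sum_ne_top.2 fun m _ => measure_ne_top _ _
  have hSle : S ≤ ENNReal.ofReal ε * (1 + S) := by
    calc S ≤ ∑ m ∈ Finset.range n, ENNReal.ofReal ε *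
          (clockLaw lam {v | partialSum v m ≤ T ∧ T < partialSum v (m + 1)}
            + clockLaw lam {v | partialSum v m ∈ Set.Ioc T (T + δ)}) :=
          Finset.sum_le_sum fun m _ => hstep m
      _ = ENNReal.ofReal ε *
          (∑ m ∈ Finset.range n, clockLaw lam {v | partialSum v m ≤ T ∧ T < partialSum v (m + 1)}
            + ∑ m ∈ Finset.range n, clockLaw lam {v | partialSum v m ∈ Set.Ioc T (T + δ)}) := by
        rw [← Finset.mul_sum, Finset.sum_add_distrib]
      _ ≤ _ := by
        gcongr
        · exact sum_crossing_le lam T n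
        · calc _ ≤ ∑ m ∈ Finset.range (n + 1),
              clockLaw lam {v | partialSum v m ∈ Set.Ioc T (T + δ)} :=
                Finset.sum_le_sum_of_subset (Finset.range_mono (Nat.le_succ n))
            _ = S := by rw [Finset.sum_range_succ', h0, add_zero]
  clear_value S
  lift S to ℝ≥0 using hStop
  have h4 : (S : ℝ) ≤ ε * (1 + S) := by
    have := ENNReal.toReal_mono (by finiteness) hSle
    simpa [ENNReal.toReal_mul, ENNReal.toReal_add, hε0] using this
  have h5 : (S : ℝ) ≤ 2⁻¹ := by nlinarith [S.2]
  have h6 : S ≤ 2⁻¹ := by exact_mod_cast h5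
  calc (S : ℝ≥0∞) ≤ ((2⁻¹ : ℝ≥0) : ℝ≥0∞) := by exact_mod_cast h6
    _ = 2⁻¹ := by simp

/-- By Borel–Cantelli each window contains finitely many rings, and a bounded clock would place
infinitely many rings in finitely many windows. -/
lemma ae_clock_unbounded : ∀ᵐ v ∂clockLaw lam, ∀ t : ℝ, ∃ m, t < partialSum v (m + 1) := by
  have hδ := winLength_pos lam
  have h1 : ∀ᵐ v ∂clockLaw lam, ∀ w, {m | partialSum v (m + 1) ∈ win (winLength lam) w}.Finite := by
    refine ae_all_iff.2 fun w => ?_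
    exact ae_finite_setOfPred_mem ((tsum_ring_mem_win_le lam w).trans_lt (by simp)).ne
  filter_upwards [h1, ae_clock_pos lam] with v hv hpos t
  by_contra! hle
  obtain ⟨W, hW⟩ := exists_nat_ge (t / winLength lam)
  rw [div_le_iff₀ hδ] at hW
  have hfin : (⋃ w ∈ Set.Iic W, {m | partialSum v (m + 1) ∈ win (winLength lam) w}).Finite :=
    (Set.finite_Iic W).biUnion fun w _ => hv w
  refine Set.infinite_univ (hfin.subset fun m _ => ?_)
  have h0 : 0 < partialSum v (m + 1) := Finset.sum_pos (fun l _ => hpos l) (by simp)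
  obtain ⟨w, hw⟩ := exists_mem_win hδ h0
  simp only [Set.mem_iUnion]
  exact ⟨w, le_of_mem_win hδ hw ((hle m).trans (hW.trans (by nlinarith))), hw⟩

lemma clockLaw_partialSum_eq (m : ℕ) (c : ℝ) :
    clockLaw lam {v | partialSum v (m + 1) = c} = 0 := by
  have hms : MeasurableSet {v : ℕ → ℝ | partialSum v (m + 1) = c} :=
    measurable_partialSum (m + 1) (measurableSet_singleton c)
  rw [← lintegral_indicator_one hms]
  have := lintegral_partialSum_succ lam (f := fun _ r => ({c} : Set ℝ).indicator 1 r)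
    ((measurable_one.indicator (measurableSet_singleton c)).comp measurable_snd) m
  refine (Eq.trans ?_ this).trans ?_
  · rfl
  · refine lintegral_eq_zero_of_ae_eq_zero (Eventually.of_forall fun v => ?_)
    have h : (fun u => ({c} : Set ℝ).indicator (1 : ℝ → ℝ≥0∞) (partialSum v m + u))
        = ({c - partialSum v m} : Set ℝ).indicator 1 := by
      funext u
      simp only [Set.indicator_apply, Set.mem_singleton_iff, eq_sub_iff_add_eq', Pi.one_apply]
    simp only [h, Pi.zero_apply]
    rw [lintegral_indicator_one (measurableSet_singleton _), expMeasure_singleton]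

variable (p : PMF (Site d)) (mu : ℝ≥0)

lemma measurable_ringTime (x : Site d) (i m : ℕ) :
    Measurable fun ω : Noise d => ringTime ω x i m := by
  unfold ringTime
  fun_prop

lemma measurePreserving_clock (x : Site d) (i : ℕ) :
    MeasurePreserving (fun ω : Noise d => fun l => ω.2.2 (x, i, l)) (noiseLaw p lam mu)
      (clockLaw lam) := by
  refine ⟨by fun_prop, Measure.ext_of_lintegral _ fun f hf => ?_⟩
  rw [lintegral_map hf (by fun_prop)]
  simpa using lintegral_mul_clock p lam mu (F := fun _ => 1) measurable_const hf x i
    fun _ _ => rfl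

lemma ringTime_setClock_of_ne {x y : Site d} {i j : ℕ} (h : ¬ (y = x ∧ j = i)) (ω : Noise d)
    (v : ℕ → ℝ) (m : ℕ) : ringTime (setClock x i ω v) y j m = ringTime ω y j m := by
  unfold ringTime setClock
  refine Finset.sum_congr rfl fun l _ => ?_
  refine Function.extend_apply' _ _ _ ?_
  rintro ⟨k, hk⟩
  simp only [Prod.mk.injEq] at hk
  exact h ⟨hk.1.symm, hk.2.1.symm⟩

lemma ringTime_setClock_self (x : Site d) (i : ℕ) (ω : Noise d) (v : ℕ → ℝ) (m : ℕ) :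
    ringTime (setClock x i ω v) x i m = partialSum v (m + 1) := by
  unfold ringTime setClock partialSum
  exact Finset.sum_congr rfl fun l _ => (clock_injective x i).extend_apply _ _ _

lemma ae_ringTime_ne {x y : Site d} (hxy : x ≠ y) (i m j l : ℕ) :
    ∀ᵐ ω ∂noiseLaw p lam mu, ringTime ω x i m ≠ ringTime ω y j l := by
  have hms : MeasurableSet {ω : Noise d | ringTime ω x i m = ringTime ω y j l} :=
    measurableSet_eq_fun (measurable_ringTime x i m) (measurable_ringTime y j l)
  have hmp := measurePreserving_setClock p lam mu x i
  rw [ae_iff]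
  simp only [ne_eq, not_not]
  rw [← hmp.measure_preimage hms.nullMeasurableSet,
    Measure.prod_apply (hmp.measurable hms)]
  refine lintegral_eq_zero_of_ae_eq_zero (Eventually.of_forall fun ω => ?_)
  refine Eq.trans (congrArg _ (Set.ext fun v => ?_))
    (clockLaw_partialSum_eq lam m (ringTime ω y j l))
  simp only [Set.mem_preimage, Set.mem_ofPred_eq, ringTime_setClock_self]
  rw [ringTime_setClock_of_ne (fun h => hxy h.1.symm)]

lemma ae_goodClocks : ∀ᵐ ω ∂noiseLaw p lam mu, GoodClocks ω := by
  have h1 : ∀ᵐ ω ∂noiseLaw p lam mu, ∀ x i, (∀ l, 0 < ω.2.2 (x, i, l)) ∧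
      ∀ t, ∃ m, t < ringTime ω x i m := by
    refine ae_all_iff.2 fun x => ae_all_iff.2 fun i => ?_
    exact (measurePreserving_clock lam p mu x i).quasiMeasurePreserving.ae
      ((ae_clock_pos lam).and (ae_clock_unbounded lam))
  have h2 : ∀ᵐ ω ∂noiseLaw p lam mu, ∀ x i m y j l, x ≠ y →
      ringTime ω x i m ≠ ringTime ω y j l := by
    refine ae_all_iff.2 fun x => ae_all_iff.2 fun i => ae_all_iff.2 fun m => ae_all_iff.2 fun y =>
      ae_all_iff.2 fun j => ae_all_iff.2 fun l => ?_
    by_cases hxy : x = y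
    · simp [hxy]
    · filter_upwards [ae_ringTime_ne lam p mu hxy i m j l] with ω hω _
      exact hω
  filter_upwards [h1, h2] with ω h1 h2
  exact ⟨fun a => (h1 a.1 a.2.1).1 a.2.2, h2, fun x i => (h1 x i).2⟩

end

section

variable {d : ℕ}

/-! ### The expected size of the dominating process -/

lemma cnt_natCast_lt (e : ℕ∞) : cnt {j : ℕ | (j : ℝ≥0∞) < (e : ℝ≥0∞)} = e := by
  induction e with
  | top => simp [cnt]
  | coe n =>
    have : {j : ℕ | (j : ℝ≥0∞) < ((n : ℕ∞) : ℝ≥0∞)} = (Finset.range n : Set ℕ) := by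
      ext j
      simp
    rw [this, cnt_finset]
    simp

lemma measurable_cnt {Ω α : Type*} [MeasurableSpace Ω] [Countable α] {s : Ω → Set α}
    (h : ∀ a, MeasurableSet {ω | a ∈ s ω}) : Measurable fun ω => cnt (s ω) := by
  simp_rw [cnt_eq_tsum]
  exact Measurable.tsum fun a => Measurable.indicator (f := fun _ => (1 : ℝ≥0∞))
    measurable_const (h a)

lemma measurableSet_dest (a : Site d × ℕ) (x : Site d) :
    MeasurableSet {ω : Noise d | dest ω.2.1 a = x} := by
  have h : Measurable fun ω : Noise d => ω.2.1 a := by fun_prop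
  exact h (show MeasurableSet {v : Instruction d | a.1 + disp v = x} from trivial)

lemma measurable_source (S : Set (Site d)) (x : Site d) :
    Measurable fun ω : Noise d => source S ω x := by
  unfold source
  split_ifs
  · fun_prop
  · fun_prop

lemma measurable_visitors (S : Set (Site d)) {L : Noise d → Site d → ℝ≥0∞}
    (hL : ∀ x, Measurable fun ω => L ω x) (x : Site d) :
    Measurable fun ω => visitors S ω (L ω) x := by
  unfold visitors arrivals
  refine Measurable.add ?_ (measurable_cnt fun a => ?_)
  · exact (measurable_from_top (f := fun n : ℕ => (n : ℝ≥0∞))).comp (measurable_source S x)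
  · exact (measurableSet_lt measurable_const (hL a.1)).inter (measurableSet_dest a x)

lemma measurable_domUsed (S : Set (Site d)) (δ : ℝ) (g w : ℕ) (x : Site d) :
    Measurable fun ω => domUsed S ω δ g w x := by
  induction g generalizing w x with
  | zero => exact measurable_const
  | succ g ih =>
    refine measurable_cnt fun a => ?_
    have : {ω : Noise d | a ∈ {a : ℕ × ℕ | ∃ v ≤ w, ringTime ω x a.1 a.2 ∈ win δ v ∧
        (a.1 : ℝ≥0∞) < visitors S ω (domUsed S ω δ g v) x}}
        = ⋃ v ∈ Set.Iic w, {ω | ringTime ω x a.1 a.2 ∈ win δ v} ∩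
          {ω | (a.1 : ℝ≥0∞) < visitors S ω (domUsed S ω δ g v) x} := by
      ext ω
      simp only [Set.mem_ofPred_eq, Set.mem_iUnion, Set.mem_inter_iff, Set.mem_Iic, exists_prop]
    rw [this]
    refine MeasurableSet.biUnion (Set.to_countable _) fun v _ => ?_
    exact (measurable_ringTime x a.1 a.2 measurableSet_Ioc).inter
      (measurableSet_lt measurable_const (measurable_visitors S (ih v) x))

/-- An instruction outside the bound at stage (`g`, `w`) is outside all earlier stages, by
monotonicity. None of them has consulted it, so changing it changes none of them. -/
lemma domUsed_setInstr {S : Set (Site d)} {ω : Noise d} {δ : ℝ} {g w : ℕ} {a : Site d × ℕ}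
    (h : ¬ (a.2 : ℝ≥0∞) < domUsed S ω δ g w a.1) (v : Instruction d) :
    ∀ g' ≤ g, ∀ w' ≤ w, domUsed S (setInstr a ω v) δ g' w' = domUsed S ω δ g' w' := by
  intro g'
  induction g' with
  | zero => intros; rfl
  | succ g' ih =>
    intro hg w' hw
    have key : ∀ u ≤ w', ∀ x, visitors S (setInstr a ω v) (domUsed S (setInstr a ω v) δ g' u) x
        = visitors S ω (domUsed S ω δ g' u) x := by
      intro u hu x
      rw [ih (by omega) u (hu.trans hw)]
      refine congrArg₂ (· + ·) rfl (congrArg cnt (Set.ext fun b => and_congr_right fun hb => ?_))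
      have hba : b ≠ a := by
        rintro rfl
        refine h (lt_of_lt_of_le hb ?_)
        exact (domUsed_mono S ω δ u (show g' ≤ g by omega) b.1).trans
          (domUsed_mono_window S ω δ g (hu.trans hw) b.1)
      simp [dest, setInstr, hba]
    funext x
    refine congrArg cnt (Set.ext fun b => ?_)
    refine exists_congr fun u => and_congr_right fun hu => ?_
    rw [key u hu x]
    rfl

lemma lt_domUsed_setInstr (S : Set (Site d)) (ω : Noise d) (δ : ℝ) (g w : ℕ) (a : Site d × ℕ)
    (v : Instruction d) : (a.2 : ℝ≥0∞) < domUsed S (setInstr a ω v) δ g w a.1 ↔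
      (a.2 : ℝ≥0∞) < domUsed S ω δ g w a.1 := by
  have key : ∀ (ω : Noise d) v, ¬ (a.2 : ℝ≥0∞) < domUsed S ω δ g w a.1 →
      ¬ (a.2 : ℝ≥0∞) < domUsed S (setInstr a ω v) δ g w a.1 := fun ω v h => by
    rwa [domUsed_setInstr h v g le_rfl w le_rfl]
  -- The converse restores the old instruction and applies the same implication to the modified
  -- noise.
  refine ⟨fun h => not_not.1 fun h' => key _ _ h' h, fun h => not_not.1 fun h' => ?_⟩
  have := key _ (ω.2.1 a) h'
  simp [setInstr] at this
  exact absurd h (not_lt.2 this)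

/-- The analogue for clocks: a clock that is not effective by stage (`g`, `w`) has not contributed
to any earlier stage. -/
lemma domUsed_setClock {S : Set (Site d)} {ω : Noise d} {δ : ℝ} {g w : ℕ} {x : Site d} {i : ℕ}
    (h : ¬ (i : ℝ≥0∞) < visitors S ω (domUsed S ω δ g w) x) (v : ℕ → ℝ) :
    ∀ g' ≤ g, ∀ w' ≤ w, domUsed S (setClock x i ω v) δ g' w' = domUsed S ω δ g' w' := by
  intro g'
  induction g' with
  | zero => intros; rfl
  | succ g' ih =>
    intro hg w' hw
    funext y
    refine congrArg cnt (Set.ext fun b => ?_)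
    refine exists_congr fun u => and_congr_right fun hu => ?_
    have hv : visitors S (setClock x i ω v) (domUsed S (setClock x i ω v) δ g' u) y
        = visitors S ω (domUsed S ω δ g' u) y := by
      rw [ih (by omega) u (hu.trans hw)]
      rfl
    rw [hv]
    by_cases hyx : y = x ∧ b.1 = i
    · obtain ⟨rfl, hb⟩ := hyx
      have hn : ¬ (b.1 : ℝ≥0∞) < visitors S ω (domUsed S ω δ g' u) y := by
        rw [hb]
        refine fun h' => h (h'.trans_le (visitors_mono subset_rfl ?_ y))
        exact (domUsed_mono S ω δ u (show g' ≤ g by omega)).trans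
          (domUsed_mono_window S ω δ g (hu.trans hw))
      simp [hn]
    · rw [ringTime_setClock_of_ne hyx]

lemma lt_visitors_setClock (S : Set (Site d)) (ω : Noise d) (δ : ℝ) (g w : ℕ) (x : Site d)
    (i : ℕ) (v : ℕ → ℝ) :
    (i : ℝ≥0∞) < visitors S (setClock x i ω v) (domUsed S (setClock x i ω v) δ g w) x ↔
      (i : ℝ≥0∞) < visitors S ω (domUsed S ω δ g w) x := by
  have key : ∀ (ω : Noise d) v, ¬ (i : ℝ≥0∞) < visitors S ω (domUsed S ω δ g w) x →
      ¬ (i : ℝ≥0∞) < visitors S (setClock x i ω v) (domUsed S (setClock x i ω v) δ g w) x :=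
    fun ω v h => by
      rw [domUsed_setClock h v g le_rfl w le_rfl]
      exact h
  refine ⟨fun h => not_not.1 fun h' => key _ _ h' h, fun h => not_not.1 fun h' => ?_⟩
  have h1 := key _ (fun l => ω.2.2 (x, i, l)) h'
  have h2 : setClock x i (setClock x i ω v) (fun l => ω.2.2 (x, i, l)) = ω := by
    unfold setClock
    refine Prod.ext rfl (Prod.ext rfl (funext fun b => ?_))
    change Function.extend (fun l : ℕ => (x, i, l)) (fun l => ω.2.2 (x, i, l))
      (Function.extend (fun l : ℕ => (x, i, l)) v ω.2.2) b = ω.2.2 b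
    by_cases hb : ∃ l, (x, i, l) = b
    · obtain ⟨l, rfl⟩ := hb
      exact (clock_injective x i).extend_apply _ _ _
    · exact (Function.extend_apply' _ _ _ hb).trans (Function.extend_apply' _ _ _ hb)
  rw [h2] at h1
  exact h1 h

/-- The Stein–Chen identity, from (n + 1) P(n + 1) = r P(n). It yields both the mean and the second
moment. -/
lemma lintegral_natCast_mul_poisson (r : ℝ≥0) (f : ℕ → ℝ≥0∞) :
    ∫⁻ n, n * f n ∂poissonMeasure r = r * ∫⁻ n, f (n + 1) ∂poissonMeasure r := by
  rw [lintegral_countable', lintegral_countable', tsum_eq_zero_add' ENNReal.summable,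
    ← ENNReal.tsum_mul_left]
  simp only [Nat.cast_zero, zero_mul, zero_add]
  refine tsum_congr fun n => ?_
  have h : ((n + 1 : ℕ) : ℝ≥0∞) * poissonMeasure r {n + 1} = r * poissonMeasure r {n} := by
    rw [poissonMeasure_singleton, poissonMeasure_singleton, ← ENNReal.ofReal_natCast,
      ← ENNReal.ofReal_coe_nnreal, ← ENNReal.ofReal_mul (by positivity),
      ← ENNReal.ofReal_mul (by positivity)]
    congr 1
    rw [Nat.factorial_succ]
    push_cast
    field_simp
    ring
  rw [mul_right_comm, h]
  ring

lemma lintegral_natCast_poisson (r : ℝ≥0) : ∫⁻ n, (n : ℝ≥0∞) ∂poissonMeasure r = r := by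
  simpa using lintegral_natCast_mul_poisson r fun _ => 1

/-! ### Expectation recursion for the dominating process -/

variable (p : PMF (Site d)) (lam : ℝ≥0∞) (mu : ℝ≥0)

lemma measurePreserving_initial (x : Site d) :
    MeasurePreserving (fun ω : Noise d => ω.1 x) (noiseLaw p lam mu) (poissonMeasure mu) :=
  (measurePreserving_eval_infinitePi (fun _ : Site d => poissonMeasure mu) x).comp
    measurePreserving_fst

lemma lintegral_source (S : Set (Site d)) (x : Site d) :
    ∫⁻ ω, (source S ω x : ℝ≥0∞) ∂noiseLaw p lam mu = S.indicator (fun _ => (mu : ℝ≥0∞)) x := by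
  by_cases hx : x ∈ S
  · simp only [source, hx, if_true, Set.indicator_of_mem]
    rw [← lintegral_natCast_poisson mu,
      ← (measurePreserving_initial p lam mu x).lintegral_comp measurable_from_top]
  · simp [source, hx]

/-- The probability that an instruction at `y` leads to `x`. -/
def hop (y x : Site d) : ℝ≥0∞ := instructionLaw p lam {v | y + disp v = x}

lemma hop_eq_lintegral (y x : Site d) :
    hop p lam y x = ∫⁻ v, (if y + disp v = x then 1 else 0) ∂instructionLaw p lam := by
  rw [hop, ← lintegral_indicator_one (show MeasurableSet {v : Instruction d | y + disp v = x}
    from trivial)]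
  simp only [Set.indicator_apply, Set.mem_ofPred_eq, Pi.one_apply]

/-- Counting measure is invariant under the walk, by translation. This is what carries bounds
uniform in the site from one step to the next. -/
lemma tsum_hop_left (x : Site d) : ∑' y, hop p lam y x = 1 := by
  simp_rw [hop_eq_lintegral]
  rw [← lintegral_tsum fun _ => measurable_from_top.aemeasurable]
  simp_rw [← eq_sub_iff_add_eq]
  simp

lemma tsum_hop_right (y : Site d) : ∑' x, hop p lam y x = 1 := by
  simp_rw [hop_eq_lintegral]
  rw [← lintegral_tsum fun _ => measurable_from_top.aemeasurable]
  simp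

/-- Whether an instruction is within the bound does not depend on its own value
(`lt_domUsed_setInstr`), so the expected arrivals are expected use times hopping probability. -/
lemma lintegral_visitors (S : Set (Site d)) (δ : ℝ) (g w : ℕ) (x : Site d) :
    ∫⁻ ω, visitors S ω (domUsed S ω δ g w) x ∂noiseLaw p lam mu
      = S.indicator (fun _ => (mu : ℝ≥0∞)) x
        + ∑' y, (∫⁻ ω, domUsed S ω δ g w y ∂noiseLaw p lam mu) * hop p lam y x := by
  classical
  have hmd := measurable_domUsed S δ g w
  have hm1 : Measurable fun ω : Noise d => (source S ω x : ℝ≥0∞) :=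
    (measurable_from_top (f := fun n : ℕ => (n : ℝ≥0∞))).comp (measurable_source S x)
  have hlt : ∀ a : Site d × ℕ, Measurable fun ω : Noise d =>
      {ω : Noise d | (a.2 : ℝ≥0∞) < domUsed S ω δ g w a.1}.indicator (1 : Noise d → ℝ≥0∞) ω :=
    fun a => measurable_one.indicator (measurableSet_lt measurable_const (hmd a.1))
  have hdest : ∀ a : Site d × ℕ, Measurable fun ω : Noise d =>
      (if dest ω.2.1 a = x then 1 else 0 : ℝ≥0∞) := fun a =>
    Measurable.ite (measurableSet_dest a x) measurable_const measurable_const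
  simp only [visitors, arrivals, cnt_eq_tsum]
  rw [lintegral_add_left hm1, lintegral_source]
  congr 1
  have h1 : ∀ (ω : Noise d) (a : Site d × ℕ),
      Set.indicator {b | b ∈ below (domUsed S ω δ g w) ∧ dest ω.2.1 b = x} (1 : Site d × ℕ → ℝ≥0∞) a
      = {ω : Noise d | (a.2 : ℝ≥0∞) < domUsed S ω δ g w a.1}.indicator 1 ω
        * (if dest ω.2.1 a = x then 1 else 0) := by
    intro ω a
    simp only [Set.indicator_apply, Set.mem_ofPred_eq, below, Pi.one_apply]
    by_cases h : (a.2 : ℝ≥0∞) < domUsed S ω δ g w a.1 <;> by_cases h' : dest ω.2.1 a = x <;>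
      simp [h, h']
  simp_rw [h1]
  rw [lintegral_tsum, ENNReal.tsum_prod']
  swap
  · exact fun a => ((hlt a).mul (hdest a)).aemeasurable
  refine tsum_congr fun y => ?_
  have h2 : ∀ m : ℕ, ∫⁻ ω, {ω : Noise d | (m : ℝ≥0∞) < domUsed S ω δ g w y}.indicator 1 ω
      * (if dest ω.2.1 (y, m) = x then 1 else 0) ∂noiseLaw p lam mu
      = (∫⁻ ω, {ω : Noise d | (m : ℝ≥0∞) < domUsed S ω δ g w y}.indicator 1 ω
        ∂noiseLaw p lam mu) * hop p lam y x := by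
    intro m
    rw [hop_eq_lintegral]
    refine lintegral_mul_instr p lam mu (hlt (y, m))
      (H := fun v => if y + disp v = x then 1 else 0) (y, m) fun ω v => ?_
    simp only [Set.indicator_apply, Set.mem_ofPred_eq]
    simp only [lt_domUsed_setInstr S ω δ g w (y, m) v, Pi.one_apply]
  simp_rw [h2]
  rw [ENNReal.tsum_mul_right, ← lintegral_tsum fun m => (hlt (y, m)).aemeasurable]
  congr 1
  refine lintegral_congr fun ω => ?_
  obtain ⟨e, he⟩ : ∃ e : ℕ∞, domUsed S ω δ g w y = e := by
    cases g with
    | zero => exact ⟨0, by simp [domUsed]⟩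
    | succ g => exact ⟨_, rfl⟩
  conv_rhs => rw [he, ← cnt_natCast_lt e, cnt_eq_tsum]
  refine tsum_congr fun m => ?_
  simp only [Set.indicator_apply, Set.mem_ofPred_eq, he, Pi.one_apply]

/-- Whether clock `i` is effective in window `v` does not depend on that clock, and it rings at most
1/2 times in the window on average. Summing over `i` turns indicators into the expected number of
visitors. -/
lemma lintegral_domUsed_succ_le (S : Set (Site d)) (g w : ℕ) (x : Site d) :
    ∫⁻ ω, domUsed S ω (winLength lam) (g + 1) w x ∂noiseLaw p lam mu
      ≤ 2⁻¹ * ∑ v ∈ Finset.range (w + 1),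
        ∫⁻ ω, visitors S ω (domUsed S ω (winLength lam) g v) x ∂noiseLaw p lam mu := by
  classical
  set δ := winLength lam
  have hmv : ∀ v, Measurable fun ω => visitors S ω (domUsed S ω δ g v) x := fun v =>
    measurable_visitors S (fun y => measurable_domUsed S δ g v y) x
  have hlt : ∀ v i : ℕ, Measurable fun ω : Noise d =>
      {ω : Noise d | (i : ℝ≥0∞) < visitors S ω (domUsed S ω δ g v) x}.indicator
        (1 : Noise d → ℝ≥0∞) ω :=
    fun v i => measurable_one.indicator (measurableSet_lt measurable_const (hmv v))
  have hwm : ∀ v m : ℕ, MeasurableSet {u : ℕ → ℝ | partialSum u (m + 1) ∈ win δ v} :=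
    fun v m => measurable_partialSum (m + 1) measurableSet_Ioc
  have hw' : ∀ v m : ℕ, Measurable fun u : ℕ → ℝ =>
      {u : ℕ → ℝ | partialSum u (m + 1) ∈ win δ v}.indicator (1 : (ℕ → ℝ) → ℝ≥0∞) u :=
    fun v m => measurable_one.indicator (hwm v m)
  have hclk : ∀ i : ℕ, Measurable fun ω : Noise d => fun l => ω.2.2 (x, i, l) := by
    intro i; fun_prop
  have hpt : ∀ ω : Noise d, domUsed S ω δ (g + 1) w x ≤ ∑ v ∈ Finset.range (w + 1), ∑' i : ℕ,
      ∑' m : ℕ, {ω : Noise d | (i : ℝ≥0∞) < visitors S ω (domUsed S ω δ g v) x}.indicator 1 ω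
        * {u : ℕ → ℝ | partialSum u (m + 1) ∈ win δ v}.indicator 1 (fun l => ω.2.2 (x, i, l)) := by
    intro ω
    change cnt _ ≤ _
    rw [cnt_eq_tsum, ENNReal.tsum_prod']
    simp_rw [← Summable.tsum_finsetSum fun _ _ => ENNReal.summable]
    refine ENNReal.tsum_le_tsum fun i => ENNReal.tsum_le_tsum fun m => ?_
    rw [Set.indicator_apply]
    split_ifs with h
    · obtain ⟨v, hv, h1, h2⟩ := h
      refine le_trans (le_of_eq ?_) (Finset.single_le_sum (fun _ _ => zero_le)
        (Finset.mem_range.2 (Nat.lt_succ_of_le hv)))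
      simp only [Set.indicator_apply, Set.mem_ofPred_eq, Pi.one_apply]
      rw [if_pos h2, if_pos (by simpa [ringTime_eq_partialSum] using h1), one_mul]
    · exact zero_le
  refine (lintegral_mono hpt).trans ?_
  rw [lintegral_finsetSum, Finset.mul_sum]
  swap
  · exact fun v _ => Measurable.tsum fun i => Measurable.tsum fun m =>
      (hlt v i).mul ((hw' v m).comp (hclk i))
  refine Finset.sum_le_sum fun v _ => ?_
  rw [lintegral_tsum]
  swap
  · exact fun i => (Measurable.tsum fun m =>
      (hlt v i).mul ((hw' v m).comp (hclk i))).aemeasurable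
  have h1 : ∀ i : ℕ, ∫⁻ ω, ∑' m : ℕ,
      {ω : Noise d | (i : ℝ≥0∞) < visitors S ω (domUsed S ω δ g v) x}.indicator 1 ω
        * {u : ℕ → ℝ | partialSum u (m + 1) ∈ win δ v}.indicator 1 (fun l => ω.2.2 (x, i, l))
        ∂noiseLaw p lam mu
      ≤ (∫⁻ ω, {ω : Noise d | (i : ℝ≥0∞) < visitors S ω (domUsed S ω δ g v) x}.indicator 1 ω
        ∂noiseLaw p lam mu) * 2⁻¹ := by
    intro i
    rw [lintegral_tsum]
    swap
    · exact fun m => ((hlt v i).mul ((hw' v m).comp (hclk i))).aemeasurable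
    have h2 : ∀ m : ℕ, ∫⁻ ω,
        {ω : Noise d | (i : ℝ≥0∞) < visitors S ω (domUsed S ω δ g v) x}.indicator 1 ω
        * {u : ℕ → ℝ | partialSum u (m + 1) ∈ win δ v}.indicator 1 (fun l => ω.2.2 (x, i, l))
        ∂noiseLaw p lam mu
        = (∫⁻ ω, {ω : Noise d | (i : ℝ≥0∞) < visitors S ω (domUsed S ω δ g v) x}.indicator 1 ω
          ∂noiseLaw p lam mu) * clockLaw lam {u | partialSum u (m + 1) ∈ win δ v} := by
      intro m
      rw [← lintegral_indicator_one (hwm v m)]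
      refine lintegral_mul_clock p lam mu (hlt v i) (hw' v m) x i fun ω u => ?_
      simp only [Set.indicator_apply, Set.mem_ofPred_eq]
      simp only [lt_visitors_setClock S ω δ g v x i u, Pi.one_apply]
    simp_rw [h2]
    rw [ENNReal.tsum_mul_left]
    gcongr
    exact tsum_ring_mem_win_le lam v
  refine (ENNReal.tsum_le_tsum h1).trans ?_
  rw [ENNReal.tsum_mul_right, mul_comm, ← lintegral_tsum fun i => (hlt v i).aemeasurable]
  gcongr with ω
  refine le_of_eq ?_
  obtain ⟨e, he⟩ : ∃ e : ℕ∞, visitors S ω (domUsed S ω δ g v) x = e :=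
    ⟨source S ω x + Set.encard _, by rw [visitors, arrivals, cnt]; push_cast; rfl⟩
  conv_rhs => rw [he, ← cnt_natCast_lt e, cnt_eq_tsum]
  refine tsum_congr fun m => ?_
  simp only [Set.indicator_apply, Set.mem_ofPred_eq, he, Pi.one_apply]

/-- This makes `4 * m * 3 ^ w` stable under the recursion: the left side equals `3 * m * 3 ^ w`, by
the geometric sum. -/
lemma add_half_sum_le (m : ℝ≥0∞) (w : ℕ) :
    m + 2⁻¹ * ∑ v ∈ Finset.range (w + 1), 4 * m * 3 ^ v ≤ 4 * m * 3 ^ w := by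
  have h : ∀ n : ℕ, 1 + 2 * ∑ v ∈ Finset.range n, (3 : ℝ≥0∞) ^ v = 3 ^ n := by
    intro n
    induction n with
    | zero => simp
    | succ n ih =>
      rw [Finset.sum_range_succ, mul_add, ← add_assoc, ih, pow_succ]
      ring
  have h2 : (2⁻¹ : ℝ≥0∞) * 4 = 2 := by
    rw [show (4 : ℝ≥0∞) = 2 * 2 by norm_num, ← mul_assoc, ENNReal.inv_mul_cancel] <;> simp
  calc m + 2⁻¹ * ∑ v ∈ Finset.range (w + 1), 4 * m * 3 ^ v
      = m * (1 + 2 * ∑ v ∈ Finset.range (w + 1), 3 ^ v) := by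
        rw [← Finset.mul_sum, mul_add, mul_one, ← mul_assoc, ← mul_assoc, h2]
        ring
    _ = 3 * m * 3 ^ w := by rw [h, pow_succ]; ring
    _ ≤ 4 * m * 3 ^ w := by gcongr; norm_num

lemma lintegral_visitors_le (S : Set (Site d)) (g w : ℕ) (x : Site d) :
    ∫⁻ ω, visitors S ω (domUsed S ω (winLength lam) g w) x ∂noiseLaw p lam mu
      ≤ 4 * mu * 3 ^ w := by
  induction g generalizing w x with
  | zero =>
    rw [lintegral_visitors]
    simp only [domUsed, lintegral_zero, zero_mul, tsum_zero, add_zero]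
    refine (Set.indicator_le_self' (fun _ _ => zero_le) x).trans ?_
    calc (mu : ℝ≥0∞) = 1 * mu * 1 := by ring
      _ ≤ _ := by
        gcongr
        · norm_num
        · exact one_le_pow₀ (by norm_num)
  | succ g ih =>
    rw [lintegral_visitors]
    refine le_trans (add_le_add (Set.indicator_le_self' (fun _ _ => zero_le) x) ?_)
      (add_half_sum_le mu w)
    calc _ ≤ ∑' y, (2⁻¹ * ∑ v ∈ Finset.range (w + 1), 4 * (mu : ℝ≥0∞) * 3 ^ v) * hop p lam y x := by
          gcongr with y
          refine (lintegral_domUsed_succ_le p lam mu S g w y).trans ?_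
          gcongr with v
          exact ih v y
      _ = _ := by rw [ENNReal.tsum_mul_left, tsum_hop_left, mul_one]

/-- The same recursion summed over all sites. For a finite box the total source is finite, which
excludes explosion; the sitewise bound serves the limit of large boxes. -/
lemma tsum_lintegral_visitors_le (S : Set (Site d)) (g w : ℕ) :
    ∑' x, ∫⁻ ω, visitors S ω (domUsed S ω (winLength lam) g w) x ∂noiseLaw p lam mu
      ≤ 4 * (∑' x, S.indicator (fun _ => (mu : ℝ≥0∞)) x) * 3 ^ w := by
  set m := ∑' x, S.indicator (fun _ => (mu : ℝ≥0∞)) x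
  induction g generalizing w with
  | zero =>
    simp_rw [lintegral_visitors]
    simp only [domUsed, lintegral_zero, zero_mul, tsum_zero, add_zero]
    calc m = 1 * m * 1 := by ring
      _ ≤ _ := by
        gcongr
        · norm_num
        · exact one_le_pow₀ (by norm_num)
  | succ g ih =>
    simp_rw [lintegral_visitors]
    rw [ENNReal.tsum_add]
    refine le_trans (add_le_add le_rfl ?_) (add_half_sum_le m w)
    rw [ENNReal.tsum_comm]
    simp_rw [ENNReal.tsum_mul_left, tsum_hop_right, mul_one]
    refine (ENNReal.tsum_le_tsum fun y => lintegral_domUsed_succ_le p lam mu S g w y).trans ?_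
    rw [ENNReal.tsum_mul_left, Summable.tsum_finsetSum fun _ _ => ENNReal.summable]
    gcongr with v
    exact ih v

lemma ae_exists_natCast_bound {Ω : Type*} [MeasurableSpace Ω] {μ : Measure Ω}
    {f : ℕ → Ω → ℝ≥0∞} (hf : ∀ g, Measurable (f g)) (hmono : Monotone f) {C : ℝ≥0∞} (hC : C ≠ ⊤)
    (h : ∀ g, ∫⁻ ω, f g ω ∂μ ≤ C) : ∀ᵐ ω ∂μ, ∃ N : ℕ, ∀ g, f g ω ≤ N := by
  have h1 : ∫⁻ ω, ⨆ g, f g ω ∂μ ≠ ⊤ := by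
    rw [lintegral_iSup hf hmono]
    exact ((iSup_le h).trans_lt hC.lt_top).ne
  filter_upwards [ae_lt_top (Measurable.iSup hf) h1] with ω hω
  obtain ⟨N, hN⟩ := ENNReal.exists_nat_gt hω.ne
  exact ⟨N, fun g => (le_iSup (fun g => f g ω) g).trans hN.le⟩

theorem ae_good : ∀ᵐ ω ∂noiseLaw p lam mu, Good lam ω := by
  have h1 : ∀ᵐ ω ∂noiseLaw p lam mu, ∀ M w, ∃ C : ℕ, ∀ g,
      ∑' x, domUsed (box d M) ω (winLength lam) g w x ≤ C := by
    refine ae_all_iff.2 fun M => ae_all_iff.2 fun w => ?_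
    set m := ∑' x, (box d M).indicator (fun _ => (mu : ℝ≥0∞)) x
    have hm : m ≠ ⊤ := by
      have : m = ∑ x ∈ (box_finite d M).toFinset, (mu : ℝ≥0∞) := by
        simp only [m]
        rw [tsum_eq_sum (s := (box_finite d M).toFinset)]
        · exact Finset.sum_congr rfl fun x hx => by simp_all
        · exact fun x hx => by simp_all
      rw [this]
      simp [ENNReal.mul_ne_top]
    refine ae_exists_natCast_bound (C := 2⁻¹ * ∑ v ∈ Finset.range (w + 1), 4 * m * 3 ^ v)
      (fun g => Measurable.tsum fun x => measurable_domUsed _ _ g w x)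
      (fun g g' hg ω => ENNReal.tsum_le_tsum fun x => domUsed_mono _ _ _ w hg x)
      ?_ fun g => ?_
    · have : ∀ v : ℕ, 4 * m * 3 ^ v ≠ ⊤ := fun v => by finiteness
      exact ENNReal.mul_ne_top (by simp) (ENNReal.sum_ne_top.2 fun v _ => this v)
    · rw [lintegral_tsum fun x => (measurable_domUsed _ _ g w x).aemeasurable]
      cases g with
      | zero => simp [domUsed]
      | succ g =>
        refine (ENNReal.tsum_le_tsum fun x => lintegral_domUsed_succ_le p lam mu _ g w x).trans ?_
        rw [ENNReal.tsum_mul_left, Summable.tsum_finsetSum fun _ _ => ENNReal.summable]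
        gcongr with v
        exact tsum_lintegral_visitors_le p lam mu _ g v
  have h2 : ∀ᵐ ω ∂noiseLaw p lam mu, ∀ w x, ∃ C : ℕ, ∀ g,
      visitors Set.univ ω (domUsed Set.univ ω (winLength lam) g w) x ≤ C := by
    refine ae_all_iff.2 fun w => ae_all_iff.2 fun x => ?_
    exact ae_exists_natCast_bound (C := 4 * mu * 3 ^ w)
      (fun g => measurable_visitors _ (fun y => measurable_domUsed _ _ g w y) x)
      (fun g g' hg ω => visitors_mono subset_rfl (domUsed_mono _ _ _ w hg) x)
      (by finiteness) fun g => lintegral_visitors_le p lam mu _ g w x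
  filter_upwards [ae_goodClocks lam p mu, h1, h2] with ω hg h1 h2
  exact hg.good (winLength_pos lam) h1 h2

end

section

variable {d : ℕ}

/-! ### The random walk -/

lemma sleepProb_lt_one (lam : ℝ≥0∞) : sleepProb lam < 1 := by
  unfold sleepProb
  split_ifs with h
  · exact zero_lt_one
  · refine ENNReal.div_lt_of_lt_mul ?_
    rw [one_mul]
    exact ENNReal.lt_add_right h one_ne_zero |>.trans_eq (add_comm _ _)

lemma exists_mem_support_ne_zero (hd : 1 ≤ d) {p : PMF (Site d)}
    (hp : AddSubgroup.closure p.support = ⊤) : ∃ z ∈ p.support, z ≠ 0 := by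
  by_contra! h
  have h1 : AddSubgroup.closure p.support ≤ ⊥ := by
    rw [AddSubgroup.closure_le]
    intro z hz
    simp [h z hz]
  have h2 : (fun _ => 1 : Site d) ∈ (⊥ : AddSubgroup (Site d)) := h1 (hp ▸ trivial)
  have h3 := congrFun (AddSubgroup.mem_bot.1 h2) ⟨0, hd⟩
  simp at h3

lemma instructionLaw_jump_pos {p : PMF (Site d)} (lam : ℝ≥0∞) {z : Site d} (hz : z ∈ p.support) :
    0 < instructionLaw p lam {v | disp v = z} := by
  have h1 : (p.map Instruction.jump).toMeasure {Instruction.jump z}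
      ≤ (p.map Instruction.jump).toMeasure {v : Instruction d | disp v = z} :=
    measure_mono fun v hv => by
      obtain rfl := Set.mem_singleton_iff.1 hv
      rfl
  rw [PMF.toMeasure_apply_singleton _ _
    (show MeasurableSet {Instruction.jump z} from trivial)] at h1
  have h2 : 0 < (p.map Instruction.jump) (Instruction.jump z) := by
    rw [pos_iff_ne_zero, ← PMF.mem_support_iff, PMF.mem_support_map_iff]
    exact ⟨z, hz, rfl⟩
  have h3 : 0 < (1 - sleepProb lam) * (p.map Instruction.jump).toMeasure {v | disp v = z} :=
    ENNReal.mul_pos (tsub_pos_of_lt (sleepProb_lt_one lam)).ne' (h2.trans_le h1).ne'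
  rw [instructionLaw, Measure.add_apply, Measure.smul_apply, Measure.smul_apply]
  exact h3.trans_le le_add_self

section walk

variable (p : PMF (Site d)) (lam : ℝ≥0∞)

open Classical in
/-- The probability that a random walk that starts at `x` and moves according to the instructions
is at the origin after `k` steps. -/
def walk : ℕ → Site d → ℝ≥0∞
  | 0 => fun x => if x = 0 then 1 else 0
  | k + 1 => fun x => ∫⁻ v, walk k (x + disp v) ∂instructionLaw p lam

/-- The expected number of visits to the origin in the first `m` steps. -/
def green (m : ℕ) (x : Site d) : ℝ≥0∞ := ∑ k ∈ Finset.range m, walk p lam k x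

lemma tsum_lintegral_shift (f : Site d → ℝ≥0∞) :
    ∑' x, ∫⁻ v, f (x + disp v) ∂instructionLaw p lam = ∑' x, f x := by
  rw [← lintegral_tsum fun _ => measurable_from_top.aemeasurable]
  have : ∀ v : Instruction d, ∑' x, f (x + disp v) = ∑' x, f x := fun v =>
    (Equiv.addRight (disp v)).tsum_eq f
  simp [this]

lemma tsum_walk (k : ℕ) : ∑' x, walk p lam k x = 1 := by
  induction k with
  | zero => simp [walk]
  | succ k ih => rw [← ih]; exact tsum_lintegral_shift p lam _

lemma tsum_green (m : ℕ) : ∑' x, green p lam m x = m := by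
  unfold green
  rw [Summable.tsum_finsetSum fun _ _ => ENNReal.summable]
  simp [tsum_walk]

lemma green_le (m : ℕ) (x : Site d) : green p lam m x ≤ m :=
  (ENNReal.le_tsum x).trans_eq (tsum_green p lam m)

lemma green_ne_top (m : ℕ) (x : Site d) : green p lam m x ≠ ⊤ :=
  ((green_le p lam m x).trans_lt (by simp)).ne

lemma green_mono (x : Site d) : Monotone fun m => green p lam m x :=
  fun _ _ h => Finset.sum_le_sum_of_subset (Finset.range_mono h)

lemma green_succ (m : ℕ) (x : Site d) : green p lam (m + 1) x
    = walk p lam 0 x + ∫⁻ v, green p lam m (x + disp v) ∂instructionLaw p lam := by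
  unfold green
  rw [Finset.sum_range_succ', lintegral_finsetSum _ fun _ _ => measurable_from_top, add_comm]
  rfl

/-- `green` with real values. -/
def greenR (m : ℕ) (x : Site d) : ℝ := (green p lam m x).toReal

/-- The expectation of `greenR` after one step. -/
def greenStep (m : ℕ) (x : Site d) : ℝ := ∫ v, greenR p lam m (x + disp v) ∂instructionLaw p lam

lemma greenR_nonneg (m : ℕ) (x : Site d) : 0 ≤ greenR p lam m x := ENNReal.toReal_nonneg

lemma greenR_le (m : ℕ) (x : Site d) : greenR p lam m x ≤ m := by
  simpa [greenR] using ENNReal.toReal_mono (by simp) (green_le p lam m x)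

lemma greenR_mono {m n : ℕ} (h : m ≤ n) (x : Site d) : greenR p lam m x ≤ greenR p lam n x :=
  ENNReal.toReal_mono (green_ne_top p lam n x) (green_mono p lam x h)

lemma integrable_greenR (m : ℕ) (x : Site d) :
    Integrable (fun v => greenR p lam m (x + disp v)) (instructionLaw p lam) := by
  have hm : Measurable fun v : Instruction d => greenR p lam m (x + disp v) := measurable_from_top
  refine Integrable.of_bound hm.aestronglyMeasurable (m : ℝ) (Eventually.of_forall fun v => ?_)
  rw [Real.norm_of_nonneg (greenR_nonneg _ _ _ _)]
  exact greenR_le _ _ _ _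

lemma greenStep_eq (m : ℕ) (x : Site d) :
    greenStep p lam m x = (∫⁻ v, green p lam m (x + disp v) ∂instructionLaw p lam).toReal := by
  rw [greenStep]
  exact integral_toReal measurable_from_top.aemeasurable
    (Eventually.of_forall fun v => (green_ne_top _ _ _ _).lt_top)

lemma lintegral_green_ne_top (m : ℕ) (x : Site d) :
    ∫⁻ v, green p lam m (x + disp v) ∂instructionLaw p lam ≠ ⊤ := by
  have := green_succ p lam m x
  exact fun h => green_ne_top p lam (m + 1) x (by rw [this, h, add_top])

open Classical in
lemma greenR_succ (m : ℕ) (x : Site d) :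
    greenR p lam (m + 1) x = (if x = 0 then 1 else 0) + greenStep p lam m x := by
  have h : walk p lam 0 x = if x = 0 then 1 else 0 := rfl
  rw [greenR, green_succ, greenStep_eq, ENNReal.toReal_add _ (lintegral_green_ne_top p lam m x), h]
  · split_ifs <;> simp
  · rw [h]; split_ifs <;> simp

lemma sum_greenR_le (m : ℕ) (F : Finset (Site d)) : ∑ x ∈ F, greenR p lam m x ≤ m := by
  unfold greenR
  rw [← ENNReal.toReal_sum fun x _ => green_ne_top p lam m x]
  have h := (ENNReal.sum_le_tsum F).trans_eq (tsum_green p lam m)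
  simpa using ENNReal.toReal_mono (by simp) h

/-- The increments are the probabilities of being at the origin at time `m`, of total mass 1 over
starting points. This bounds the cost per round of keeping one particle at every site. -/
lemma sum_greenR_sub_le (m : ℕ) (F : Finset (Site d)) :
    ∑ x ∈ F, (greenR p lam (m + 1) x - greenR p lam m x) ≤ 1 := by
  have hw : ∀ x, walk p lam m x ≠ ⊤ := fun x =>
    ((ENNReal.le_tsum x).trans_eq (tsum_walk p lam m)).trans_lt ENNReal.one_lt_top |>.ne
  have h1 : ∀ x, greenR p lam (m + 1) x - greenR p lam m x = (walk p lam m x).toReal := by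
    intro x
    have : green p lam (m + 1) x = green p lam m x + walk p lam m x := Finset.sum_range_succ _ _
    rw [greenR, greenR, this, ENNReal.toReal_add (green_ne_top p lam m x) (hw x)]
    ring
  simp_rw [h1]
  rw [← ENNReal.toReal_sum fun x _ => hw x]
  have h := (ENNReal.sum_le_tsum F).trans_eq (tsum_walk p lam m)
  simpa using ENNReal.toReal_mono (by simp) h

/-- The Green function grows sublinearly, uniformly in the starting point. -/
lemma exists_greenR_le (hd : 1 ≤ d) (hp : AddSubgroup.closure p.support = ⊤) (N : ℕ)
    (hN : N ≠ 0) : ∃ C : ℝ, ∀ m x, greenR p lam m x ≤ (m + C) / N := by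
  obtain ⟨z, hz, hz0⟩ := exists_mem_support_ne_zero hd hp
  set A : Set (Instruction d) := {v | disp v = z}
  have hA : MeasurableSet A := trivial
  set a : ℝ := (instructionLaw p lam).real A
  have ha : 0 < a := ENNReal.toReal_pos (instructionLaw_jump_pos lam hz).ne' (measure_ne_top _ _)
  -- `c n` bounds the distance from the maximum `s` after `n` steps in direction `z`. It does not
  -- depend on `m`, which is essential.
  let c : ℕ → ℝ := fun n => Nat.rec 1 (fun _ c => (1 + c) / a) n
  have hc : ∀ n, c (n + 1) = (1 + c n) / a := fun n => rfl
  refine ⟨∑ n ∈ Finset.range N, c n, fun m x => ?_⟩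
  set s := ⨆ x, greenR p lam m x
  have hbdd : BddAbove (Set.range fun x => greenR p lam m x) :=
    ⟨m, by rintro _ ⟨x, rfl⟩; exact greenR_le p lam m x⟩
  have hs : ∀ x, greenR p lam m x ≤ s := fun x => le_ciSup hbdd x
  refine (hs x).trans ?_
  -- Near-maximality propagates: the Green function at `y` is at most 1 plus its mean after a step,
  -- and with probability `a` the step is `z`. Hence `y + z` cannot be far below the maximum if `y`
  -- is not.
  have hstep : ∀ y, s - greenR p lam m (y + z) ≤ (1 + (s - greenR p lam m y)) / a := by
    intro y
    have h1 : greenR p lam m y ≤ 1 + greenStep p lam m y := by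
      classical
      refine (greenR_mono p lam (Nat.le_succ m) y).trans ?_
      rw [Nat.succ_eq_add_one, greenR_succ]
      gcongr
      split_ifs <;> simp
    have h2 : greenStep p lam m y ≤ s - a * (s - greenR p lam m (y + z)) := by
      have h3 : ∫ v, (s - A.indicator (fun _ => s - greenR p lam m (y + z)) v)
          ∂instructionLaw p lam = s - a * (s - greenR p lam m (y + z)) := by
        rw [integral_sub (integrable_const _), integral_indicator_const _ hA]
        · simp [a]
        · exact (integrable_const _).indicator hA
      rw [← h3]
      refine integral_mono (integrable_greenR p lam m y) ?_ fun v => ?_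
      · exact (integrable_const _).sub ((integrable_const _).indicator hA)
      · by_cases hv : v ∈ A
        · rw [Set.indicator_of_mem hv, show disp v = z from hv]
          simp
        · rw [Set.indicator_of_notMem hv, sub_zero]
          exact hs _
    rw [le_div_iff₀ ha]
    linarith
  obtain ⟨y, hy⟩ := exists_lt_of_lt_ciSup (show s - 1 < ⨆ x, greenR p lam m x by linarith)
  have hn : ∀ n : ℕ, s - greenR p lam m (y + n • z) ≤ c n := by
    intro n
    induction n with
    | zero => simp only [zero_smul, add_zero]; change _ ≤ (1 : ℝ); linarith
    | succ n ih =>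
      rw [succ_nsmul, ← add_assoc, hc]
      refine (hstep _).trans ?_
      gcongr
  -- The `N` sites are distinct since `z ≠ 0`, so the total mass `m` of the Green function is shared
  -- by `N` nearly maximal values.
  have hinj : Function.Injective fun n : ℕ => y + n • z := by
    intro n n' h
    have h1 : n • z = n' • z := by simpa using h
    obtain ⟨i, hi⟩ := Function.ne_iff.1 hz0
    have h2 := congrFun h1 i
    simp only [Pi.smul_apply, nsmul_eq_mul] at h2
    simp only [Pi.zero_apply, ne_eq] at hi
    exact_mod_cast mul_right_cancel₀ hi h2
  have hsum := sum_greenR_le p lam m ((Finset.range N).image fun n : ℕ => y + n • z)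
  rw [Finset.sum_image fun n _ n' _ h => hinj h] at hsum
  have hsum' : (N : ℝ) * s - ∑ n ∈ Finset.range N, c n
      ≤ ∑ n ∈ Finset.range N, greenR p lam m (y + n • z) := by
    have : (N : ℝ) * s = ∑ n ∈ Finset.range N, s := by simp
    rw [this, ← Finset.sum_sub_distrib]
    refine Finset.sum_le_sum fun n _ => ?_
    linarith [hn n]
  rw [le_div_iff₀ (by positivity)]
  linarith

/-- The variance of the Green function after one step. -/
def greenVar (m : ℕ) (x : Site d) : ℝ :=
  ∫ v, (greenR p lam m (x + disp v) - greenStep p lam m x) ^ 2 ∂instructionLaw p lam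

lemma greenVar_add (m : ℕ) (x : Site d) : ENNReal.ofReal (greenVar p lam m x)
    + (∫⁻ v, green p lam m (x + disp v) ∂instructionLaw p lam) ^ 2
    = ∫⁻ v, green p lam m (x + disp v) ^ 2 ∂instructionLaw p lam := by
  have hm : Measurable fun v : Instruction d => greenR p lam m (x + disp v) := measurable_from_top
  have hL : MemLp (fun v => greenR p lam m (x + disp v)) 2 (instructionLaw p lam) := by
    refine MemLp.of_bound hm.aestronglyMeasurable (m : ℝ) (Eventually.of_forall fun v => ?_)
    rw [Real.norm_of_nonneg (greenR_nonneg _ _ _ _)]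
    exact greenR_le _ _ _ _
  have h1 : greenVar p lam m x + greenStep p lam m x ^ 2
      = ∫ v, greenR p lam m (x + disp v) ^ 2 ∂instructionLaw p lam := by
    have h2 := variance_eq_sub hL
    rw [variance_eq_integral hm.aemeasurable] at h2
    simp only [Pi.pow_apply] at h2
    rw [greenVar, greenStep, h2]
    ring
  have h3 : ∫⁻ v, green p lam m (x + disp v) ^ 2 ∂instructionLaw p lam
      = ENNReal.ofReal (∫ v, greenR p lam m (x + disp v) ^ 2 ∂instructionLaw p lam) := by
    rw [ofReal_integral_eq_lintegral_ofReal hL.integrable_sq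
      (Eventually.of_forall fun v => sq_nonneg _)]
    refine lintegral_congr fun v => ?_
    rw [greenR, ← ENNReal.toReal_pow, ENNReal.ofReal_toReal (by
      exact ENNReal.pow_ne_top (green_ne_top _ _ _ _))]
  have h0 : 0 ≤ greenVar p lam m x := integral_nonneg fun v => sq_nonneg _
  rw [h3, ← h1, ENNReal.ofReal_add h0 (sq_nonneg _),
    greenStep_eq, ← ENNReal.toReal_pow,
    ENNReal.ofReal_toReal (ENNReal.pow_ne_top (lintegral_green_ne_top _ _ _ _))]

/-- Energy identity: with P the mean of G_m after a step, translation invariance gives Σ Var + Σ P²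
= Σ G_m². Moreover G_{m+1} = P + 1_0, so Σ G_{m+1}² exceeds Σ P² by 1 + 2P(0) ≤ 2 G_{m+1}(0).
Summing over `m` telescopes. -/
lemma sum_greenVar_le (K : ℕ) :
    ∑ m ∈ Finset.range K, ∑' x, ENNReal.ofReal (greenVar p lam m x)
      ≤ 2 * ∑ m ∈ Finset.range K, green p lam (m + 1) 0 := by
  classical
  have hS : ∀ m, ∑' x, green p lam m x ^ 2 ≠ ⊤ := by
    intro m
    refine ((ENNReal.tsum_le_tsum (g := fun x => m * green p lam m x) fun x => ?_).trans_lt ?_).ne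
    · rw [sq]
      gcongr
      exact green_le p lam m x
    · rw [ENNReal.tsum_mul_left, tsum_green]
      finiteness
  have hstep : ∀ m, ∑' x, ENNReal.ofReal (greenVar p lam m x) + ∑' x, green p lam (m + 1) x ^ 2
      ≤ ∑' x, green p lam m x ^ 2 + 2 * green p lam (m + 1) 0 := by
    intro m
    set P : Site d → ℝ≥0∞ := fun x => ∫⁻ v, green p lam m (x + disp v) ∂instructionLaw p lam
    have h1 : ∀ x, green p lam (m + 1) x ^ 2
        = P x ^ 2 + if x = 0 then 1 + 2 * P 0 else 0 := by
      intro x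
      rw [green_succ]
      change ((if x = 0 then 1 else 0) + P x) ^ 2 = _
      by_cases hx : x = 0
      · subst hx
        simp only [if_true]
        ring
      · simp [hx]
    have h2 : ∑' x, green p lam (m + 1) x ^ 2 = ∑' x, P x ^ 2 + (1 + 2 * P 0) := by
      simp_rw [h1]
      rw [ENNReal.tsum_add, tsum_ite_eq]
    rw [h2, ← add_assoc, ← ENNReal.tsum_add]
    have h3 : ∑' x, (ENNReal.ofReal (greenVar p lam m x) + P x ^ 2)
        = ∑' x, green p lam m x ^ 2 := by
      simp_rw [P, greenVar_add]
      exact tsum_lintegral_shift p lam fun x => green p lam m x ^ 2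
    rw [h3]
    gcongr
    rw [green_succ]
    change _ ≤ 2 * ((if (0 : Site d) = 0 then 1 else 0) + P 0)
    rw [if_pos rfl, mul_add]
    gcongr
    norm_num
  have hind : ∀ K, ∑ m ∈ Finset.range K, ∑' x, ENNReal.ofReal (greenVar p lam m x)
      + ∑' x, green p lam K x ^ 2 ≤ 2 * ∑ m ∈ Finset.range K, green p lam (m + 1) 0 := by
    intro K
    induction K with
    | zero => simp [green]
    | succ K ih =>
      rw [Finset.sum_range_succ, Finset.sum_range_succ, mul_add, add_assoc]
      calc _ ≤ _ := add_le_add_right (hstep K) _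
        _ = _ := (add_assoc _ _ _).symm
        _ ≤ _ := add_le_add_left ih _
  exact le_self_add.trans (hind K)

/-- The visits to the origin that are not accounted for by the expected motion. -/
def greenDev (m : ℕ) (x : Site d) (v : Instruction d) : ℝ :=
  greenR p lam m (x + disp v) - greenStep p lam m x

/-! ### Green function potential for toppling in rounds -/

lemma rounds_subset_succ (B : Finset (Site d)) {σ : Site d → ℕ} (hσ : ∀ x, x ∉ B → σ x = 0)
    (τ : Site d × ℕ → Instruction d) (j : ℕ) : rounds B σ τ j ⊆ rounds B σ τ (j + 1) := by
  induction j with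
  | zero => exact Finset.empty_subset _
  | succ j ih =>
    intro a ha
    rw [mem_rounds_succ hσ] at ha ⊢
    have : arr τ (rounds B σ τ j) a.1 ≤ arr τ (rounds B σ τ (j + 1)) a.1 :=
      Finset.card_le_card (Finset.filter_subset_filter _ ih)
    omega

lemma rounds_mono (B : Finset (Site d)) {σ : Site d → ℕ} (hσ : ∀ x, x ∉ B → σ x = 0)
    (τ : Site d × ℕ → Instruction d) : Monotone (rounds B σ τ) :=
  monotone_nat_of_le_succ (rounds_subset_succ B hσ τ)

lemma card_rounds_succ_fiber {B : Finset (Site d)} {σ : Site d → ℕ} (hσ : ∀ x, x ∉ B → σ x = 0)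
    (τ : Site d × ℕ → Instruction d) (j : ℕ) (x : Site d) :
    ((rounds B σ τ (j + 1)).filter fun a => a.1 = x).card
      = σ x + arr τ (rounds B σ τ j) x - 1 := by
  rw [← Finset.card_range (σ x + arr τ (rounds B σ τ j) x - 1),
    ← Finset.card_image_of_injective (Finset.range _) (Prod.mk_right_injective x)]
  refine congrArg Finset.card (Finset.ext fun a => ?_)
  simp only [Finset.mem_filter, mem_rounds_succ hσ, Finset.mem_image, Finset.mem_range]
  constructor
  · rintro ⟨h, rfl⟩
    exact ⟨a.2, by omega, rfl⟩
  · rintro ⟨m, hm, rfl⟩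
    exact ⟨by dsimp only; omega, rfl⟩

/-- The Green function bounds from below the number of instructions that are used at the origin in
the first `K` rounds. -/
lemma sum_greenR_mul_le {B : Finset (Site d)} {σ : Site d → ℕ} (hσ : ∀ x, x ∉ B → σ x = 0)
    (τ : Site d × ℕ → Instruction d) (K : ℕ) :
    ∑ x ∈ B, greenR p lam K x * σ x + ∑ j ∈ Finset.range K,
      ∑ a ∈ rounds B σ τ (j + 1) \ rounds B σ τ j, greenDev p lam (K - 1 - j) a.1 (τ a)
      ≤ K + ((rounds B σ τ K).filter fun a => a.1 = 0).card := by
  classical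
  set E := rounds B σ τ
  -- The total weight after round `j` when `k` rounds remain: initial weights plus the changes made
  -- by all instructions used so far.
  let Ψ : ℕ → ℕ → ℝ := fun k j => ∑ x ∈ B, greenR p lam k x * σ x
    + ∑ a ∈ E j, (greenR p lam k (dest τ a) - greenR p lam k a.1)
  have hstep : ∀ k j, Ψ (k + 1) j
      + ∑ a ∈ E (j + 1) \ E j, greenDev p lam k a.1 (τ a)
      ≤ Ψ k (j + 1) + 1 + ∑ a ∈ E (j + 1) \ E j, (if a.1 = 0 then 1 else 0 : ℝ) := by
    intro k j
    set δ : Site d → ℝ := fun x => greenR p lam (k + 1) x - greenR p lam k x with hδ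
    have hδ0 : ∀ x, 0 ≤ δ x := fun x => sub_nonneg.2 (greenR_mono p lam (Nat.le_succ k) x)
    -- The left side adds `δ` over all particles after round `j`, each counted with its past visits.
    -- At every site all but at most one of these visits use an instruction by round `j + 1`, and
    -- the exceptions cost at most `∑ δ ≤ 1`.
    have hkey : ∑ x ∈ B, δ x * σ x + ∑ a ∈ E j, δ (dest τ a)
        ≤ 1 + ∑ a ∈ E (j + 1), δ a.1 := by
      set F := B ∪ (E j).image (dest τ) ∪ (E (j + 1)).image Prod.fst
      have h1 : ∑ x ∈ B, δ x * σ x = ∑ x ∈ F, δ x * σ x := by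
        refine Finset.sum_subset (fun x hx => by simp [F, hx]) fun x _ hx => ?_
        simp [hσ x hx]
      have h2 : ∑ a ∈ E j, δ (dest τ a) = ∑ x ∈ F, δ x * arr τ (E j) x := by
        rw [← Finset.sum_fiberwise_of_maps_to (s := E j) (t := F) (g := dest τ)
          (fun a ha => by
            simp only [F, Finset.mem_union, Finset.mem_image]
            exact Or.inl (Or.inr ⟨a, ha, rfl⟩))]
        refine Finset.sum_congr rfl fun x _ => ?_
        rw [Finset.sum_congr rfl fun a ha => by rw [(Finset.mem_filter.1 ha).2]]
        simp [arr, mul_comm]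
      have h3 : ∑ a ∈ E (j + 1), δ a.1
          = ∑ x ∈ F, δ x * (σ x + arr τ (E j) x - 1 : ℕ) := by
        rw [← Finset.sum_fiberwise_of_maps_to (s := E (j + 1)) (t := F) (g := Prod.fst)
          (fun a ha => by
            simp only [F, Finset.mem_union, Finset.mem_image]
            exact Or.inr ⟨a, ha, rfl⟩)]
        refine Finset.sum_congr rfl fun x _ => ?_
        rw [Finset.sum_congr rfl fun a ha => by rw [(Finset.mem_filter.1 ha).2],
          ← card_rounds_succ_fiber hσ τ j x]
        simp [E, mul_comm]
      rw [h1, h2, h3, ← Finset.sum_add_distrib]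
      refine le_trans ?_ (add_le_add_left (sum_greenR_sub_le p lam k F) _)
      rw [← Finset.sum_add_distrib]
      refine Finset.sum_le_sum fun x _ => ?_
      have h4 : (σ x : ℝ) + arr τ (E j) x ≤ 1 + (σ x + arr τ (E j) x - 1 : ℕ) := by
        have : σ x + arr τ (E j) x ≤ 1 + (σ x + arr τ (E j) x - 1) := by omega
        exact_mod_cast this
      calc δ x * σ x + δ x * arr τ (E j) x = δ x * (σ x + arr τ (E j) x) := by ring
        _ ≤ δ x * (1 + (σ x + arr τ (E j) x - 1 : ℕ)) :=
          mul_le_mul_of_nonneg_left h4 (hδ0 x)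
        _ = _ := by rw [mul_add, mul_one]
    have hsplit : ∀ f : Site d × ℕ → ℝ, ∑ a ∈ E (j + 1), f a
        = ∑ a ∈ E j, f a + ∑ a ∈ E (j + 1) \ E j, f a := by
      intro f
      exact ((add_comm _ _).trans (Finset.sum_sdiff (rounds_subset_succ B hσ τ j))).symm
    have hdev : ∑ a ∈ E (j + 1) \ E j, greenDev p lam k a.1 (τ a)
        = ∑ a ∈ E (j + 1) \ E j, (greenR p lam k (dest τ a) - greenR p lam k a.1)
          - ∑ a ∈ E (j + 1) \ E j, δ a.1
          + ∑ a ∈ E (j + 1) \ E j, (if a.1 = 0 then 1 else 0 : ℝ) := by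
      rw [← Finset.sum_sub_distrib, ← Finset.sum_add_distrib]
      refine Finset.sum_congr rfl fun a _ => ?_
      have h5 := greenR_succ p lam k a.1
      simp only [hδ, greenDev, dest]
      linarith
    have hΨ : Ψ (k + 1) j = ∑ x ∈ B, greenR p lam k x * σ x + ∑ x ∈ B, δ x * σ x
        + (∑ a ∈ E j, (greenR p lam k (dest τ a) - greenR p lam k a.1)
          + (∑ a ∈ E j, δ (dest τ a) - ∑ a ∈ E j, δ a.1)) := by
      simp only [Ψ, hδ]
      rw [← Finset.sum_add_distrib, ← Finset.sum_sub_distrib, ← Finset.sum_add_distrib]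
      congr 1
      · exact Finset.sum_congr rfl fun x _ => by ring
      · exact Finset.sum_congr rfl fun x _ => by ring
    have hΨ' : Ψ k (j + 1) = ∑ x ∈ B, greenR p lam k x * σ x
        + (∑ a ∈ E j, (greenR p lam k (dest τ a) - greenR p lam k a.1)
          + ∑ a ∈ E (j + 1) \ E j, (greenR p lam k (dest τ a) - greenR p lam k a.1)) := by
      simp only [Ψ]
      rw [hsplit]
    have hδs := hsplit fun a => δ a.1
    rw [hdev, hΨ, hΨ']
    linarith
  -- Lowering the index of the Green function by one in each round makes it reach 0 after `K`
  -- rounds, where the weight vanishes.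
  have hind : ∀ j ≤ K, Ψ K 0 + ∑ i ∈ Finset.range j, ∑ a ∈ E (i + 1) \ E i,
      greenDev p lam (K - 1 - i) a.1 (τ a)
      ≤ Ψ (K - j) j + j + ∑ a ∈ E j, (if a.1 = 0 then 1 else 0 : ℝ) := by
    intro j hj
    induction j with
    | zero => simp [E, rounds]
    | succ j ih =>
      have h1 := ih (by omega)
      have h2 := hstep (K - 1 - j) j
      rw [show K - 1 - j + 1 = K - j by omega] at h2
      have h3 : ∑ a ∈ E (j + 1), (if a.1 = 0 then 1 else 0 : ℝ)
          = ∑ a ∈ E j, (if a.1 = 0 then 1 else 0 : ℝ)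
            + ∑ a ∈ E (j + 1) \ E j, (if a.1 = 0 then 1 else 0 : ℝ) :=
        ((add_comm _ _).trans (Finset.sum_sdiff (rounds_subset_succ B hσ τ j))).symm
      rw [Finset.sum_range_succ, h3, show K - (j + 1) = K - 1 - j by omega]
      push_cast
      linarith
  have h0 : ∀ j, Ψ 0 j = 0 := by
    intro j
    simp [Ψ, greenR, green]
  have hK : Ψ K 0 = ∑ x ∈ B, greenR p lam K x * σ x := by
    simp [Ψ, E, rounds]
  have := hind K le_rfl
  rw [Nat.sub_self, h0, hK, zero_add] at this
  refine this.trans (le_of_eq ?_)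
  rw [Finset.sum_boole]

end walk

end

section

variable {d : ℕ}

/-! ### Second moments -/

lemma lintegral_sum_sq_of_orthogonal {Ω ι : Type*} [MeasurableSpace Ω] {μ : Measure Ω}
    [IsProbabilityMeasure μ] {X : ι → Ω → ℝ} (hX : ∀ i, Measurable (X i)) {C : ℝ}
    (hC : ∀ i ω, |X i ω| ≤ C) (h : ∀ i j, i ≠ j → ∫ ω, X i ω * X j ω ∂μ = 0) (T : Finset ι) :
    ∫⁻ ω, ENNReal.ofReal ((∑ i ∈ T, X i ω) ^ 2) ∂μ
      = ∑ i ∈ T, ∫⁻ ω, ENNReal.ofReal (X i ω ^ 2) ∂μ := by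
  have hint : ∀ i j, Integrable (fun ω => X i ω * X j ω) μ := by
    intro i j
    refine Integrable.of_bound ((hX i).mul (hX j)).aestronglyMeasurable (C * C)
      (Eventually.of_forall fun ω => ?_)
    rw [Real.norm_eq_abs, abs_mul]
    exact mul_le_mul (hC i ω) (hC j ω) (abs_nonneg _) ((abs_nonneg _).trans (hC i ω))
  have hsq : ∀ ω, (∑ i ∈ T, X i ω) ^ 2 = ∑ i ∈ T, ∑ j ∈ T, X i ω * X j ω := fun ω => by
    rw [sq, Finset.sum_mul_sum]
  have h1 : ∫ ω, (∑ i ∈ T, X i ω) ^ 2 ∂μ = ∑ i ∈ T, ∫ ω, X i ω ^ 2 ∂μ := by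
    simp_rw [hsq]
    rw [integral_finsetSum _ fun i _ => integrable_finsetSum _ fun j _ => hint i j]
    refine Finset.sum_congr rfl fun i hi => ?_
    rw [integral_finsetSum _ fun j _ => hint i j, Finset.sum_eq_single i
      (fun j _ hj => h i j hj.symm) fun hi' => absurd hi hi']
    simp_rw [sq]
  rw [← ofReal_integral_eq_lintegral_ofReal
    ((integrable_finsetSum _ fun i _ => integrable_finsetSum _ fun j _ => hint i j).congr
      (Eventually.of_forall fun ω => (hsq ω).symm)) (Eventually.of_forall fun ω => sq_nonneg _),
    h1, ENNReal.ofReal_sum_of_nonneg fun i _ => integral_nonneg fun ω => sq_nonneg _]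
  refine Finset.sum_congr rfl fun i _ => ?_
  rw [← ofReal_integral_eq_lintegral_ofReal
    ((hint i i).congr (Eventually.of_forall fun ω => (sq _).symm))
    (Eventually.of_forall fun ω => sq_nonneg _)]

/-- The instructions used in the first `j` rounds of the finite system. -/
def roundsAt (M j : ℕ) (ω : Noise d) : Finset (Site d × ℕ) :=
  rounds (box_finite d M).toFinset (source (box d M) ω) ω.2.1 j

/-- The instructions used for the first time in round `j + 1`. -/
def fresh (M j : ℕ) (ω : Noise d) : Finset (Site d × ℕ) := roundsAt M (j + 1) ω \ roundsAt M j ω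

lemma source_eq_zero (M : ℕ) (ω : Noise d) (x : Site d) (hx : x ∉ (box_finite d M).toFinset) :
    source (box d M) ω x = 0 := by
  simp only [Set.Finite.mem_toFinset] at hx
  simp [source, hx]

lemma mem_roundsAt_succ {M j : ℕ} {ω : Noise d} {a : Site d × ℕ} :
    a ∈ roundsAt M (j + 1) ω
      ↔ a.2 + 1 < source (box d M) ω a.1 + arr ω.2.1 (roundsAt M j ω) a.1 :=
  mem_rounds_succ (source_eq_zero M ω)

lemma roundsAt_mono (M : ℕ) (ω : Noise d) : Monotone fun j => roundsAt M j ω :=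
  rounds_mono _ (source_eq_zero M ω) _

lemma measurableSet_mem_roundsAt (M j : ℕ) (a : Site d × ℕ) :
    MeasurableSet {ω : Noise d | a ∈ roundsAt M j ω} := by
  induction j generalizing a with
  | zero => simp [roundsAt, rounds]
  | succ j ih =>
    have h1 : Measurable fun ω : Noise d => (arr ω.2.1 (roundsAt M j ω) a.1 : ℝ≥0∞) := by
      simp_rw [← arrivals_coe]
      exact measurable_cnt fun b => (ih b).inter (measurableSet_dest b a.1)
    have h2 : Measurable fun ω : Noise d =>
        (source (box d M) ω a.1 : ℝ≥0∞) + arr ω.2.1 (roundsAt M j ω) a.1 :=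
      ((measurable_from_top (f := fun n : ℕ => (n : ℝ≥0∞))).comp
        (measurable_source (box d M) a.1)).add h1
    have h3 : {ω : Noise d | a ∈ roundsAt M (j + 1) ω} = {ω : Noise d | ((a.2 + 1 : ℕ) : ℝ≥0∞)
        < (source (box d M) ω a.1 : ℝ≥0∞) + arr ω.2.1 (roundsAt M j ω) a.1} := by
      ext ω
      rw [Set.mem_ofPred_eq, Set.mem_ofPred_eq, mem_roundsAt_succ, ← Nat.cast_add, Nat.cast_lt]
    rw [h3]
    exact measurableSet_lt measurable_const h2

lemma measurableSet_mem_fresh (M j : ℕ) (a : Site d × ℕ) :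
    MeasurableSet {ω : Noise d | a ∈ fresh M j ω} := by
  have : {ω : Noise d | a ∈ fresh M j ω}
      = {ω | a ∈ roundsAt M (j + 1) ω} \ {ω | a ∈ roundsAt M j ω} := by
    ext ω
    simp [fresh]
  rw [this]
  exact (measurableSet_mem_roundsAt M _ a).diff (measurableSet_mem_roundsAt M _ a)

/-- The set used in round `i` depends only on where the instructions of round `i - 1` lead. This is
why the conclusion reaches `j + 1` although `a` is only assumed unused through round `j`; freshness
of `a` therefore does not depend on its value. -/
lemma roundsAt_setInstr {M j : ℕ} {ω : Noise d} {a : Site d × ℕ} (h : a ∉ roundsAt M j ω)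
    (v : Instruction d) : ∀ i ≤ j + 1, roundsAt M i (setInstr a ω v) = roundsAt M i ω := by
  intro i
  induction i with
  | zero => intros; rfl
  | succ i ih =>
    intro hi
    ext b
    rw [mem_roundsAt_succ, mem_roundsAt_succ, ih (by omega)]
    have h1 : arr (setInstr a ω v).2.1 (roundsAt M i ω) b.1 = arr ω.2.1 (roundsAt M i ω) b.1 := by
      refine congrArg Finset.card (Finset.filter_congr fun e he => ?_)
      have hea : e ≠ a := by
        rintro rfl
        exact h (roundsAt_mono M ω (by omega) he)
      simp [dest, setInstr, hea]
    rw [h1]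
    rfl

lemma mem_roundsAt_setInstr (M j : ℕ) (ω : Noise d) (a : Site d × ℕ) (v : Instruction d) :
    a ∈ roundsAt M j (setInstr a ω v) ↔ a ∈ roundsAt M j ω := by
  have key : ∀ (ω : Noise d) v, a ∉ roundsAt M j ω → a ∉ roundsAt M j (setInstr a ω v) :=
    fun ω v h => by rwa [roundsAt_setInstr h v j (by omega)]
  refine ⟨fun h => not_not.1 fun h' => key _ _ h' h, fun h => not_not.1 fun h' => ?_⟩
  have := key _ (ω.2.1 a) h'
  simp [setInstr] at this
  exact absurd h this

lemma fresh_setInstr {M i j : ℕ} {ω : Noise d} {a : Site d × ℕ} (h : a ∉ roundsAt M j ω)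
    (v : Instruction d) (hi : i ≤ j) : fresh M i (setInstr a ω v) = fresh M i ω := by
  rw [fresh, fresh, roundsAt_setInstr h v _ (by omega), roundsAt_setInstr h v _ (by omega)]

lemma mem_fresh_setInstr (M j : ℕ) (ω : Noise d) (a : Site d × ℕ) (v : Instruction d) :
    a ∈ fresh M j (setInstr a ω v) ↔ a ∈ fresh M j ω := by
  by_cases h : a ∈ roundsAt M j ω
  · have h' := (mem_roundsAt_setInstr M j ω a v).2 h
    simp [fresh, h, h']
  · rw [fresh_setInstr h v le_rfl]

section

variable (p : PMF (Site d)) (lam : ℝ≥0∞) (mu : ℝ≥0)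

lemma tsum_mem_fresh_eq (M j : ℕ) (x : Site d) :
    ∑' m : ℕ, noiseLaw p lam mu {ω | (x, m) ∈ fresh M j ω}
      = ∫⁻ ω, cnt {m : ℕ | (x, m) ∈ fresh M j ω} ∂noiseLaw p lam mu := by
  simp_rw [cnt_eq_tsum]
  have h : ∀ m, Measurable fun ω : Noise d =>
      {m : ℕ | (x, m) ∈ fresh M j ω}.indicator (1 : ℕ → ℝ≥0∞) m := fun m =>
    Measurable.indicator (f := fun _ => (1 : ℝ≥0∞)) measurable_const
      (measurableSet_mem_fresh M j (x, m))
  rw [lintegral_tsum fun m => (h m).aemeasurable]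
  refine tsum_congr fun m => ?_
  rw [← lintegral_indicator_one (measurableSet_mem_fresh M j (x, m))]
  rfl

lemma cnt_Ico (k l : ℕ) : cnt {m : ℕ | k ≤ m ∧ m < l} = (l - k : ℕ) := by
  have : {m : ℕ | k ≤ m ∧ m < l} = (Finset.Ico k l : Set ℕ) := by ext; simp
  rw [this, cnt_finset, Nat.card_Ico]

lemma arr_fresh (M j : ℕ) (ω : Noise d) (x : Site d) :
    arr ω.2.1 (roundsAt M (j + 1) ω) x
      = arr ω.2.1 (roundsAt M j ω) x + arr ω.2.1 (fresh M j ω) x := by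
  unfold arr
  rw [← Finset.card_union_of_disjoint]
  · rw [← Finset.filter_union, fresh,
      Finset.union_sdiff_of_subset (roundsAt_mono M ω (Nat.le_succ j))]
  · exact Finset.disjoint_filter_filter Finset.disjoint_sdiff

/-- In every round, the expected number of new instructions at a site is at most `mu`. -/
lemma tsum_mem_fresh_le (M j : ℕ) (x : Site d) :
    ∑' m : ℕ, noiseLaw p lam mu {ω | (x, m) ∈ fresh M j ω} ≤ mu := by
  induction j generalizing x with
  | zero =>
    rw [tsum_mem_fresh_eq]
    have h1 : ∀ ω : Noise d, cnt {m : ℕ | (x, m) ∈ fresh M 0 ω} ≤ source (box d M) ω x := by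
      intro ω
      rw [← Nat.sub_zero (source (box d M) ω x), ← cnt_Ico]
      refine cnt_mono fun m hm => ?_
      have h2 := (Finset.mem_sdiff.1 hm).1
      rw [mem_roundsAt_succ] at h2
      simp only [roundsAt, rounds, arr, Finset.filter_empty, Finset.card_empty] at h2
      exact ⟨by omega, by omega⟩
    refine (lintegral_mono h1).trans ?_
    rw [lintegral_source]
    exact Set.indicator_apply_le' (fun _ => le_rfl) fun _ => bot_le
  | succ j ih =>
    classical
    rw [tsum_mem_fresh_eq]
    have h1 : ∀ ω : Noise d, cnt {m : ℕ | (x, m) ∈ fresh M (j + 1) ω}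
        ≤ ∑' a : Site d × ℕ, {ω | a ∈ fresh M j ω}.indicator 1 ω
          * (if a.1 + disp (ω.2.1 a) = x then 1 else 0) := by
      intro ω
      -- Once a site has been toppled down to one particle, only new arrivals allow new
      -- instructions; a site that was still empty uses even one fewer.
      have h2 : cnt {m : ℕ | (x, m) ∈ fresh M (j + 1) ω} ≤ arr ω.2.1 (fresh M j ω) x := by
        have h3 := arr_fresh M j ω x
        set k := source (box d M) ω x + arr ω.2.1 (roundsAt M j ω) x - 1 with hk
        rw [← Nat.add_sub_cancel_left (n := k) (m := arr ω.2.1 (fresh M j ω) x), ← cnt_Ico]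
        refine cnt_mono fun m hm => ?_
        have h4 := Finset.mem_sdiff.1 hm
        rw [mem_roundsAt_succ, mem_roundsAt_succ] at h4
        dsimp only at h4
        exact ⟨by omega, by omega⟩
      refine h2.trans (le_of_eq ?_)
      rw [← arrivals_coe, arrivals, cnt_eq_tsum]
      refine tsum_congr fun a => ?_
      by_cases h4 : a ∈ fresh M j ω <;> by_cases h5 : dest ω.2.1 a = x <;>
        simp_all [dest, Set.indicator]
    refine (lintegral_mono h1).trans ?_
    have hm : ∀ a : Site d × ℕ, Measurable ({ω : Noise d | a ∈ fresh M j ω}.indicator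
        (1 : Noise d → ℝ≥0∞)) := fun a => measurable_one.indicator (measurableSet_mem_fresh M j a)
    have hm' : ∀ a : Site d × ℕ, Measurable fun ω : Noise d =>
        (if a.1 + disp (ω.2.1 a) = x then 1 else 0 : ℝ≥0∞) := fun a =>
      Measurable.ite (measurableSet_dest a x) measurable_const measurable_const
    have hmm : ∀ a : Site d × ℕ, Measurable fun ω : Noise d => {ω | a ∈ fresh M j ω}.indicator 1 ω
        * (if a.1 + disp (ω.2.1 a) = x then 1 else 0 : ℝ≥0∞) := fun a => (hm a).mul (hm' a)
    rw [lintegral_tsum fun a => (hmm a).aemeasurable]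
    have h6 : ∀ a : Site d × ℕ, ∫⁻ ω, {ω | a ∈ fresh M j ω}.indicator 1 ω
          * (if a.1 + disp (ω.2.1 a) = x then 1 else 0) ∂noiseLaw p lam mu
        = noiseLaw p lam mu {ω | a ∈ fresh M j ω} * hop p lam a.1 x := by
      intro a
      rw [lintegral_mul_instr p lam mu (hm a) (H := fun v => if a.1 + disp v = x then 1 else 0) a,
        lintegral_indicator_one (measurableSet_mem_fresh M j a), hop_eq_lintegral]
      intro ω v
      simp only [Set.indicator_apply, Set.mem_ofPred_eq, mem_fresh_setInstr, Pi.one_apply]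
    simp_rw [h6]
    rw [ENNReal.tsum_prod']
    calc ∑' y, ∑' m : ℕ, noiseLaw p lam mu {ω | (y, m) ∈ fresh M j ω} * hop p lam y x
        ≤ ∑' y, mu * hop p lam y x := by
          refine ENNReal.tsum_le_tsum fun y => ?_
          rw [ENNReal.tsum_mul_right]
          gcongr
          exact ih y
      _ = mu := by rw [ENNReal.tsum_mul_left, tsum_hop_left, mul_one]

end

end

/-! ### Deviations as orthogonal sums, and initial fluctuations -/

section

variable {d : ℕ}

section

variable (p : PMF (Site d)) (lam : ℝ≥0∞)

lemma abs_greenDev_le (m : ℕ) (x : Site d) (v : Instruction d) : |greenDev p lam m x v| ≤ m := by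
  have h1 : 0 ≤ greenStep p lam m x := integral_nonneg fun v => greenR_nonneg _ _ _ _
  have h2 : greenStep p lam m x ≤ m := by
    have h3 : ∫ _ : Instruction d, (m : ℝ) ∂instructionLaw p lam = m := by simp
    rw [← h3]
    exact integral_mono (integrable_greenR p lam m x) (integrable_const _) fun v =>
      greenR_le p lam m _
  have h4 := greenR_nonneg p lam m (x + disp v)
  have h5 := greenR_le p lam m (x + disp v)
  rw [greenDev, abs_le]
  constructor <;> linarith

lemma integral_greenDev (m : ℕ) (x : Site d) :
    ∫ v, greenDev p lam m x v ∂instructionLaw p lam = 0 := by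
  unfold greenDev
  rw [integral_sub (integrable_greenR p lam m x) (integrable_const _)]
  simp [greenStep]

lemma lintegral_greenDev_sq (m : ℕ) (x : Site d) :
    ∫⁻ v, ENNReal.ofReal (greenDev p lam m x v ^ 2) ∂instructionLaw p lam
      = ENNReal.ofReal (greenVar p lam m x) := by
  have hm : Measurable (greenDev p lam m x) := measurable_from_top
  rw [greenVar, ofReal_integral_eq_lintegral_ofReal _ (Eventually.of_forall fun v => sq_nonneg _)]
  · rfl
  · refine Integrable.of_bound (hm.pow_const 2).aestronglyMeasurable ((m : ℝ) ^ 2)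
      (Eventually.of_forall fun v => ?_)
    rw [Real.norm_eq_abs, abs_pow]
    exact pow_le_pow_left₀ (abs_nonneg _) (abs_greenDev_le p lam m x v) 2

/-- The deviation that is due to the instruction `a` in round `j + 1`. -/
def devTerm (M K : ℕ) (i : ℕ × Site d × ℕ) (ω : Noise d) : ℝ :=
  (if i.2 ∈ fresh M i.1 ω then 1 else 0) * greenDev p lam (K - 1 - i.1) i.2.1 (ω.2.1 i.2)

/-- The sum of the deviations in the first `K` rounds. -/
def devSum (M K : ℕ) (ω : Noise d) : ℝ :=
  ∑ j ∈ Finset.range K, ∑ a ∈ fresh M j ω, greenDev p lam (K - 1 - j) a.1 (ω.2.1 a)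

lemma measurable_fresh_ite (M j : ℕ) (a : Site d × ℕ) :
    Measurable fun ω : Noise d => (if a ∈ fresh M j ω then 1 else 0 : ℝ) :=
  Measurable.ite (measurableSet_mem_fresh M j a) measurable_const measurable_const

lemma measurable_devTerm (M K : ℕ) (i : ℕ × Site d × ℕ) :
    Measurable (devTerm p lam M K i) := by
  have h : Measurable (greenDev p lam (K - 1 - i.1) i.2.1) := measurable_from_top
  exact (measurable_fresh_ite M i.1 i.2).mul (h.comp (by fun_prop))

lemma abs_devTerm_le (M K : ℕ) (i : ℕ × Site d × ℕ) (ω : Noise d) :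
    |devTerm p lam M K i ω| ≤ K := by
  have h := abs_greenDev_le p lam (K - 1 - i.1) i.2.1 (ω.2.1 i.2)
  have h2 : ((K - 1 - i.1 : ℕ) : ℝ) ≤ K := by
    exact_mod_cast (Nat.sub_le _ _).trans (Nat.sub_le _ _)
  unfold devTerm
  split_ifs
  · rw [one_mul]
    exact h.trans h2
  · simp

/-- The random finite sets of instructions are replaced by a deterministic exhausting sequence, for
measurability and so that orthogonality applies to deterministic index sets. -/
lemma exists_eventually_eq_devSum (M K : ℕ) : ∃ F : ℕ → Finset (Site d × ℕ), ∀ ω, ∀ᶠ n in atTop,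
    ∑ i ∈ Finset.range K ×ˢ F n, devTerm p lam M K i ω = devSum p lam M K ω := by
  obtain ⟨F, hF⟩ := exists_seq_tendsto (atTop : Filter (Finset (Site d × ℕ)))
  refine ⟨F, fun ω => ?_⟩
  filter_upwards [hF.eventually (eventually_ge_atTop (roundsAt M K ω))] with n hn
  rw [Finset.sum_product, devSum]
  refine Finset.sum_congr rfl fun j hj => ?_
  have hsub : fresh M j ω ⊆ F n := fun a ha =>
    hn (roundsAt_mono M ω (Finset.mem_range.1 hj) (Finset.mem_sdiff.1 ha).1)
  rw [← Finset.sum_subset hsub]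
  · refine Finset.sum_congr rfl fun a ha => ?_
    simp [devTerm, ha]
  · intro a _ ha
    simp [devTerm, ha]

lemma measurable_devSum (M K : ℕ) : Measurable (devSum p lam M K : Noise d → ℝ) := by
  obtain ⟨F, hF⟩ := exists_eventually_eq_devSum p lam M K
  refine measurable_of_tendsto_metrizable (f := fun n ω =>
    ∑ i ∈ Finset.range K ×ˢ F n, devTerm p lam M K i ω)
    (fun n => Finset.measurable_fun_sum _ fun i _ => measurable_devTerm p lam M K i)
    (tendsto_pi_nhds.2 fun ω => tendsto_const_nhds.congr' ?_)
  filter_upwards [hF ω] with n hn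
  exact hn.symm

variable (mu : ℝ≥0)

/-- A martingale-difference argument. An instruction is fresh in only one round. For distinct
instructions, the one from the later or same round affects neither its own freshness nor the other
term, and its deviation has mean zero. -/
lemma integral_devTerm_mul (M K : ℕ) {i i' : ℕ × Site d × ℕ} (h : i ≠ i') :
    ∫ ω, devTerm p lam M K i ω * devTerm p lam M K i' ω ∂noiseLaw p lam mu = 0 := by
  wlog hle : i.1 ≤ i'.1 generalizing i i'
  · simp_rw [mul_comm (devTerm p lam M K i _)]
    exact this h.symm (le_of_not_ge hle)
  obtain ⟨j, a⟩ := i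
  obtain ⟨j', a'⟩ := i'
  dsimp only at hle
  by_cases ha : a = a'
  · subst ha
    have hlt : j + 1 ≤ j' := lt_of_le_of_ne hle fun h' => h (by rw [h'])
    rw [← integral_zero (Noise d) ℝ]
    refine integral_congr_ae (Eventually.of_forall fun ω => ?_)
    simp only [devTerm]
    by_cases h1 : a ∈ fresh M j ω
    · have h2 : a ∉ fresh M j' ω := fun h2 =>
        (Finset.mem_sdiff.1 h2).2 (roundsAt_mono M ω hlt (Finset.mem_sdiff.1 h1).1)
      simp [h2]
    · simp [h1]
  · have hdev : Measurable fun ω : Noise d => devTerm p lam M K (j, a) ω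
        * (if a' ∈ fresh M j' ω then 1 else 0 : ℝ) :=
      (measurable_devTerm p lam M K (j, a)).mul (measurable_fresh_ite M j' a')
    have key := integral_mul_instr p lam mu hdev (H := greenDev p lam (K - 1 - j') a'.1) a' (by
      intro ω v
      simp only [mem_fresh_setInstr]
      by_cases h1 : a' ∈ fresh M j' ω
      · have h2 := fresh_setInstr (Finset.mem_sdiff.1 h1).2 v hle
        simp only [devTerm, h2]
        simp [setInstr, ha]
      · simp [h1])
    rw [integral_greenDev, mul_zero] at key
    rw [← key]
    refine integral_congr_ae (Eventually.of_forall fun ω => ?_)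
    simp only [devTerm]
    ring

lemma lintegral_devTerm_sq (M K : ℕ) (i : ℕ × Site d × ℕ) :
    ∫⁻ ω, ENNReal.ofReal (devTerm p lam M K i ω ^ 2) ∂noiseLaw p lam mu
      = noiseLaw p lam mu {ω | i.2 ∈ fresh M i.1 ω}
        * ENNReal.ofReal (greenVar p lam (K - 1 - i.1) i.2.1) := by
  rw [← lintegral_greenDev_sq, ← lintegral_indicator_one (measurableSet_mem_fresh M i.1 i.2),
    ← lintegral_mul_instr p lam mu (measurable_one.indicator (measurableSet_mem_fresh M i.1 i.2))
      (H := fun v => ENNReal.ofReal (greenDev p lam (K - 1 - i.1) i.2.1 v ^ 2)) i.2]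
  · refine lintegral_congr fun ω => ?_
    by_cases h : i.2 ∈ fresh M i.1 ω <;> simp [devTerm, h]
  · intro ω v
    simp only [Set.indicator_apply, Set.mem_ofPred_eq, mem_fresh_setInstr, Pi.one_apply]

/-- By orthogonality only the diagonal survives; expected freshness contributes at most `mu` per
site and round, and the sum of the variances is the energy bound. -/
lemma lintegral_sum_devTerm_sq_le (M K : ℕ) (F : Finset (Site d × ℕ)) :
    ∫⁻ ω, ENNReal.ofReal ((∑ i ∈ Finset.range K ×ˢ F, devTerm p lam M K i ω) ^ 2)
        ∂noiseLaw p lam mu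
      ≤ mu * (2 * ∑ m ∈ Finset.range K, green p lam (m + 1) 0) := by
  rw [lintegral_sum_sq_of_orthogonal (measurable_devTerm p lam M K) (abs_devTerm_le p lam M K)
    fun i i' h => integral_devTerm_mul p lam mu M K h]
  simp_rw [lintegral_devTerm_sq]
  rw [Finset.sum_product]
  calc ∑ j ∈ Finset.range K, ∑ a ∈ F, noiseLaw p lam mu {ω | a ∈ fresh M j ω}
        * ENNReal.ofReal (greenVar p lam (K - 1 - j) a.1)
      ≤ ∑ j ∈ Finset.range K, mu * ∑' x, ENNReal.ofReal (greenVar p lam (K - 1 - j) x) := by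
        refine Finset.sum_le_sum fun j _ => (ENNReal.sum_le_tsum F).trans ?_
        rw [ENNReal.tsum_prod', ← ENNReal.tsum_mul_left]
        refine ENNReal.tsum_le_tsum fun x => ?_
        dsimp only
        rw [ENNReal.tsum_mul_right]
        gcongr
        exact tsum_mem_fresh_le p lam mu M j x
    _ = mu * ∑ m ∈ Finset.range K, ∑' x, ENNReal.ofReal (greenVar p lam m x) := by
        rw [← Finset.mul_sum, Finset.sum_range_reflect
          fun m => ∑' x, ENNReal.ofReal (greenVar p lam m x)]
    _ ≤ _ := by
        gcongr
        exact sum_greenVar_le p lam K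

lemma lintegral_devSum_sq_le (M K : ℕ) :
    ∫⁻ ω, ENNReal.ofReal (devSum p lam M K ω ^ 2) ∂noiseLaw p lam mu
      ≤ mu * (2 * ∑ m ∈ Finset.range K, green p lam (m + 1) 0) := by
  obtain ⟨F, hF⟩ := exists_eventually_eq_devSum p lam M K
  have hm : ∀ n, Measurable fun ω => ENNReal.ofReal
      ((∑ i ∈ Finset.range K ×ˢ F n, devTerm p lam M K i ω) ^ 2) := fun n =>
    ((Finset.measurable_fun_sum _ fun i _ =>
      measurable_devTerm p lam M K i).pow_const 2).ennreal_ofReal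
  calc ∫⁻ ω, ENNReal.ofReal (devSum p lam M K ω ^ 2) ∂noiseLaw p lam mu
      = ∫⁻ ω, liminf (fun n => ENNReal.ofReal
        ((∑ i ∈ Finset.range K ×ˢ F n, devTerm p lam M K i ω) ^ 2)) atTop
          ∂noiseLaw p lam mu := by
        refine lintegral_congr fun ω => (Tendsto.liminf_eq ?_).symm
        refine tendsto_const_nhds.congr' ?_
        filter_upwards [hF ω] with n hn
        rw [hn]
    -- Fatou's lemma suffices because the finite approximations satisfy a uniform bound.
    _ ≤ _ := lintegral_liminf_le hm
    _ ≤ _ := by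
        refine liminf_le_of_le (by isBoundedDefault) fun b hb => ?_
        obtain ⟨n, hn⟩ := hb.exists
        exact hn.trans (lintegral_sum_devTerm_sq_le p lam mu M K (F n))

end

/-! ### The initial configuration -/

lemma memLp_natCast_poisson (r : ℝ≥0) : MemLp (fun n : ℕ => (n : ℝ)) 2 (poissonMeasure r) ∧
    ∫ n, (n : ℝ) ∂poissonMeasure r = r ∧ variance (fun n : ℕ => (n : ℝ)) (poissonMeasure r) = r := by
  have hm : Measurable fun n : ℕ => (n : ℝ) := measurable_from_top
  have h2 : ∫⁻ n, ENNReal.ofReal ((n : ℝ) ^ 2) ∂poissonMeasure r = r * (r + 1) := by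
    have h3 : ∀ n : ℕ, ENNReal.ofReal ((n : ℝ) ^ 2) = n * (n : ℝ≥0∞) := by
      intro n
      rw [ENNReal.ofReal_pow (by positivity), ENNReal.ofReal_natCast, sq]
    simp_rw [h3]
    rw [lintegral_natCast_mul_poisson r fun n => (n : ℝ≥0∞)]
    push_cast
    rw [lintegral_add_right _ measurable_const, lintegral_natCast_poisson]
    simp
  have hL : MemLp (fun n : ℕ => (n : ℝ)) 2 (poissonMeasure r) := by
    rw [memLp_two_iff_integrable_sq hm.aestronglyMeasurable,
      ← lintegral_ofReal_ne_top_iff_integrable (hm.pow_const 2).aestronglyMeasurable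
        (Eventually.of_forall fun n => sq_nonneg _), h2]
    finiteness
  have h4 : ∫ n, (n : ℝ) ∂poissonMeasure r = r := by
    rw [integral_eq_lintegral_of_nonneg_ae (Eventually.of_forall fun n => by positivity)
      hm.aestronglyMeasurable]
    simp [lintegral_natCast_poisson]
  have h5 : ∫ n, (n : ℝ) ^ 2 ∂poissonMeasure r = r * (r + 1) := by
    rw [integral_eq_lintegral_of_nonneg_ae (Eventually.of_forall fun n => sq_nonneg _)
      (hm.pow_const 2).aestronglyMeasurable, h2]
    simp [ENNReal.toReal_add]
  refine ⟨hL, h4, ?_⟩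
  rw [variance_eq_sub hL]
  simp only [Pi.pow_apply]
  rw [h4, h5]
  ring

/-- A weak law of large numbers for the initial configuration. -/
lemma measure_sum_initial_le (mu : ℝ≥0) (B : Finset (Site d)) {w : Site d → ℝ}
    (hw : ∀ x, 0 ≤ w x) {s : ℝ} (hs : ∀ x, w x ≤ s) {c : ℝ} (hc : 0 < c) :
    (Measure.infinitePi fun _ : Site d => poissonMeasure mu)
        {η | ∑ x ∈ B, w x * η x ≤ mu * ∑ x ∈ B, w x - c}
      ≤ ENNReal.ofReal (mu * s * (∑ x ∈ B, w x) / c ^ 2) := by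
  obtain ⟨hL, hmean, hvar⟩ := memLp_natCast_poisson mu
  set P := Measure.infinitePi fun _ : Site d => poissonMeasure mu
  have hmp : ∀ x, MeasurePreserving (fun η : Site d → ℕ => η x) P (poissonMeasure mu) :=
    measurePreserving_eval_infinitePi fun _ : Site d => poissonMeasure mu
  let X : Site d → (Site d → ℕ) → ℝ := fun x η => w x * η x
  have hX : ∀ x, MemLp (X x) 2 P := fun x => (hL.comp_measurePreserving (hmp x)).const_mul (w x)
  have hvX : ∀ x, variance (X x) P = w x ^ 2 * mu := by
    intro x
    have h1 : variance (fun η : Site d → ℕ => (η x : ℝ)) P = mu := by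
      rw [← hvar, ← (hmp x).map_eq, variance_map measurable_from_top.aemeasurable
        (hmp x).measurable.aemeasurable]
      rfl
    rw [← h1]
    exact variance_const_mul _ _ _
  have hmX : ∀ x, ∫ η, X x η ∂P = mu * w x := by
    intro x
    have h1 : ∫ η : Site d → ℕ, (η x : ℝ) ∂P = mu := by
      rw [← hmean, ← (hmp x).map_eq, integral_map (hmp x).measurable.aemeasurable
        measurable_from_top.aestronglyMeasurable]
    simp only [X]
    rw [integral_const_mul, h1, mul_comm]
  have hind : iIndepFun X P :=
    iIndepFun_infinitePi (P := fun _ : Site d => poissonMeasure mu)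
      (X := fun x (n : ℕ) => w x * (n : ℝ)) fun x => measurable_from_top
  have hvar' : variance (∑ x ∈ B, X x) P ≤ mu * s * ∑ x ∈ B, w x := by
    rw [IndepFun.variance_sum (fun x _ => hX x) fun x _ y _ h => hind.indepFun h, Finset.mul_sum]
    refine Finset.sum_le_sum fun x _ => ?_
    rw [hvX]
    have := mul_le_mul_of_nonneg_right (hs x) (mul_nonneg mu.coe_nonneg (hw x))
    calc w x ^ 2 * mu = w x * (mu * w x) := by ring
      _ ≤ s * (mu * w x) := this
      _ = _ := by ring
  have hmean' : ∫ η, (∑ x ∈ B, X x) η ∂P = mu * ∑ x ∈ B, w x := by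
    simp only [Finset.sum_apply]
    rw [integral_finsetSum _ fun x _ => (hX x).integrable one_le_two, Finset.mul_sum]
    exact Finset.sum_congr rfl fun x _ => hmX x
  refine le_trans (measure_mono fun η hη => ?_) ((meas_ge_le_variance_div_sq
    (memLp_finsetSum' B fun x _ => hX x) hc).trans (ENNReal.ofReal_le_ofReal ?_))
  · rw [Set.mem_ofPred_eq, hmean', abs_sub_comm]
    simp only [Set.mem_ofPred_eq, Finset.sum_apply, X] at hη ⊢
    exact le_trans (by linarith) (le_abs_self _)
  · gcongr

end

section

variable {d : ℕ}

/-! ### Absence of fixation above density one -/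

lemma exists_subset_box (F : Finset (Site d)) : ∃ M, (F : Set (Site d)) ⊆ box d M := by
  refine ⟨F.sup fun x => Finset.univ.sup fun i => (x i).natAbs, fun x hx i => ?_⟩
  have h1 := Finset.le_sup (f := fun x : Site d => Finset.univ.sup fun i => (x i).natAbs) hx
  have h2 := Finset.le_sup (f := fun i => (x i).natAbs) (Finset.mem_univ i)
  rw [Int.abs_eq_natAbs]
  exact_mod_cast h2.trans h1

section

variable (p : PMF (Site d)) (lam : ℝ≥0∞)

lemma exists_lt_sum_box_greenR (K : ℕ) {r : ℝ} (hr0 : 0 ≤ r) (hr : r < K) :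
    ∃ M, r < ∑ x ∈ (box_finite d M).toFinset, greenR p lam K x := by
  have h1 : ENNReal.ofReal r < ∑' x, green p lam K x := by
    rw [tsum_green, ← ENNReal.ofReal_natCast]
    exact (ENNReal.ofReal_lt_ofReal_iff (hr0.trans_lt hr)).2 hr
  rw [ENNReal.tsum_eq_iSup_sum, lt_iSup_iff] at h1
  obtain ⟨F, hF⟩ := h1
  obtain ⟨M, hM⟩ := exists_subset_box F
  refine ⟨M, ?_⟩
  have h2 : ∑ x ∈ F, green p lam K x ≠ ⊤ := ENNReal.sum_ne_top.2 fun x _ => green_ne_top p lam K x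
  have h3 : r < ∑ x ∈ F, greenR p lam K x := by
    unfold greenR
    rw [← ENNReal.toReal_sum fun x _ => green_ne_top p lam K x]
    exact (ENNReal.ofReal_lt_iff_lt_toReal hr0 h2).1 hF
  refine h3.trans_le (Finset.sum_le_sum_of_subset_of_nonneg (fun x hx => ?_)
    fun x _ _ => greenR_nonneg p lam K x)
  simpa using hM hx

variable {mu : ℝ≥0}

lemma measure_le_abs_devSum_le (M K : ℕ) {s : ℝ} (hs : greenR p lam K 0 ≤ s) {c : ℝ}
    (hc : 0 < c) : noiseLaw p lam mu {ω | c ≤ |devSum p lam M K ω|}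
      ≤ ENNReal.ofReal (2 * mu * s * K / c ^ 2) := by
  have hs0 : 0 ≤ s := (greenR_nonneg p lam K 0).trans hs
  have hm : Measurable fun ω => ENNReal.ofReal (devSum p lam M K ω ^ 2) :=
    ((measurable_devSum p lam M K).pow_const 2).ennreal_ofReal
  have h1 : ∑ m ∈ Finset.range K, green p lam (m + 1) 0 ≤ K * ENNReal.ofReal s := by
    have h2 : ∀ m ∈ Finset.range K, green p lam (m + 1) 0 ≤ ENNReal.ofReal s := fun m hm => by
      refine (green_mono p lam 0 (Finset.mem_range.1 hm)).trans ?_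
      dsimp only
      rw [← ENNReal.ofReal_toReal (green_ne_top p lam K 0)]
      exact ENNReal.ofReal_le_ofReal hs
    simpa using Finset.sum_le_sum h2
  have h3 : {ω | c ≤ |devSum p lam M K ω|}
      ⊆ {ω | ENNReal.ofReal (c ^ 2) ≤ ENNReal.ofReal (devSum p lam M K ω ^ 2)} := by
    intro ω hω
    refine ENNReal.ofReal_le_ofReal ?_
    rw [← sq_abs (devSum p lam M K ω)]
    exact pow_le_pow_left₀ hc.le hω 2
  refine (measure_mono h3).trans ((meas_ge_le_lintegral_div hm.aemeasurable
    (by simpa using hc.ne') ENNReal.ofReal_ne_top).trans ?_)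
  rw [ENNReal.ofReal_div_of_pos (by positivity)]
  gcongr
  refine (lintegral_devSum_sq_le p lam mu M K).trans ?_
  calc (mu : ℝ≥0∞) * (2 * ∑ m ∈ Finset.range K, green p lam (m + 1) 0)
      ≤ mu * (2 * (K * ENNReal.ofReal s)) := by gcongr
    _ = ENNReal.ofReal (2 * mu * s * K) := by
      rw [ENNReal.ofReal_mul (by positivity), ENNReal.ofReal_mul (by positivity),
        ENNReal.ofReal_mul (by positivity), ENNReal.ofReal_natCast, ENNReal.ofReal_coe_nnreal]
      simp
      ring

/-- With high probability, arbitrarily many instructions are used at the origin. -/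
lemma exists_measure_card_roundsAt_le (hd : 1 ≤ d) (hp : AddSubgroup.closure p.support = ⊤)
    (hmu : 1 < mu) (R : ℕ) {ε : ℝ} (hε : 0 < ε) : ∃ M K, noiseLaw p lam mu
      {ω | ((roundsAt M K ω).filter fun a => a.1 = 0).card ≤ R} ≤ ENNReal.ofReal ε := by
  have hmu' : (1 : ℝ) < mu := hmu
  -- The excess is split into four parts: one for truncation to a box, one for the initial
  -- fluctuation, one for the deviations, and one left over to exceed `R`.
  obtain ⟨c, hc, hcmu⟩ : ∃ c : ℝ, 0 < c ∧ (mu : ℝ) = 1 + 4 * c :=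
    ⟨(mu - 1) / 4, by linarith, by ring⟩
  obtain ⟨N, hN⟩ := exists_nat_gt (6 * mu / (c ^ 2 * ε))
  have hN0 : (0 : ℝ) < N := lt_of_le_of_lt (by positivity) hN
  obtain ⟨C, hC⟩ := exists_greenR_le p lam hd hp N (by exact_mod_cast hN0.ne')
  obtain ⟨K, hK⟩ := exists_nat_gt (max C (R / c))
  have hKC : C < K := (le_max_left _ _).trans_lt hK
  have hKR : R < K * c := (div_lt_iff₀ hc).1 ((le_max_right _ _).trans_lt hK)
  have hK0 : (0 : ℝ) < K := pos_of_mul_pos_left ((Nat.cast_nonneg R).trans_lt hKR) hc.le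
  -- `K` exceeds `C`, so `(K + C) / N` is at most `s`; the large `N` makes `s` small compared with
  -- `K`.
  set s : ℝ := 2 * K / N
  have hs : ∀ x, greenR p lam K x ≤ s := fun x => (hC K x).trans (by
    simp only [s]
    gcongr
    linarith)
  obtain ⟨M, hM⟩ := exists_lt_sum_box_greenR p lam K (r := K * (1 + 3 * c) / (1 + 4 * c))
    (by positivity) (by
    rw [div_lt_iff₀ (by positivity)]
    nlinarith)
  refine ⟨M, K, ?_⟩
  set B := (box_finite d M).toFinset
  set S := ∑ x ∈ B, greenR p lam K x
  have hSK : S ≤ K := sum_greenR_le p lam K B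
  have hMS : K * (1 + 3 * c) < mu * S := by
    rw [div_lt_iff₀ (by positivity)] at hM
    rw [hcmu]
    linarith
  have hKc : 0 < K * c := by positivity
  -- Outside the two exceptional events the initial weight exceeds `K * (1 + 2 * c)` and the
  -- deviation exceeds `-K * c`, so more than `K * c > R` instructions are used at the origin.
  have hsub : {ω : Noise d | ((roundsAt M K ω).filter fun a => a.1 = 0).card ≤ R}
      ⊆ (fun ω : Noise d => ω.1) ⁻¹'
          {η | ∑ x ∈ B, greenR p lam K x * η x ≤ mu * S - K * c}
        ∪ {ω | K * c ≤ |devSum p lam M K ω|} := by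
    intro ω hω
    by_contra h
    simp only [Set.mem_union, Set.mem_preimage, Set.mem_ofPred_eq, not_or, not_le] at h hω
    have h1 := sum_greenR_mul_le p lam (source_eq_zero M ω) ω.2.1 K
    have h2 : ∑ x ∈ B, greenR p lam K x * source (box d M) ω x
        = ∑ x ∈ B, greenR p lam K x * ω.1 x := by
      refine Finset.sum_congr rfl fun x hx => ?_
      rw [source, if_pos ((box_finite d M).mem_toFinset.1 hx)]
    rw [h2] at h1
    change ∑ x ∈ B, greenR p lam K x * ω.1 x + devSum p lam M K ω
      ≤ K + (((roundsAt M K ω).filter fun a => a.1 = 0).card : ℝ) at h1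
    have h4 := (abs_lt.1 h.2).1
    have h5 : (((roundsAt M K ω).filter fun a => a.1 = 0).card : ℝ) ≤ R := by exact_mod_cast hω
    linarith [h.1]
  have hmp : MeasurePreserving (fun ω : Noise d => ω.1) (noiseLaw p lam mu)
      (Measure.infinitePi fun _ : Site d => poissonMeasure mu) := measurePreserving_fst
  have hmeas : MeasurableSet
      {η : Site d → ℕ | ∑ x ∈ B, greenR p lam K x * η x ≤ mu * S - K * c} := by
    refine measurableSet_le (Finset.measurable_fun_sum _ fun x _ => ?_) measurable_const
    exact (measurable_from_top (f := fun n : ℕ => greenR p lam K x * (n : ℝ))).comp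
      (measurable_pi_apply x)
  refine (measure_mono hsub).trans ((measure_union_le _ _).trans ?_)
  rw [hmp.measure_preimage hmeas.nullMeasurableSet]
  refine (add_le_add (measure_sum_initial_le mu B (greenR_nonneg p lam K) hs hKc)
    (measure_le_abs_devSum_le p lam M K (hs 0) hKc)).trans ?_
  have hS0 : 0 ≤ S := Finset.sum_nonneg fun x _ => greenR_nonneg p lam K x
  rw [← ENNReal.ofReal_add (by positivity) (by positivity)]
  refine ENNReal.ofReal_le_ofReal ?_
  calc mu * s * S / (K * c) ^ 2 + 2 * mu * s * K / (K * c) ^ 2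
      ≤ mu * s * K / (K * c) ^ 2 + 2 * mu * s * K / (K * c) ^ 2 := by gcongr
    _ = 6 * mu / (c ^ 2 * N) := by
      simp only [s]
      field_simp
      ring
    _ ≤ ε := by
      rw [div_lt_iff₀ (by positivity)] at hN
      rw [div_le_iff₀ (by positivity)]
      linarith

lemma ae_exists_lt_card_roundsAt (hd : 1 ≤ d) (hp : AddSubgroup.closure p.support = ⊤)
    (hmu : 1 < mu) : ∀ᵐ ω ∂noiseLaw p lam mu, ∀ R, ∃ M K,
      R < ((roundsAt M K ω).filter fun a => a.1 = 0).card := by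
  refine ae_all_iff.2 fun R => ?_
  rw [ae_iff]
  refine le_antisymm (ENNReal.le_of_forall_pos_le_add fun ε hε _ => ?_) bot_le
  obtain ⟨M, K, h⟩ := exists_measure_card_roundsAt_le p lam hd hp hmu R (ε := ε) hε
  rw [zero_add, ← ENNReal.ofReal_coe_nnreal]
  refine (measure_mono fun ω hω => ?_).trans h
  simp only [Set.mem_ofPred_eq, not_exists, not_lt] at hω
  exact hω M K

/-- Nonzero displacements have positive probability, so a tail of the stack without any has
probability at most `q ^ k` for all `k`, with `q < 1`. -/
lemma ae_exists_disp_ne_zero (hd : 1 ≤ d) (hp : AddSubgroup.closure p.support = ⊤)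
    (x : Site d) : ∀ᵐ ω ∂noiseLaw p lam mu, ∀ n, ∃ j ≥ n, disp (ω.2.1 (x, j)) ≠ 0 := by
  classical
  obtain ⟨z, hz, hz0⟩ := exists_mem_support_ne_zero hd hp
  set A : Set (Instruction d) := {v | disp v = z}ᶜ
  have hAm : MeasurableSet A := trivial
  have hA : instructionLaw p lam A < 1 := by
    rw [prob_compl_eq_one_sub (show MeasurableSet {v : Instruction d | disp v = z} from trivial)]
    exact ENNReal.sub_lt_self ENNReal.one_ne_top one_ne_zero (instructionLaw_jump_pos lam hz).ne'
  have hmp : MeasurePreserving (fun ω : Noise d => ω.2.1) (noiseLaw p lam mu)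
      (Measure.infinitePi fun _ : Site d × ℕ => instructionLaw p lam) :=
    measurePreserving_fst.comp measurePreserving_snd
  refine ae_all_iff.2 fun n => ?_
  rw [ae_iff]
  have hle : ∀ k : ℕ, noiseLaw p lam mu {ω | ¬ ∃ j ≥ n, disp (ω.2.1 (x, j)) ≠ 0}
      ≤ instructionLaw p lam A ^ k := by
    intro k
    set T : Finset (Site d × ℕ) := (Finset.Ico n (n + k)).image fun j => (x, j)
    have hT : MeasurableSet (Set.pi (T : Set (Site d × ℕ)) fun _ => A) :=
      MeasurableSet.pi T.countable_toSet fun _ _ => hAm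
    have hsub : {ω : Noise d | ¬ ∃ j ≥ n, disp (ω.2.1 (x, j)) ≠ 0}
        ⊆ (fun ω : Noise d => ω.2.1) ⁻¹' Set.pi (T : Set (Site d × ℕ)) fun _ => A := by
      intro ω hω a ha
      obtain ⟨j, hj, rfl⟩ := Finset.mem_image.1 ha
      simp only [Set.mem_ofPred_eq, not_exists, not_and, not_not] at hω
      have h1 := hω j (Finset.mem_Ico.1 hj).1
      intro h2
      exact hz0 (((show disp (ω.2.1 (x, j)) = z from h2)).symm.trans h1)
    refine (measure_mono hsub).trans (le_of_eq ?_)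
    rw [hmp.measure_preimage hT.nullMeasurableSet, Measure.infinitePi_pi _ fun _ _ => hAm,
      Finset.prod_const, Finset.card_image_of_injective _ (Prod.mk_right_injective x),
      Nat.card_Ico, Nat.add_sub_cancel_left]
  exact le_antisymm (ge_of_tendsto' (ENNReal.tendsto_pow_atTop_nhds_zero_of_lt_one hA) hle) bot_le

theorem ae_not_fixates (hd : 1 ≤ d) (hp : AddSubgroup.closure p.support = ⊤) (hmu : 1 < mu) :
    ∀ᵐ ω ∂noiseLaw p lam mu, ¬ Fixates lam ω := by
  filter_upwards [ae_good p lam mu, ae_exists_lt_card_roundsAt p lam hd hp hmu,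
    ae_exists_disp_ne_zero p lam hd hp 0] with ω hgood hcard hdisp
  refine hgood.not_fixates hdisp fun n => ?_
  obtain ⟨M, K, h⟩ := hcard n
  obtain ⟨t, ht0, ht⟩ := hgood.rounds_subset M K
  -- More than `n` instructions at the origin have distinct stack indices, so at least one index is
  -- `n` or larger.
  obtain ⟨a, ha1, ha2, han⟩ : ∃ a ∈ roundsAt M K ω, a.1 = 0 ∧ n ≤ a.2 := by
    by_contra! hlt
    refine absurd h (not_lt.2 ?_)
    rw [← Finset.card_range n]
    refine Finset.card_le_card_of_injOn Prod.snd (fun a ha => ?_) fun a ha b hb hab => ?_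
    · obtain ⟨h1, h2⟩ := Finset.mem_filter.1 ha
      exact Finset.mem_coe.2 (Finset.mem_range.2 (hlt a h1 h2))
    · exact Prod.ext ((Finset.mem_filter.1 ha).2.trans (Finset.mem_filter.1 hb).2.symm) hab
  refine ⟨M, t, ht0, ?_⟩
  have := ht a ha1
  rw [ha2] at this
  omega

end

end

end ARW

end

theorem mainTheorem5 (d : ℕ) (hd : 1 ≤ d) (p : PMF (ARW.Site d))
    (hp : AddSubgroup.closure p.support = ⊤) (lam : ℝ≥0∞) (hlam : 0 < lam) :
    (∀ mu : ℝ≥0, 1 < mu → ∀ᵐ ω ∂(ARW.noiseLaw p lam mu), ¬ ARW.Fixates lam ω) ∧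
      ARW.criticalDensity p lam ≤ 1 := by
  refine ⟨fun mu hmu => ARW.ae_not_fixates p lam hd hp hmu, iSup₂_le fun mu hfix => ?_⟩
  by_contra hmu
  have hmu' : 1 < mu := by exact_mod_cast not_le.1 hmu
  -- Almost sure fixation and almost sure non-fixation cannot both hold under a probability measure.
  obtain ⟨ω, h1, h2⟩ := (hfix.and (ARW.ae_not_fixates p lam hd hp hmu')).exists
  exact h2 h1
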